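/- Let $a>0$, $\gamma>0$, $\alpha\in(0,1)$, $\eta\ge 0$, $b\in\mathbb R\setminus\{0\}$, and put $\kappa(\alpha)=\frac{\sin(\alpha\pi)}{\pi}$, $\mu(\xi)=|\xi|^{\frac{2\alpha-1}{2}}$ for $\xi\in\mathbb R$. Let $H^1_L(0,1)=\{u\in H^1(0,1):u(0)=0\}$ and let $$\mathcal H=H^1_L(0,1)\times L^2(0,1)\times H^1_0(0,1)\times L^2(0,1)\times L^2(\mathbb R)$$ (complex-valued functions) carry the inner product $$\langle (u,v,y,z,\omega),(\tilde u,\tilde v,\tilde y,\tilde z,\tilde\omega)\rangle_{\mathcal H}=\int_0^1\left(v\overline{\tilde v}+u_x\overline{\tilde u_x}+z\overline{\tilde z}+a\,y_x\overline{\tilde y_x}\right)dx+\gamma\kappa(\alpha)\int_{\mathbb R}\omega\,\overline{\tilde\omega}\,d\xi .$$ Let $\mathcal A$ be the unbounded operator on $\mathcal H$ given by $$\mathcal A(u,v,y,z,\omega)=\left(v,\;u_{xx}-bz,\;z,\;a\,y_{xx}+bv,\;-(\xi^2+\eta)\omega+v(1)\mu(\xi)\right),$$ whose domain consists of all $(u,v,y,z,\omega)\in\mathcal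 H$ with $u\in H^2(0,1)\cap H^1_L(0,1)$, $y\in H^2(0,1)\cap H^1_0(0,1)$, $v\in H^1_L(0,1)$, $z\in H^1_0(0,1)$, $-(\xi^2+\eta)\omega+v(1)\mu(\xi)\in L^2(\mathbb R)$, $|\xi|\omega\in L^2(\mathbb R)$ and $u_x(1)+\gamma\kappa(\alpha)\int_{\mathbb R}\mu(\xi)\omega(\xi)\,d\xi=0$. **Theorem.** Assume that $a=1$, $\eta>0$ and $$\text{(SC1)}\qquad b\neq\frac{\pi}{\sqrt2}\,\frac{k_1^2-k_2^2}{\sqrt{k_1^2+k_2^2}}\quad\text{for all }(k_1,k_2)\in\mathbb Z^2\setminus\{(0,0)\}.$$ Then $\mathcal A$ generates a $C_0$-semigroup of contractions $e^{t\mathcal A}$ on $\mathcal H$, and this semigroup is not uniformly (exponentially) stable: there are no constants $M,\delta>0$ such that $\|e^{t\mathcal A}\|\le Me^{-\delta t}$ for all $t\ge0$. Moreover, there is a sequence of pairwise distinct eigenvalues $\lambda_n$ of $\mathcal A$ with $\operatorname{Re}\lambda_n\to0$ as $n\to\infty$. -/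

import Mathlib

open MeasureTheory Set Filter Topology
open scoped ContDiff NNReal

noncomputable section

namespace FracWave

/-! ### Sobolev spaces on the interval `(0,1)` -/

/-- Lebesgue measure on the interval `(0,1)`. -/
abbrev volI : Measure ℝ := volume.restrict (Ioo (0 : ℝ) 1)

/-- The complex space `L²(0,1)`. -/
abbrev L2I : Type := Lp ℂ 2 volI

/-- The complex space `L²(ℝ)`. -/
abbrev L2R : Type := Lp ℂ 2 (volume : Measure ℝ)

/-- `g` is the weak derivative of `u` on `(0,1)`: `∫ φ' u = - ∫ φ g` for every smooth `φ` with
compact support in `(0,1)`. -/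
def HasWeakDeriv (u g : L2I) : Prop :=
  ∀ φ : ℝ → ℝ, ContDiff ℝ ∞ φ → HasCompactSupport φ → tsupport φ ⊆ Ioo (0 : ℝ) 1 →
    ∫ x in Ioo (0 : ℝ) 1, deriv φ x • u x = - ∫ x in Ioo (0 : ℝ) 1, φ x • g x

/-- `u` has a representative that is continuous on `[0,1]` and takes the value `c` at `x₀`. -/
def HasTrace (u : L2I) (x₀ : ℝ) (c : ℂ) : Prop :=
  ∃ F : ℝ → ℂ, ContinuousOn F (Icc (0 : ℝ) 1) ∧ u =ᵐ[volI] F ∧ F x₀ = c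

open Classical in
/-- The weak derivative of `u` (it is `0` when there is none). -/
def wderiv (u : L2I) : L2I := if h : ∃ g, HasWeakDeriv u g then h.choose else 0

open Classical in
/-- The value at `x₀ ∈ [0,1]` of the continuous representative of `u`
(it is `0` when there is none). -/
def trace (x₀ : ℝ) (u : L2I) : ℂ := if h : ∃ c, HasTrace u x₀ c then h.choose else 0

/-! Helper facts: uniqueness of weak derivatives, and functions with a weak derivative are
primitives of it (so that boundary values exist). -/

theorem integrable_coe (u : L2I) : Integrable u volI :=
  (Lp.memLp u).integrable (by norm_num)

theorem integrable_test_smul {w : ℝ → ℂ} (hw : Integrable w volI) {φ : ℝ → ℝ} (hφ : Continuous φ)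
    (hc : HasCompactSupport φ) : Integrable (fun x => φ x • w x) volI :=
  hw.smul_of_top_right (hφ.memLp_top_of_hasCompactSupport hc _)

theorem zero_of_tsupport {φ : ℝ → ℝ} (hs : tsupport φ ⊆ Ioo (0 : ℝ) 1) {x : ℝ}
    (hx : x ∉ Ioo (0 : ℝ) 1) : φ x = 0 :=
  image_eq_zero_of_notMem_tsupport fun h => hx (hs h)

theorem ae_zero_of_test {w : ℝ → ℂ} (hw : Integrable w volI)
    (h : ∀ φ : ℝ → ℝ, ContDiff ℝ ∞ φ → HasCompactSupport φ → tsupport φ ⊆ Ioo (0 : ℝ) 1 →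
      ∫ x in Ioo (0 : ℝ) 1, φ x • w x = 0) : w =ᵐ[volI] 0 := by
  have hL : LocallyIntegrableOn w (Ioo (0 : ℝ) 1) volume :=
    IntegrableOn.locallyIntegrableOn hw
  have := isOpen_Ioo.ae_eq_zero_of_integral_contDiff_smul_eq_zero hL (fun φ h1 h2 h3 => by
    rw [← h φ h1 h2 h3]
    refine (setIntegral_eq_integral_of_forall_compl_eq_zero fun x hx => ?_).symm
    rw [zero_of_tsupport h3 hx, zero_smul])
  exact (ae_restrict_iff' measurableSet_Ioo).2 this

theorem test_deriv_integral {k : ℝ → ℝ} (hk : IntervalIntegrable k volume 0 1) {φ : ℝ → ℝ}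
    (h1 : ContDiff ℝ ∞ φ) (h3 : tsupport φ ⊆ Ioo (0 : ℝ) 1) :
    ∫ x in (0 : ℝ)..1, deriv φ x * (∫ t in (0 : ℝ)..x, k t) = - ∫ x in (0 : ℝ)..1, φ x * k x := by
  have hK := hk.absolutelyContinuousOnInterval_intervalIntegral (c := 0) (by simp)
  have hφ : AbsolutelyContinuousOnInterval φ 0 1 :=
    (h1.of_le (by exact_mod_cast le_top)).contDiffOn.absolutelyContinuousOnInterval
  have e := hK.integral_mul_deriv_eq_deriv_mul hφ
  rw [zero_of_tsupport h3 (x := 1) (by simp), zero_of_tsupport h3 (x := 0) (by simp)] at e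
  have e2 : ∫ x in (0 : ℝ)..1, deriv (fun x => ∫ t in (0 : ℝ)..x, k t) x * φ x
      = ∫ x in (0 : ℝ)..1, φ x * k x := by
    refine intervalIntegral.integral_congr_ae ?_
    filter_upwards [hk.ae_hasDerivAt_integral] with x hx hx'
    rw [(hx (uIoc_subset_uIcc hx') 0 (by simp)).deriv, mul_comm]
  simp only [mul_comm] at e e2 ⊢
  rw [e, e2]; simp

theorem integral_Ioo_eq (w : ℝ → ℂ) : ∫ x in Ioo (0 : ℝ) 1, w x = ∫ x in (0 : ℝ)..1, w x := by
  rw [intervalIntegral.integral_of_le zero_le_one, integral_Ioc_eq_integral_Ioo]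

theorem intervalIntegrable_of {w : ℝ → ℂ} (hw : Integrable w volI) :
    IntervalIntegrable w volume 0 1 := by
  rw [intervalIntegrable_iff_integrableOn_Ioo_of_le zero_le_one]; exact hw

theorem continuousOn_primitive {w : ℝ → ℂ} (hw : Integrable w volI) :
    ContinuousOn (fun x => ∫ t in (0 : ℝ)..x, w t) (Icc (0 : ℝ) 1) := by
  have := intervalIntegral.continuousOn_primitive_interval (μ := volume) (f := w) (a := 0) (b := 1)
    (by rw [uIcc_of_le zero_le_one, integrableOn_Icc_iff_integrableOn_Ioo]; exact hw)
  rwa [uIcc_of_le zero_le_one] at this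

theorem integrable_primitive {w : ℝ → ℂ} (hw : Integrable w volI) :
    Integrable (fun x => ∫ t in (0 : ℝ)..x, w t) volI :=
  ((continuousOn_primitive hw).integrableOn_Icc).mono_set Ioo_subset_Icc_self

theorem test_primitive {g : ℝ → ℂ} (hg : Integrable g volI) {φ : ℝ → ℝ}
    (h1 : ContDiff ℝ ∞ φ) (h2 : HasCompactSupport φ) (h3 : tsupport φ ⊆ Ioo (0 : ℝ) 1) :
    ∫ x in Ioo (0 : ℝ) 1, deriv φ x • (∫ t in (0 : ℝ)..x, g t)
      = - ∫ x in Ioo (0 : ℝ) 1, φ x • g x := by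
  have hgi := intervalIntegrable_of hg
  have hI1 := intervalIntegrable_of (integrable_test_smul (integrable_primitive hg)
    (h1.continuous_deriv (by simp)) h2.deriv)
  have hI2 := intervalIntegrable_of (integrable_test_smul hg h1.continuous h2)
  have key : ∀ L : ℂ →L[ℝ] ℝ, L (∫ x in (0 : ℝ)..1, deriv φ x • (∫ t in (0 : ℝ)..x, g t))
      = L (- ∫ x in (0 : ℝ)..1, φ x • g x) := by
    intro L
    have hk : IntervalIntegrable (fun x => L (g x)) volume 0 1 :=
      ⟨L.integrable_comp hgi.1, L.integrable_comp hgi.2⟩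
    rw [map_neg, ← L.intervalIntegral_comp_comm hI1, ← L.intervalIntegral_comp_comm hI2]
    have := test_deriv_integral hk h1 h3
    simp only [map_smul, smul_eq_mul]
    rw [← this]
    refine intervalIntegral.integral_congr fun x hx => ?_
    rw [uIcc_of_le zero_le_one] at hx
    rw [L.intervalIntegral_comp_comm]
    exact hgi.mono_set (by rw [uIcc_of_le hx.1, uIcc_of_le zero_le_one]; exact Icc_subset_Icc_right hx.2)
  rw [integral_Ioo_eq, integral_Ioo_eq]
  exact Complex.ext (key Complex.reCLM) (key Complex.imCLM)

theorem exists_bump : ∃ θ : ℝ → ℝ, ContDiff ℝ ∞ θ ∧ HasCompactSupport θ ∧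
    tsupport θ ⊆ Ioo (0 : ℝ) 1 ∧ ∫ x, θ x = 1 := by
  let c : ContDiffBump (1 / 2 : ℝ) := ⟨1 / 8, 1 / 4, by norm_num, by norm_num⟩
  refine ⟨c.normed volume, c.contDiff_normed, c.hasCompactSupport_normed, ?_, c.integral_normed⟩
  rw [c.tsupport_normed_eq, Real.closedBall_eq_Icc]
  exact Icc_subset_Ioo (by norm_num) (by norm_num)

theorem exists_antideriv {ψ : ℝ → ℝ} (h1 : ContDiff ℝ ∞ ψ) (h2 : HasCompactSupport ψ)
    (h3 : tsupport ψ ⊆ Ioo (0 : ℝ) 1) (h4 : ∫ x, ψ x = 0) :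
    ∃ φ : ℝ → ℝ, ContDiff ℝ ∞ φ ∧ HasCompactSupport φ ∧ tsupport φ ⊆ Ioo (0 : ℝ) 1 ∧
      deriv φ = ψ := by
  have hint : Integrable ψ := h1.continuous.integrable_of_hasCompactSupport h2
  let φ : ℝ → ℝ := fun x => ∫ t in (0 : ℝ)..x, ψ t
  have hd : ∀ x, HasDerivAt φ (ψ x) x := fun x =>
    intervalIntegral.integral_hasDerivAt_right (hint.intervalIntegrable)
      (h1.continuous.stronglyMeasurableAtFilter _ _) h1.continuous.continuousAt
  have hder : deriv φ = ψ := funext fun x => (hd x).deriv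
  have hcd : ContDiff ℝ ∞ φ := by
    rw [contDiff_infty_iff_deriv]
    exact ⟨fun x => (hd x).differentiableAt, by rw [hder]; exact h1⟩
  -- a compact interval containing the support
  obtain ⟨p, q, hp, hq, hsub⟩ : ∃ p q : ℝ, 0 < p ∧ q < 1 ∧ tsupport ψ ⊆ Icc p q := by
    by_cases hne : (tsupport ψ).Nonempty
    · have hcpt : IsCompact (tsupport ψ) := h2
      exact ⟨sInf (tsupport ψ), sSup (tsupport ψ), (h3 (hcpt.sInf_mem hne)).1,
        (h3 (hcpt.sSup_mem hne)).2, fun x hx =>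
          ⟨csInf_le hcpt.bddBelow hx, le_csSup hcpt.bddAbove hx⟩⟩
    · rw [not_nonempty_iff_eq_empty] at hne
      exact ⟨1 / 2, 1 / 2, by norm_num, by norm_num, by rw [hne]; exact empty_subset _⟩
  have hz : ∀ x, x ∉ Icc p q → ψ x = 0 := fun x hx =>
    image_eq_zero_of_notMem_tsupport fun h => hx (hsub h)
  have hsupp : Function.support φ ⊆ Icc p q := by
    intro x hx
    by_contra hn
    apply hx
    rw [mem_Icc, not_and_or, not_le, not_le] at hn
    rcases hn with hn | hn
    · refine (intervalIntegral.integral_congr (g := fun _ => (0 : ℝ)) fun t ht => ?_).trans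
        (by simp)
      refine hz t fun h => ?_
      rcases le_total 0 x with h0 | h0
      · rw [uIcc_of_le h0] at ht; linarith [ht.2, h.1]
      · rw [uIcc_of_ge h0] at ht; linarith [ht.2, h.1]
    · have e0 : ∫ t in Iic x, ψ t = ∫ t, ψ t :=
        setIntegral_eq_integral_of_forall_compl_eq_zero fun t ht =>
          hz t fun h => ht (show t ≤ x by linarith [h.2])
      have e1 : ∫ t in Iic (0 : ℝ), ψ t = 0 :=
        setIntegral_eq_zero_of_forall_eq_zero fun t ht =>
          hz t fun h => by have : t ≤ 0 := ht; linarith [h.1]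
      have := intervalIntegral.integral_Iic_sub_Iic (μ := volume) (f := ψ) (a := 0) (b := x)
        hint.integrableOn hint.integrableOn
      show ∫ t in (0 : ℝ)..x, ψ t = 0
      rw [← this, e0, e1, h4, sub_zero]
  have hts : tsupport φ ⊆ Icc p q := closure_minimal hsupp isClosed_Icc
  exact ⟨φ, hcd, HasCompactSupport.of_support_subset_isCompact isCompact_Icc hsupp,
    hts.trans (Icc_subset_Ioo hp hq), hder⟩

theorem ae_const_of_test {w : ℝ → ℂ} (hw : Integrable w volI)
    (h : ∀ φ : ℝ → ℝ, ContDiff ℝ ∞ φ → HasCompactSupport φ → tsupport φ ⊆ Ioo (0 : ℝ) 1 →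
      ∫ x in Ioo (0 : ℝ) 1, deriv φ x • w x = 0) : ∃ c : ℂ, w =ᵐ[volI] fun _ => c := by
  obtain ⟨θ, t1, t2, t3, t4⟩ := exists_bump
  set c : ℂ := ∫ x in Ioo (0 : ℝ) 1, θ x • w x with hc
  refine ⟨c, ?_⟩
  have hwc : Integrable (fun x => w x - c) volI := hw.sub (integrable_const c)
  have := ae_zero_of_test hwc fun ψ p1 p2 p3 => by
    have hm2 : HasCompactSupport (fun x => (∫ t, ψ t) * θ x) := t2.mul_left
    have hm3 : tsupport (fun x => (∫ t, ψ t) * θ x) ⊆ Ioo (0 : ℝ) 1 :=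
      (tsupport_mul_subset_right (f := fun _ => ∫ t, ψ t)).trans t3
    obtain ⟨φ, f1, f2, f3, f4⟩ := exists_antideriv (ψ := fun x => ψ x - (∫ t, ψ t) * θ x)
      (p1.sub (contDiff_const.mul t1)) (p2.sub hm2)
      ((tsupport_sub _ _).trans (union_subset p3 hm3)) (by
        rw [integral_sub (μ := volume) (p1.continuous.integrable_of_hasCompactSupport p2)
          (show Integrable (fun x => (∫ t, ψ t) * θ x) from
            (continuous_const.mul t1.continuous).integrable_of_hasCompactSupport hm2),
          integral_const_mul, t4]; ring)
    have e := h φ f1 f2 f3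
    rw [f4] at e
    have hψ : ∫ x in Ioo (0 : ℝ) 1, ψ x = ∫ x, ψ x :=
      setIntegral_eq_integral_of_forall_compl_eq_zero fun x hx => zero_of_tsupport p3 hx
    have i1 := integrable_test_smul hw p1.continuous p2
    have i2 := integrable_test_smul hw t1.continuous t2
    have i3 : Integrable (fun x => ψ x • c) volI :=
      integrable_test_smul (integrable_const c) p1.continuous p2
    simp only [sub_smul, mul_smul] at e
    rw [integral_sub i1 (show Integrable (fun x => (∫ t, ψ t) • θ x • w x) volI from
      i2.smul (∫ t, ψ t)), integral_smul, sub_eq_zero] at e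
    simp only [smul_sub]
    rw [integral_sub i1 i3, e, integral_smul_const, hψ, sub_self]
  filter_upwards [this] with x hx
  exact sub_eq_zero.1 hx
theorem HasWeakDeriv.add {u g v h : L2I} (hu : HasWeakDeriv u g) (hv : HasWeakDeriv v h) :
    HasWeakDeriv (u + v) (g + h) := by
  intro φ h1 h2 h3
  have e1 : ∫ x in Ioo (0 : ℝ) 1, deriv φ x • (u + v : L2I) x
      = ∫ x in Ioo (0 : ℝ) 1, (deriv φ x • u x + deriv φ x • v x) := by
    refine integral_congr_ae ?_
    filter_upwards [Lp.coeFn_add u v] with x hx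
    rw [hx, Pi.add_apply, smul_add]
  have e2 : ∫ x in Ioo (0 : ℝ) 1, φ x • (g + h : L2I) x
      = ∫ x in Ioo (0 : ℝ) 1, (φ x • g x + φ x • h x) := by
    refine integral_congr_ae ?_
    filter_upwards [Lp.coeFn_add g h] with x hx
    rw [hx, Pi.add_apply, smul_add]
  have hd := h1.continuous_deriv (by simp)
  rw [e1, e2, integral_add (integrable_test_smul (integrable_coe u) hd h2.deriv)
      (integrable_test_smul (integrable_coe v) hd h2.deriv),
    integral_add (integrable_test_smul (integrable_coe g) h1.continuous h2)
      (integrable_test_smul (integrable_coe h) h1.continuous h2),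
    hu φ h1 h2 h3, hv φ h1 h2 h3, neg_add]

theorem HasWeakDeriv.smul {u g : L2I} (c : ℂ) (hu : HasWeakDeriv u g) :
    HasWeakDeriv (c • u) (c • g) := by
  intro φ h1 h2 h3
  have e1 : ∫ x in Ioo (0 : ℝ) 1, deriv φ x • (c • u : L2I) x
      = ∫ x in Ioo (0 : ℝ) 1, c • (deriv φ x • u x) := by
    refine integral_congr_ae ?_
    filter_upwards [Lp.coeFn_smul c u] with x hx
    rw [hx, Pi.smul_apply, smul_comm]
  have e2 : ∫ x in Ioo (0 : ℝ) 1, φ x • (c • g : L2I) x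
      = ∫ x in Ioo (0 : ℝ) 1, c • (φ x • g x) := by
    refine integral_congr_ae ?_
    filter_upwards [Lp.coeFn_smul c g] with x hx
    rw [hx, Pi.smul_apply, smul_comm]
  rw [e1, e2, integral_smul, integral_smul, hu φ h1 h2 h3, smul_neg]

theorem HasWeakDeriv.unique {u g h : L2I} (hg : HasWeakDeriv u g) (hh : HasWeakDeriv u h) :
    g = h := by
  have hw : Integrable (fun x => g x - h x) volI := (integrable_coe g).sub (integrable_coe h)
  have := ae_zero_of_test hw fun φ h1 h2 h3 => by
    simp only [smul_sub]
    rw [integral_sub (integrable_test_smul (integrable_coe g) h1.continuous h2)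
      (integrable_test_smul (integrable_coe h) h1.continuous h2), sub_eq_zero]
    exact neg_injective ((hg φ h1 h2 h3).symm.trans (hh φ h1 h2 h3))
  refine Lp.ext ?_
  filter_upwards [this] with x hx
  exact sub_eq_zero.1 hx

/-- A function with a weak derivative is, almost everywhere, a constant plus the primitive of its
weak derivative. -/
theorem HasWeakDeriv.ae_eq_primitive {u g : L2I} (hu : HasWeakDeriv u g) :
    ∃ c : ℂ, u =ᵐ[volI] fun x => c + ∫ t in (0 : ℝ)..x, g t := by
  have hP := integrable_primitive (integrable_coe g)
  have hw : Integrable (fun x => u x - ∫ t in (0 : ℝ)..x, g t) volI := (integrable_coe u).sub hP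
  obtain ⟨c, hc⟩ := ae_const_of_test hw fun φ h1 h2 h3 => by
    have hd := h1.continuous_deriv (by simp)
    simp only [smul_sub]
    rw [integral_sub (integrable_test_smul (integrable_coe u) hd h2.deriv)
      (integrable_test_smul hP hd h2.deriv), hu φ h1 h2 h3,
      test_primitive (integrable_coe g) h1 h2 h3, sub_self]
  refine ⟨c, ?_⟩
  filter_upwards [hc] with x hx
  exact sub_eq_iff_eq_add.1 hx

theorem HasWeakDeriv.exists_trace {u g : L2I} (hu : HasWeakDeriv u g) (x₀ : ℝ) :
    ∃ c, HasTrace u x₀ c := by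
  obtain ⟨c, hc⟩ := hu.ae_eq_primitive
  exact ⟨_, _, continuousOn_const.add (continuousOn_primitive (integrable_coe g)), hc, rfl⟩

theorem HasTrace.unique {u : L2I} {x₀ : ℝ} (hx : x₀ ∈ Icc (0 : ℝ) 1) {c d : ℂ}
    (hc : HasTrace u x₀ c) (hd : HasTrace u x₀ d) : c = d := by
  obtain ⟨F, hF, hFu, rfl⟩ := hc
  obtain ⟨G, hG, hGu, rfl⟩ := hd
  have h1 : F =ᵐ[volume.restrict (Icc (0 : ℝ) 1)] G := by
    rw [← restrict_Ioo_eq_restrict_Icc]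
    exact hFu.symm.trans hGu
  exact Measure.eqOn_Icc_of_ae_eq volume zero_ne_one h1 hF hG hx

theorem HasTrace.add {u v : L2I} {x₀ : ℝ} {c d : ℂ}
    (hc : HasTrace u x₀ c) (hd : HasTrace v x₀ d) : HasTrace (u + v) x₀ (c + d) := by
  obtain ⟨F, hF, hFu, rfl⟩ := hc
  obtain ⟨G, hG, hGu, rfl⟩ := hd
  refine ⟨fun x => F x + G x, hF.add hG, ?_, rfl⟩
  filter_upwards [Lp.coeFn_add u v, hFu, hGu] with x h1 h2 h3
  rw [h1, Pi.add_apply, h2, h3]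

theorem HasTrace.smul {u : L2I} {x₀ : ℝ} {c : ℂ} (k : ℂ)
    (hc : HasTrace u x₀ c) : HasTrace (k • u) x₀ (k • c) := by
  obtain ⟨F, hF, hFu, rfl⟩ := hc
  refine ⟨fun x => k • F x, hF.const_smul k, ?_, rfl⟩
  filter_upwards [Lp.coeFn_smul k u, hFu] with x h1 h2
  rw [h1, Pi.smul_apply, h2]

theorem HasWeakDeriv.wderiv_eq {u g : L2I} (hu : HasWeakDeriv u g) : wderiv u = g := by
  have h : ∃ g, HasWeakDeriv u g := ⟨g, hu⟩
  rw [wderiv, dif_pos h]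
  exact h.choose_spec.unique hu

theorem HasTrace.trace_eq {u : L2I} {x₀ : ℝ} (hx : x₀ ∈ Icc (0 : ℝ) 1) {c : ℂ}
    (hc : HasTrace u x₀ c) : trace x₀ u = c := by
  have h : ∃ c, HasTrace u x₀ c := ⟨c, hc⟩
  rw [trace, dif_pos h]
  exact h.choose_spec.unique hx hc

/-- The Sobolev space `H¹(0,1)`. -/
def H1 : Submodule ℂ L2I where
  carrier := {u | ∃ g, HasWeakDeriv u g}
  add_mem' := fun ⟨g, hg⟩ ⟨h, hh⟩ => ⟨g + h, hg.add hh⟩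
  zero_mem' := ⟨0, fun φ _ _ _ => by
    have h0 : ((0 : L2I) : ℝ → ℂ) =ᵐ[volI] 0 := Lp.coeFn_zero _ _ _
    have e1 : ∫ x in Ioo (0 : ℝ) 1, deriv φ x • (0 : L2I) x = 0 :=
      integral_eq_zero_of_ae (h0.mono fun x hx => by simp only [hx, Pi.zero_apply, smul_zero])
    have e2 : ∫ x in Ioo (0 : ℝ) 1, φ x • (0 : L2I) x = 0 :=
      integral_eq_zero_of_ae (h0.mono fun x hx => by simp only [hx, Pi.zero_apply, smul_zero])
    rw [e1, e2, neg_zero]⟩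
  smul_mem' := fun c _ ⟨g, hg⟩ => ⟨c • g, hg.smul c⟩

theorem hasWeakDeriv_wderiv {u : L2I} (hu : u ∈ H1) : HasWeakDeriv u (wderiv u) := by
  obtain ⟨g, hg⟩ := hu
  rwa [hg.wderiv_eq]

theorem hasTrace_trace {u : L2I} (hu : u ∈ H1) {x₀ : ℝ} (hx : x₀ ∈ Icc (0 : ℝ) 1) :
    HasTrace u x₀ (trace x₀ u) := by
  obtain ⟨c, hc⟩ := (hasWeakDeriv_wderiv hu).exists_trace x₀
  rwa [hc.trace_eq hx]

theorem wderiv_add {u v : L2I} (hu : u ∈ H1) (hv : v ∈ H1) :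
    wderiv (u + v) = wderiv u + wderiv v :=
  ((hasWeakDeriv_wderiv hu).add (hasWeakDeriv_wderiv hv)).wderiv_eq

theorem wderiv_smul (c : ℂ) {u : L2I} (hu : u ∈ H1) : wderiv (c • u) = c • wderiv u :=
  ((hasWeakDeriv_wderiv hu).smul c).wderiv_eq

theorem trace_add {u v : L2I} (hu : u ∈ H1) (hv : v ∈ H1) {x₀ : ℝ} (hx : x₀ ∈ Icc (0 : ℝ) 1) :
    trace x₀ (u + v) = trace x₀ u + trace x₀ v :=
  ((hasTrace_trace hu hx).add (hasTrace_trace hv hx)).trace_eq hx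

theorem trace_smul (c : ℂ) {u : L2I} (hu : u ∈ H1) {x₀ : ℝ} (hx : x₀ ∈ Icc (0 : ℝ) 1) :
    trace x₀ (c • u) = c * trace x₀ u :=
  ((hasTrace_trace hu hx).smul c).trace_eq hx

theorem zero_mem_Icc : (0 : ℝ) ∈ Icc (0 : ℝ) 1 := left_mem_Icc.2 zero_le_one

theorem one_mem_Icc : (1 : ℝ) ∈ Icc (0 : ℝ) 1 := right_mem_Icc.2 zero_le_one

theorem trace_zero {x₀ : ℝ} (hx : x₀ ∈ Icc (0 : ℝ) 1) : trace x₀ (0 : L2I) = 0 := by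
  have := trace_smul 0 H1.zero_mem hx
  rwa [zero_smul, zero_mul] at this

theorem eq_zero_of_wderiv {u : L2I} (hu : u ∈ H1) (h0 : trace 0 u = 0) (hd : wderiv u = 0) :
    u = 0 := by
  have hw := hasWeakDeriv_wderiv hu
  rw [hd] at hw
  obtain ⟨c, hc⟩ := hw.ae_eq_primitive
  have hint : ∀ x ∈ Ioo (0 : ℝ) 1, ∫ t in (0 : ℝ)..x, (0 : L2I) t = 0 := fun x hx => by
    rw [intervalIntegral.integral_of_le hx.1.le]
    refine integral_eq_zero_of_ae ?_
    have h1 : ((0 : L2I) : ℝ → ℂ) =ᵐ[volume.restrict (Ioc (0 : ℝ) 1)] 0 := by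
      rw [← restrict_Ioo_eq_restrict_Ioc]
      exact Lp.coeFn_zero _ _ _
    exact ae_restrict_of_ae_restrict_of_subset (Ioc_subset_Ioc_right hx.2.le) h1
  have hc' : u =ᵐ[volI] fun _ => c := by
    filter_upwards [hc, ae_restrict_mem measurableSet_Ioo] with x h1 h2
    rw [h1, hint x h2, add_zero]
  have ht : HasTrace u 0 c := ⟨fun _ => c, continuousOn_const, hc', rfl⟩
  rw [ht.trace_eq zero_mem_Icc] at h0
  refine Lp.ext ?_
  filter_upwards [hc', Lp.coeFn_zero ℂ 2 volI] with x h1 h2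
  rw [h1, h2, h0, Pi.zero_apply]

/-- `H¹_L(0,1) = {u ∈ H¹(0,1) : u(0) = 0}`. -/
def H1L : Submodule ℂ L2I where
  carrier := {u | u ∈ H1 ∧ trace 0 u = 0}
  add_mem' := fun ⟨hu, hu0⟩ ⟨hv, hv0⟩ =>
    ⟨H1.add_mem hu hv, by rw [trace_add hu hv zero_mem_Icc, hu0, hv0, add_zero]⟩
  zero_mem' := ⟨H1.zero_mem, trace_zero zero_mem_Icc⟩
  smul_mem' := fun c _ ⟨hu, hu0⟩ =>
    ⟨H1.smul_mem c hu, by rw [trace_smul c hu zero_mem_Icc, hu0, mul_zero]⟩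

/-- `H¹₀(0,1) = {u ∈ H¹(0,1) : u(0) = u(1) = 0}`. -/
def H10 : Submodule ℂ L2I where
  carrier := {u | u ∈ H1 ∧ trace 0 u = 0 ∧ trace 1 u = 0}
  add_mem' := fun ⟨hu, hu0, hu1⟩ ⟨hv, hv0, hv1⟩ =>
    ⟨H1.add_mem hu hv, by rw [trace_add hu hv zero_mem_Icc, hu0, hv0, add_zero],
      by rw [trace_add hu hv one_mem_Icc, hu1, hv1, add_zero]⟩
  zero_mem' := ⟨H1.zero_mem, trace_zero zero_mem_Icc, trace_zero one_mem_Icc⟩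
  smul_mem' := fun c _ ⟨hu, hu0, hu1⟩ =>
    ⟨H1.smul_mem c hu, by rw [trace_smul c hu zero_mem_Icc, hu0, mul_zero],
      by rw [trace_smul c hu one_mem_Icc, hu1, mul_zero]⟩

/-- The Sobolev space `H²(0,1)`. -/
def H2 : Submodule ℂ L2I where
  carrier := {u | u ∈ H1 ∧ wderiv u ∈ H1}
  add_mem' := fun ⟨hu, hu'⟩ ⟨hv, hv'⟩ =>
    ⟨H1.add_mem hu hv, by rw [wderiv_add hu hv]; exact H1.add_mem hu' hv'⟩
  zero_mem' := ⟨H1.zero_mem, by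
    have := wderiv_smul 0 H1.zero_mem
    rw [zero_smul, zero_smul] at this
    rw [this]; exact H1.zero_mem⟩
  smul_mem' := fun c _ ⟨hu, hu'⟩ =>
    ⟨H1.smul_mem c hu, by rw [wderiv_smul c hu]; exact H1.smul_mem c hu'⟩

/-! ### The parameters, the energy space and the operator -/

/-- The coefficients of the system: the ratio `a` of the wave speeds, the damping coefficient `γ`,
the order `α` and the weight `η` of the fractional derivative, the coupling parameter `b`. -/
structure Params where
  a : ℝ
  γ : ℝ
  α : ℝ
  η : ℝ
  b : ℝ
  a_pos : 0 < a
  γ_pos : 0 < γ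
  α_pos : 0 < α
  α_lt_one : α < 1
  η_nonneg : 0 ≤ η
  b_ne_zero : b ≠ 0

/-- `κ(α) = sin(απ)/π`. -/
def Params.κ (p : Params) : ℝ := Real.sin (p.α * Real.pi) / Real.pi

/-- `μ(ξ) = |ξ|^((2α-1)/2)`. -/
def Params.μ (p : Params) (ξ : ℝ) : ℝ := |ξ| ^ ((2 * p.α - 1) / 2)

theorem Params.κ_pos (p : Params) : 0 < p.κ :=
  div_pos (Real.sin_pos_of_pos_of_lt_pi (mul_pos p.α_pos Real.pi_pos)
    (by nlinarith [p.α_lt_one, Real.pi_pos])) Real.pi_pos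

/-- The energy space `H¹_L(0,1) × L²(0,1) × H¹₀(0,1) × L²(0,1) × L²(ℝ)` of elements
`(u, v, y, z, ω)`. -/
def EnergySpace (_p : Params) : Type := H1L × L2I × H10 × L2I × L2R

namespace EnergySpace

variable {p : Params}

instance : AddCommGroup (EnergySpace p) :=
  inferInstanceAs (AddCommGroup (H1L × L2I × H10 × L2I × L2R))

instance : Module ℂ (EnergySpace p) :=
  inferInstanceAs (Module ℂ (H1L × L2I × H10 × L2I × L2R))

/-- The element `(u, v, y, z, ω)`. -/
def mk (u : H1L) (v : L2I) (y : H10) (z : L2I) (w : L2R) : EnergySpace p := (u, v, y, z, w)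

/-- The component `u`. -/
def u (U : EnergySpace p) : L2I := (U.1 : L2I)
/-- The component `v`. -/
def v (U : EnergySpace p) : L2I := U.2.1
/-- The component `y`. -/
def y (U : EnergySpace p) : L2I := (U.2.2.1 : L2I)
/-- The component `z`. -/
def z (U : EnergySpace p) : L2I := U.2.2.2.1
/-- The component `ω`. -/
def w (U : EnergySpace p) : L2R := U.2.2.2.2

theorem u_mem (U : EnergySpace p) : U.u ∈ H1L := U.1.2
theorem y_mem (U : EnergySpace p) : U.y ∈ H10 := U.2.2.1.2

theorem ext {U V : EnergySpace p} (h1 : U.u = V.u) (h2 : U.v = V.v) (h3 : U.y = V.y)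
    (h4 : U.z = V.z) (h5 : U.w = V.w) : U = V :=
  Prod.ext (Subtype.ext h1) (Prod.ext h2 (Prod.ext (Subtype.ext h3) (Prod.ext h4 h5)))

theorem add_u (U V : EnergySpace p) : (U + V).u = U.u + V.u := rfl
theorem add_v (U V : EnergySpace p) : (U + V).v = U.v + V.v := rfl
theorem add_y (U V : EnergySpace p) : (U + V).y = U.y + V.y := rfl
theorem add_z (U V : EnergySpace p) : (U + V).z = U.z + V.z := rfl
theorem add_w (U V : EnergySpace p) : (U + V).w = U.w + V.w := rfl
theorem smul_u (c : ℂ) (U : EnergySpace p) : (c • U).u = c • U.u := rfl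
theorem smul_v (c : ℂ) (U : EnergySpace p) : (c • U).v = c • U.v := rfl
theorem smul_y (c : ℂ) (U : EnergySpace p) : (c • U).y = c • U.y := rfl
theorem smul_z (c : ℂ) (U : EnergySpace p) : (c • U).z = c • U.z := rfl
theorem smul_w (c : ℂ) (U : EnergySpace p) : (c • U).w = c • U.w := rfl
theorem zero_u : (0 : EnergySpace p).u = 0 := rfl
theorem zero_v : (0 : EnergySpace p).v = 0 := rfl
theorem zero_y : (0 : EnergySpace p).y = 0 := rfl
theorem zero_z : (0 : EnergySpace p).z = 0 := rfl
theorem zero_w : (0 : EnergySpace p).w = 0 := rfl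

/-- The energy inner product
`∫₀¹ (v̄ ṽ + ū_x ũ_x + z̄ z̃ + a ȳ_x ỹ_x) dx + γ κ(α) ∫_ℝ ω̄ ω̃ dξ`, conjugate-linear in the
first argument. -/
@[reducible]
def innerCore (p : Params) : InnerProductSpace.Core ℂ (EnergySpace p) where
  inner U V := inner ℂ U.v V.v + inner ℂ (wderiv U.u) (wderiv V.u) + inner ℂ U.z V.z
    + (p.a : ℂ) * inner ℂ (wderiv U.y) (wderiv V.y) + ((p.γ * p.κ : ℝ) : ℂ) * inner ℂ U.w V.w
  conj_inner_symm U V := by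
    simp only [map_add, map_mul, Complex.conj_ofReal, inner_conj_symm]
  re_inner_nonneg U := by
    have h1 := p.a_pos
    have h2 := mul_pos p.γ_pos p.κ_pos
    simp only [inner_self_eq_norm_sq_to_K]
    simp only [Complex.coe_algebraMap, ← Complex.ofReal_pow, ← Complex.ofReal_mul,
      ← Complex.ofReal_add, RCLike.re_to_complex, Complex.ofReal_re]
    positivity
  add_left U V W := by
    simp only [add_u, add_v, add_y, add_z, add_w, wderiv_add U.u_mem.1 V.u_mem.1,
      wderiv_add U.y_mem.1 V.y_mem.1, inner_add_left]
    ring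
  smul_left U V c := by
    simp only [smul_u, smul_v, smul_y, smul_z, smul_w, wderiv_smul c U.u_mem.1,
      wderiv_smul c U.y_mem.1, inner_smul_left]
    ring
  definite U h := by
    have h1 := p.a_pos
    have h2 := mul_pos p.γ_pos p.κ_pos
    simp only [inner_self_eq_norm_sq_to_K] at h
    simp only [Complex.coe_algebraMap, ← Complex.ofReal_pow, ← Complex.ofReal_mul,
      ← Complex.ofReal_add, Complex.ofReal_eq_zero] at h
    have a1 := sq_nonneg ‖U.v‖
    have a2 := sq_nonneg ‖wderiv U.u‖
    have a3 := sq_nonneg ‖U.z‖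
    have a4 := mul_nonneg h1.le (sq_nonneg ‖wderiv U.y‖)
    have a5 := mul_nonneg h2.le (sq_nonneg ‖U.w‖)
    have b1 : ‖U.v‖ ^ 2 = 0 := by linarith
    have b2 : ‖wderiv U.u‖ ^ 2 = 0 := by linarith
    have b3 : ‖U.z‖ ^ 2 = 0 := by linarith
    have b4 : p.a * ‖wderiv U.y‖ ^ 2 = 0 := by linarith
    have b5 : p.γ * p.κ * ‖U.w‖ ^ 2 = 0 := by linarith
    simp only [mul_eq_zero, h1.ne', h2.ne', false_or, pow_eq_zero_iff two_ne_zero, norm_eq_zero] at b1 b2 b3 b4 b5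
    exact ext (eq_zero_of_wderiv U.u_mem.1 U.u_mem.2 b2) b1
      (eq_zero_of_wderiv U.y_mem.1 U.y_mem.2.1 b4) b3 b5

instance : NormedAddCommGroup (EnergySpace p) := (innerCore p).toNormedAddCommGroup

instance : InnerProductSpace ℂ (EnergySpace p) := InnerProductSpace.ofCore (innerCore p).toCore

end EnergySpace

variable (p : Params)

/-- The function `ξ ↦ -(ξ² + η) ω(ξ) + v(1) μ(ξ)`. -/
def diffusion (U : EnergySpace p) (ξ : ℝ) : ℂ :=
  -((ξ ^ 2 + p.η : ℝ) : ℂ) * U.w ξ + trace 1 U.v * (p.μ ξ : ℂ)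

/-- The conditions that define the domain of the operator. -/
structure InDomain (U : EnergySpace p) : Prop where
  u_mem : U.u ∈ H2
  y_mem : U.y ∈ H2
  v_mem : U.v ∈ H1L
  z_mem : U.z ∈ H10
  diffusion_memLp : MemLp (diffusion p U) 2 volume
  boundary : trace 1 (wderiv U.u) + (p.γ * p.κ : ℝ) * ∫ ξ : ℝ, (p.μ ξ : ℂ) * U.w ξ = 0
  abs_mul_memLp : MemLp (fun ξ : ℝ => ((|ξ| : ℝ) : ℂ) * U.w ξ) 2 volume

theorem memLp_μ_div : MemLp (fun ξ : ℝ => ((p.μ ξ / (1 + |ξ|) : ℝ) : ℂ)) 2 volume := by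
  have hm : Measurable (fun ξ : ℝ => p.μ ξ / (1 + |ξ|)) := by
    unfold Params.μ; fun_prop
  have hm' : AEStronglyMeasurable (fun ξ : ℝ => ((p.μ ξ / (1 + |ξ|) : ℝ) : ℂ)) volume :=
    (Complex.measurable_ofReal.comp hm).aestronglyMeasurable
  rw [memLp_two_iff_integrable_sq_norm hm']
  have h0 := p.α_pos
  have h1 := p.α_lt_one
  let f : ℝ → ℝ := fun r => (r ^ ((2 * p.α - 1) / 2) / (1 + r)) ^ 2
  have hf : ∀ ξ : ℝ, ‖((p.μ ξ / (1 + |ξ|) : ℝ) : ℂ)‖ ^ 2 = f |ξ| := fun ξ => by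
    rw [Complex.norm_real, Real.norm_eq_abs, sq_abs]; rfl
  simp only [hf]
  have hfm : Measurable f := by fun_prop
  have hsq : ∀ r : ℝ, 0 < r → f r = r ^ (2 * p.α - 1) / (1 + r) ^ 2 := fun r hr => by
    simp only [f]
    rw [div_pow, ← Real.rpow_natCast, ← Real.rpow_mul hr.le]
    norm_num
  have hIoc : IntegrableOn f (Ioc 0 1) := by
    have hi : IntegrableOn (fun r : ℝ => r ^ (2 * p.α - 1)) (Ioc 0 1) :=
      (intervalIntegrable_iff_integrableOn_Ioc_of_le zero_le_one).1
        (intervalIntegral.intervalIntegrable_rpow' (by linarith))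
    refine hi.mono' hfm.aestronglyMeasurable ?_
    refine ae_restrict_of_forall_mem measurableSet_Ioc fun r hr => ?_
    have hr0 : 0 < r := hr.1
    rw [Real.norm_eq_abs, abs_of_nonneg (sq_nonneg _), hsq r hr0]
    exact div_le_self (Real.rpow_nonneg hr0.le _) (by nlinarith)
  have hIoi1 : IntegrableOn f (Ioi 1) := by
    have hi : IntegrableOn (fun r : ℝ => r ^ (2 * p.α - 3)) (Ioi 1) :=
      integrableOn_Ioi_rpow_of_lt (by linarith) zero_lt_one
    refine hi.mono' hfm.aestronglyMeasurable ?_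
    refine ae_restrict_of_forall_mem measurableSet_Ioi fun r hr => ?_
    have hr0 : 0 < r := zero_lt_one.trans hr
    rw [Real.norm_eq_abs, abs_of_nonneg (sq_nonneg _), hsq r hr0, div_le_iff₀ (by positivity)]
    have e : r ^ (2 * p.α - 1) = r ^ (2 * p.α - 3) * r ^ 2 := by
      rw [← Real.rpow_natCast, ← Real.rpow_add hr0]; norm_num; ring_nf
    rw [e]
    exact mul_le_mul_of_nonneg_left (by nlinarith) (Real.rpow_nonneg hr0.le _)
  have hIoi : IntegrableOn (fun ξ : ℝ => f |ξ|) (Ioi 0) := by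
    have : IntegrableOn f (Ioi 0) := by
      rw [← Ioc_union_Ioi_eq_Ioi zero_le_one]; exact hIoc.union hIoi1
    refine this.congr_fun (fun ξ hξ => ?_) measurableSet_Ioi
    simp only [abs_of_pos (show (0 : ℝ) < ξ from hξ)]
  have hIic : IntegrableOn (fun ξ : ℝ => f |ξ|) (Iic 0) := by
    rw [← Measure.map_neg_eq_self (volume : Measure ℝ)]
    have m : MeasurableEmbedding fun x : ℝ => -x := (Homeomorph.neg ℝ).measurableEmbedding
    rw [m.integrableOn_map_iff]
    simp_rw [Function.comp_def, abs_neg, neg_preimage, neg_Iic, neg_zero]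
    exact Iff.mpr integrableOn_Ici_iff_integrableOn_Ioi hIoi
  rw [← integrableOn_univ, ← Iic_union_Ioi (a := (0 : ℝ))]
  exact hIic.union hIoi

variable {p} in
/-- On the domain, the integral in the boundary condition converges. -/
theorem InDomain.integrable_μ_mul {U : EnergySpace p} (hU : InDomain p U) :
    Integrable (fun ξ : ℝ => (p.μ ξ : ℂ) * U.w ξ) volume := by
  have h1 : MemLp (fun ξ : ℝ => U.w ξ + ((|ξ| : ℝ) : ℂ) * U.w ξ) 2 volume :=
    (Lp.memLp U.w).add hU.abs_mul_memLp
  refine (MemLp.integrable_mul (memLp_μ_div p) h1).congr (ae_of_all _ fun ξ => ?_)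
  have hne : ((1 : ℂ) + ((|ξ| : ℝ) : ℂ)) ≠ 0 := by
    have : (0 : ℝ) < 1 + |ξ| := by positivity
    exact_mod_cast this.ne'
  simp only [Pi.mul_apply, Complex.ofReal_div, Complex.ofReal_add, Complex.ofReal_one]
  field_simp

variable {p} in
theorem diffusion_add {U V : EnergySpace p} (hU : U.v ∈ H1) (hV : V.v ∈ H1) :
    diffusion p (U + V) =ᵐ[volume] fun ξ => diffusion p U ξ + diffusion p V ξ := by
  filter_upwards [Lp.coeFn_add U.w V.w] with ξ h
  rw [diffusion, EnergySpace.add_w, h, EnergySpace.add_v, trace_add hU hV one_mem_Icc,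
    Pi.add_apply, diffusion, diffusion]
  ring

variable {p} in
theorem diffusion_smul (c : ℂ) {U : EnergySpace p} (hU : U.v ∈ H1) :
    diffusion p (c • U) =ᵐ[volume] fun ξ => c * diffusion p U ξ := by
  filter_upwards [Lp.coeFn_smul c U.w] with ξ h
  rw [diffusion, EnergySpace.smul_w, h, EnergySpace.smul_v, trace_smul c hU one_mem_Icc,
    Pi.smul_apply, diffusion, smul_eq_mul]
  ring

variable {p} in
theorem InDomain.add {U V : EnergySpace p} (hU : InDomain p U) (hV : InDomain p V) :
    InDomain p (U + V) where
  u_mem := H2.add_mem hU.u_mem hV.u_mem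
  y_mem := H2.add_mem hU.y_mem hV.y_mem
  v_mem := H1L.add_mem hU.v_mem hV.v_mem
  z_mem := H10.add_mem hU.z_mem hV.z_mem
  diffusion_memLp := (hU.diffusion_memLp.add hV.diffusion_memLp).ae_eq
    (diffusion_add hU.v_mem.1 hV.v_mem.1).symm
  boundary := by
    have e : ∫ ξ : ℝ, (p.μ ξ : ℂ) * (U + V).w ξ
        = (∫ ξ : ℝ, (p.μ ξ : ℂ) * U.w ξ) + ∫ ξ : ℝ, (p.μ ξ : ℂ) * V.w ξ := by
      rw [← integral_add hU.integrable_μ_mul hV.integrable_μ_mul]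
      refine integral_congr_ae ?_
      filter_upwards [Lp.coeFn_add U.w V.w] with ξ h
      rw [EnergySpace.add_w, h, Pi.add_apply, mul_add]
    rw [e, EnergySpace.add_u, wderiv_add hU.u_mem.1 hV.u_mem.1,
      trace_add hU.u_mem.2 hV.u_mem.2 one_mem_Icc]
    linear_combination hU.boundary + hV.boundary
  abs_mul_memLp := (hU.abs_mul_memLp.add hV.abs_mul_memLp).ae_eq (by
    filter_upwards [Lp.coeFn_add U.w V.w] with ξ h
    rw [EnergySpace.add_w, h, Pi.add_apply, Pi.add_apply, mul_add])

variable {p} in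
theorem InDomain.smul (c : ℂ) {U : EnergySpace p} (hU : InDomain p U) : InDomain p (c • U) where
  u_mem := H2.smul_mem c hU.u_mem
  y_mem := H2.smul_mem c hU.y_mem
  v_mem := H1L.smul_mem c hU.v_mem
  z_mem := H10.smul_mem c hU.z_mem
  diffusion_memLp := (hU.diffusion_memLp.const_mul c).ae_eq (diffusion_smul c hU.v_mem.1).symm
  boundary := by
    have e : ∫ ξ : ℝ, (p.μ ξ : ℂ) * (c • U).w ξ = c * ∫ ξ : ℝ, (p.μ ξ : ℂ) * U.w ξ := by
      rw [← integral_const_mul]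
      refine integral_congr_ae ?_
      filter_upwards [Lp.coeFn_smul c U.w] with ξ h
      rw [EnergySpace.smul_w, h, Pi.smul_apply, smul_eq_mul, mul_left_comm]
    rw [e, EnergySpace.smul_u, wderiv_smul c hU.u_mem.1, trace_smul c hU.u_mem.2 one_mem_Icc]
    linear_combination c * hU.boundary
  abs_mul_memLp := (hU.abs_mul_memLp.const_mul c).ae_eq (by
    filter_upwards [Lp.coeFn_smul c U.w] with ξ h
    rw [EnergySpace.smul_w, h, Pi.smul_apply, smul_eq_mul, mul_left_comm])

theorem InDomain.zero : InDomain p 0 := by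
  have h0 : ((0 : EnergySpace p).w : ℝ → ℂ) =ᵐ[volume] 0 := Lp.coeFn_zero _ _ _
  have ht : trace 1 (0 : EnergySpace p).v = 0 := trace_zero one_mem_Icc
  have hd : wderiv (0 : EnergySpace p).u = 0 := by
    have := wderiv_smul 0 H1.zero_mem
    rwa [zero_smul, zero_smul] at this
  refine ⟨H2.zero_mem, H2.zero_mem, H1L.zero_mem, H10.zero_mem, ?_, ?_, ?_⟩
  · refine (MemLp.zero (ε := ℂ)).ae_eq ?_
    filter_upwards [h0] with ξ h
    simp [diffusion, h, ht]
  · rw [hd, trace_zero one_mem_Icc, zero_add, integral_eq_zero_of_ae, mul_zero]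
    filter_upwards [h0] with ξ h
    simp [h]
  · refine (MemLp.zero (ε := ℂ)).ae_eq ?_
    filter_upwards [h0] with ξ h
    simp [h]

/-- The domain of the operator, as a subspace of the energy space. -/
def waveDomain : Submodule ℂ (EnergySpace p) where
  carrier := {U | InDomain p U}
  add_mem' := fun hU hV => hU.add hV
  zero_mem' := InDomain.zero p
  smul_mem' := fun c _ hU => hU.smul c

variable {p} in
/-- `A U = (v, u_xx - b z, z, a y_xx + b v, -(ξ² + η) ω + v(1) μ)` for `U = (u, v, y, z, ω)` in the
domain. -/
def waveVal (U : EnergySpace p) (hU : InDomain p U) : EnergySpace p :=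
  EnergySpace.mk
    ⟨U.v, hU.v_mem⟩
    (wderiv (wderiv U.u) - (p.b : ℂ) • U.z)
    ⟨U.z, hU.z_mem⟩
    ((p.a : ℂ) • wderiv (wderiv U.y) + (p.b : ℂ) • U.v)
    (hU.diffusion_memLp.toLp (diffusion p U))

section

variable {p}

theorem waveVal_u (U : EnergySpace p) (hU : InDomain p U) : (waveVal U hU).u = U.v := rfl
theorem waveVal_v (U : EnergySpace p) (hU : InDomain p U) :
    (waveVal U hU).v = wderiv (wderiv U.u) - (p.b : ℂ) • U.z := rfl
theorem waveVal_y (U : EnergySpace p) (hU : InDomain p U) : (waveVal U hU).y = U.z := rfl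
theorem waveVal_z (U : EnergySpace p) (hU : InDomain p U) :
    (waveVal U hU).z = (p.a : ℂ) • wderiv (wderiv U.y) + (p.b : ℂ) • U.v := rfl
theorem waveVal_w (U : EnergySpace p) (hU : InDomain p U) :
    (waveVal U hU).w = hU.diffusion_memLp.toLp (diffusion p U) := rfl

theorem waveVal_add (U V : EnergySpace p) (hU : InDomain p U) (hV : InDomain p V) :
    waveVal (U + V) (hU.add hV) = waveVal U hU + waveVal V hV := by
  refine EnergySpace.ext ?_ ?_ ?_ ?_ ?_
  · rw [EnergySpace.add_u, waveVal_u, waveVal_u, waveVal_u, EnergySpace.add_v]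
  · rw [EnergySpace.add_v, waveVal_v, waveVal_v, waveVal_v, EnergySpace.add_u, EnergySpace.add_z,
      wderiv_add hU.u_mem.1 hV.u_mem.1, wderiv_add hU.u_mem.2 hV.u_mem.2, smul_add]
    abel
  · rw [EnergySpace.add_y, waveVal_y, waveVal_y, waveVal_y, EnergySpace.add_z]
  · rw [EnergySpace.add_z, waveVal_z, waveVal_z, waveVal_z, EnergySpace.add_y, EnergySpace.add_v,
      wderiv_add hU.y_mem.1 hV.y_mem.1, wderiv_add hU.y_mem.2 hV.y_mem.2, smul_add, smul_add]
    abel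
  · rw [EnergySpace.add_w, waveVal_w, waveVal_w, waveVal_w, ← MemLp.toLp_add]
    exact MemLp.toLp_congr _ _ (diffusion_add hU.v_mem.1 hV.v_mem.1)

theorem waveVal_smul (c : ℂ) (U : EnergySpace p) (hU : InDomain p U) :
    waveVal (c • U) (hU.smul c) = c • waveVal U hU := by
  refine EnergySpace.ext ?_ ?_ ?_ ?_ ?_
  · rw [EnergySpace.smul_u, waveVal_u, waveVal_u, EnergySpace.smul_v]
  · rw [EnergySpace.smul_v, waveVal_v, waveVal_v, EnergySpace.smul_u, EnergySpace.smul_z,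
      wderiv_smul c hU.u_mem.1, wderiv_smul c hU.u_mem.2, smul_sub, smul_comm c (p.b : ℂ)]
  · rw [EnergySpace.smul_y, waveVal_y, waveVal_y, EnergySpace.smul_z]
  · rw [EnergySpace.smul_z, waveVal_z, waveVal_z, EnergySpace.smul_y, EnergySpace.smul_v,
      wderiv_smul c hU.y_mem.1, wderiv_smul c hU.y_mem.2, smul_add, smul_comm c (p.b : ℂ),
      smul_comm c (p.a : ℂ)]
  · rw [EnergySpace.smul_w, waveVal_w, waveVal_w, ← MemLp.toLp_const_smul]
    exact MemLp.toLp_congr _ _ (diffusion_smul c hU.v_mem.1)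

end

/-- The unbounded operator `A` on the energy space. -/
def waveOp : EnergySpace p →ₗ.[ℂ] EnergySpace p where
  domain := waveDomain p
  toFun :=
    { toFun := fun U => waveVal (U : EnergySpace p) U.2
      map_add' := fun U V => waveVal_add (U : EnergySpace p) V U.2 V.2
      map_smul' := fun c U => waveVal_smul c (U : EnergySpace p) U.2 }

/-! ### Semigroups -/

section Semigroup

variable {E : Type*} [NormedAddCommGroup E] [NormedSpace ℂ E]

/-- `T` is a strongly continuous semigroup of bounded operators. -/
structure IsC0Semigroup (T : ℝ≥0 → E →L[ℂ] E) : Prop where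
  map_zero : T 0 = ContinuousLinearMap.id ℂ E
  map_add : ∀ s t, T (s + t) = (T s).comp (T t)
  tendsto_zero : ∀ x, Tendsto (fun t => T t x) (𝓝 0) (𝓝 x)

/-- `A` is the infinitesimal generator of `T`: `x ∈ D(A)` and `A x = y` if and only if
`(T h x - x) / h → y` as `h → 0⁺`. -/
def IsGenerator (A : E →ₗ.[ℂ] E) (T : ℝ≥0 → E →L[ℂ] E) : Prop :=
  ∀ x y : E, (x, y) ∈ A.graph ↔
    Tendsto (fun h : ℝ≥0 => (((h : ℝ) : ℂ)⁻¹) • (T h x - x)) (𝓝[>] 0) (𝓝 y)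

/-- Uniform (exponential) stability: `‖T t‖ ≤ M e^{-δ t}` for all `t ≥ 0`, with some `M` and
some `δ > 0`. -/
def UniformlyStable (T : ℝ≥0 → E →L[ℂ] E) : Prop :=
  ∃ M δ : ℝ, 0 < δ ∧ ∀ t : ℝ≥0, ‖T t‖ ≤ M * Real.exp (-δ * t)

/-- `lam` is an eigenvalue of the unbounded operator `A`. -/
def IsEigenvalue (A : E →ₗ.[ℂ] E) (lam : ℂ) : Prop :=
  ∃ x : A.domain, (x : E) ≠ 0 ∧ A x = lam • (x : E)

end Semigroup

/-- The condition `b ≠ (π/√2) (k₁² - k₂²)/√(k₁² + k₂²)` for all integers `k₁`, `k₂`,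
not both zero. -/
def Params.SC1 : Prop :=
  ∀ k₁ k₂ : ℤ, ¬ (k₁ = 0 ∧ k₂ = 0) →
    p.b ≠ Real.pi / √2 * (((k₁ : ℝ) ^ 2 - (k₂ : ℝ) ^ 2) / √((k₁ : ℝ) ^ 2 + (k₂ : ℝ) ^ 2))

end FracWave

end

/-!
The generation part is the Lumer–Phillips theorem, proved here for Hilbert spaces by Yosida
approximation (`IsDissipative.exists_semigroup`). The operator is dissipative
(`waveOp_dissipative`): after an integration by parts the coupling terms cancel, and the boundary
condition at `1` turns the remaining boundary term into one that the diffusion equation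
compensates, which leaves `-γ κ ∫ (ξ² + η) |ω|²`.

For the resolvent and the spectrum the assumption `a = 1` is decisive: `P = u + iy` and
`Q = u - iy` solve scalar equations `P'' = (λ² - ibλ) P` and `Q'' = (λ² + ibλ) Q`, coupled only by
the two conditions at `x = 1`. With `s₁² = λ² - ibλ` and `s₂² = λ² + ibλ`, these conditions become
a `2 × 2` linear system for the coefficients of `sinh (s₁ x)` and `sinh (s₂ x)`, whose determinant
is `charDet`. If it vanishes, `λ` is an eigenvalue (`isEigenvalue_of_charDet_eq_zero`); if not,
`λ - A` is onto (`exists_resolvent_of_charDet_ne_zero`). A positive number is not an eigenvalue of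
a dissipative operator, so `r - A` is onto for every `r > 0` (`waveOp_surjective`).

As `λ → i∞` in a vertical strip, `s₁ ≈ λ - ib/2` and `s₂ ≈ λ + ib/2`, while the feedback symbol
`∫ μ² / (λ + ξ² + η) dξ` tends to `0`. Hence `charDet / λ` differs from
`sinh (s₁ + s₂) ≈ sinh (2λ)` by a quantity that tends to `0` (`tendsto_charFun_sub`). Since
`sinh (2λ)` vanishes at `iπm`, a quantitative open mapping theorem gives a zero of `charDet` in any
small disc around `iπm` once `m` is large (`exists_eigenvalue_near_imaginary_axis`).

Exponential stability is thereby excluded: on an eigenvector the semigroup acts as `e^{λt}`, so a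
bound `‖T t‖ ≤ M e^{-δt}` forces `Re λ ≤ -δ` for every eigenvalue (`exists_pos_re_eigenvalue_le`).
-/

namespace FracWave

/-! ### Semigroups of contractions on Hilbert spaces -/

section LumerPhillips

variable {E : Type*} [NormedAddCommGroup E] [InnerProductSpace ℂ E]

theorem hasDerivAt_exp_smul_apply [CompleteSpace E] (B : E →L[ℂ] E) (x : E) (t : ℝ) :
    HasDerivAt (fun s : ℝ => NormedSpace.exp (s • B) x) (NormedSpace.exp (t • B) (B x)) t := by
  have h := hasDerivAt_exp_smul_const (𝕂 := ℝ) B t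
  exact ((ContinuousLinearMap.apply ℂ E x).restrictScalars ℝ).hasFDerivAt.comp_hasDerivAt t h

/-- The exponential of a dissipative bounded operator is a contraction, because
`‖e^{sB} x‖²` has the derivative `2 Re ⟪B e^{sB} x, e^{sB} x⟫ ≤ 0`. -/
theorem norm_exp_apply_le [CompleteSpace E] {B : E →L[ℂ] E}
    (hB : ∀ x, (inner ℂ (B x) x).re ≤ 0) (x : E) : ‖NormedSpace.exp B x‖ ≤ ‖x‖ := by
  let f : ℝ → E := fun s => NormedSpace.exp (s • B) x
  have hf : ∀ s, HasDerivAt f (B (f s)) s := fun s => by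
    have h := hasDerivAt_exp_smul_const' (𝕂 := ℝ) B s
    exact ((ContinuousLinearMap.apply ℂ E x).restrictScalars ℝ).hasFDerivAt.comp_hasDerivAt s h
  have hg : ∀ s, HasDerivAt (fun s => ‖f s‖ ^ 2) (2 * (inner ℂ (B (f s)) (f s)).re) s := fun s => by
    have h1 := (hf s).inner ℂ (hf s)
    have h2 := Complex.reCLM.hasFDerivAt.comp_hasDerivAt s h1
    refine (h2.congr_deriv ?_).congr_of_eventuallyEq (Eventually.of_forall fun s => ?_)
    · rw [map_add, ← inner_conj_symm (f s) (B (f s))]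
      simp only [Complex.reCLM_apply, Complex.conj_re]; ring
    · simp only [Function.comp, Complex.reCLM_apply]
      exact (inner_self_eq_norm_sq (𝕜 := ℂ) (f s)).symm
  have hanti : Antitone fun s => ‖f s‖ ^ 2 :=
    antitone_of_hasDerivAt_nonpos hg fun s => mul_nonpos_of_nonneg_of_nonpos zero_le_two (hB (f s))
  have h01 := hanti zero_le_one
  simp only [f, zero_smul, one_smul, NormedSpace.exp_zero, one_apply_eq_self] at h01
  exact (sq_le_sq₀ (norm_nonneg _) (norm_nonneg _)).1 h01

theorem re_inner_smul_apply_nonpos {B : E →L[ℂ] E} (hB : ∀ x, (inner ℂ (B x) x).re ≤ 0)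
    {t : ℝ} (ht : 0 ≤ t) (x : E) : (inner ℂ ((t • B) x) x).re ≤ 0 := by
  rw [smul_apply, ← Complex.coe_smul, inner_smul_left, Complex.conj_ofReal,
    Complex.re_ofReal_mul]
  exact mul_nonpos_of_nonneg_of_nonpos ht (hB x)

/-- Two commuting dissipative bounded operators: the semigroups differ by at most `t ‖B x - C x‖`.
The path `s ↦ e^{sB + (t - s)C} x` joins them, and each of its points is the exponential of a
dissipative operator. -/
theorem norm_exp_sub_exp_le [CompleteSpace E] {B C : E →L[ℂ] E} (hBC : Commute B C)
    (hB : ∀ x, (inner ℂ (B x) x).re ≤ 0) (hC : ∀ x, (inner ℂ (C x) x).re ≤ 0)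
    {t : ℝ} (ht : 0 ≤ t) (x : E) :
    ‖NormedSpace.exp (t • B) x - NormedSpace.exp (t • C) x‖ ≤ t * ‖B x - C x‖ := by
  have hcom : ∀ s : ℝ, Commute (t • C) (s • (B - C)) := fun s =>
    ((hBC.symm.sub_right (Commute.refl C)).smul_left t).smul_right s
  have hexp : ∀ s : ℝ, NormedSpace.exp (t • C) * NormedSpace.exp (s • (B - C))
      = NormedSpace.exp (s • B + (t - s) • C) := fun s => by
    let _ : NormedAlgebra ℚ (E →L[ℂ] E) := .restrictScalars ℚ ℝ _
    rw [← NormedSpace.exp_add_of_commute (hcom s)]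
    congr 1
    module
  have hdis : ∀ s ∈ Icc 0 t, ∀ z, ‖NormedSpace.exp (s • B + (t - s) • C) z‖ ≤ ‖z‖ := by
    intro s hs z
    refine norm_exp_apply_le (fun w => ?_) z
    rw [add_apply, inner_add_left, Complex.add_re]
    have h1 := re_inner_smul_apply_nonpos hB hs.1 w
    have h2 := re_inner_smul_apply_nonpos hC (sub_nonneg.2 hs.2) w
    linarith
  have hd : ∀ s : ℝ, HasDerivAt (fun s : ℝ => NormedSpace.exp (s • B + (t - s) • C) x)
      (NormedSpace.exp (s • B + (t - s) • C) ((B - C) x)) s := fun s => by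
    have h := ((NormedSpace.exp (t • C)).restrictScalars ℝ).hasFDerivAt.comp_hasDerivAt s
      (hasDerivAt_exp_smul_apply (B - C) x s)
    simp only [← hexp]
    exact h
  have := norm_image_sub_le_of_norm_deriv_le_segment' (a := 0) (b := t) (C := ‖B x - C x‖)
    (fun s _ => (hd s).hasDerivWithinAt) (fun s hs => hdis s ⟨hs.1, hs.2.le⟩ _) t ⟨ht, le_rfl⟩
  simpa [mul_comm] using this

/-- An operator is dissipative when `Re ⟪A x, x⟫ ≤ 0` on its domain. -/
def IsDissipative (A : E →ₗ.[ℂ] E) : Prop :=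
  ∀ x : A.domain, (inner ℂ (A x) (x : E)).re ≤ 0

/-- Dissipativity bounds `r - A` below by `r`; this gives both injectivity and the resolvent
estimate. -/
theorem IsDissipative.mul_norm_le {A : E →ₗ.[ℂ] E} (hA : IsDissipative A) {r : ℝ}
    (x : A.domain) : r * ‖(x : E)‖ ≤ ‖(r : ℂ) • (x : E) - A x‖ := by
  rcases (norm_nonneg (x : E)).eq_or_lt with h0 | h0
  · rw [← h0, mul_zero]; exact norm_nonneg _
  refine le_of_mul_le_mul_right ?_ h0
  have h1 : (inner ℂ ((r : ℂ) • (x : E) - A x) (x : E)).re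
      ≤ ‖(r : ℂ) • (x : E) - A x‖ * ‖(x : E)‖ :=
    re_inner_le_norm (𝕜 := ℂ) _ _
  have h2 : (inner ℂ ((r : ℂ) • (x : E) - A x) (x : E)).re
      = r * ‖(x : E)‖ ^ 2 - (inner ℂ (A x) (x : E)).re := by
    rw [inner_sub_left, inner_smul_left, Complex.conj_ofReal, Complex.sub_re,
      Complex.re_ofReal_mul]
    congr 2
    exact inner_self_eq_norm_sq (𝕜 := ℂ) (x : E)
  have := hA x
  nlinarith

variable {A : E →ₗ.[ℂ] E}

/-- The range of a positive real shift of a dissipative operator `A` being everything, the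
resolvent `(r - A)⁻¹` is a bounded operator. -/
theorem IsDissipative.exists_resolvent (hA : IsDissipative A) {r : ℝ} (hr : 0 < r)
    (hsurj : ∀ y, ∃ x : A.domain, (r : ℂ) • (x : E) - A x = y) :
    ∃ R : E →L[ℂ] E, (∀ y, r * ‖R y‖ ≤ ‖y‖) ∧
      (∀ x : A.domain, R ((r : ℂ) • (x : E) - A x) = x) ∧
      ∀ y, ∃ x : A.domain, (x : E) = R y ∧ (r : ℂ) • (x : E) - A x = y := by
  choose g hg using hsurj
  have hinj : ∀ x y : A.domain, (r : ℂ) • (x : E) - A x = (r : ℂ) • (y : E) - A y → x = y := by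
    intro x y h
    have h1 := hA.mul_norm_le (r := r) (x - y)
    rw [LinearPMap.map_sub, Submodule.coe_sub, smul_sub, sub_sub_sub_comm, h, sub_self,
      norm_zero] at h1
    have h2 : ‖(x : E) - y‖ = 0 := by
      by_contra hne
      have := mul_pos hr ((norm_nonneg _).lt_of_ne' hne)
      linarith
    exact Subtype.ext (sub_eq_zero.1 (norm_eq_zero.1 h2))
  let R0 : E →ₗ[ℂ] E :=
    { toFun := fun y => g y
      map_add' := fun y z => by
        rw [← Submodule.coe_add, SetLike.coe_eq_coe]
        refine hinj _ _ ?_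
        rw [hg, LinearPMap.map_add, Submodule.coe_add, smul_add, add_sub_add_comm, hg, hg]
      map_smul' := fun c y => by
        rw [RingHom.id_apply, ← Submodule.coe_smul, SetLike.coe_eq_coe]
        refine hinj _ _ ?_
        rw [hg, LinearPMap.map_smul, Submodule.coe_smul, smul_comm, ← smul_sub, hg] }
  have hb : ∀ y, r * ‖R0 y‖ ≤ ‖y‖ := fun y => by
    have := hA.mul_norm_le (r := r) (g y)
    rwa [hg] at this
  refine ⟨R0.mkContinuous r⁻¹ fun y => ?_, hb, fun x => ?_, fun y => ⟨g y, rfl, hg y⟩⟩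
  · rw [inv_mul_eq_div, le_div_iff₀ hr, mul_comm]; exact hb y
  · show ((g _ : A.domain) : E) = x
    rw [SetLike.coe_eq_coe]
    exact hinj _ _ (hg _)

/-- In a Hilbert space the domain is automatically dense: if `x` is orthogonal to it and
`x = d - A d`, then `‖d‖² = Re ⟪A d, d⟫ ≤ 0`, so `x = 0`. -/
theorem IsDissipative.dense_domain [CompleteSpace E] (hA : IsDissipative A)
    (hsurj : ∀ y, ∃ x : A.domain, (x : E) - A x = y) : Dense (A.domain : Set E) := by
  rw [Submodule.dense_iff_topologicalClosure_eq_top,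
    Submodule.topologicalClosure_eq_top_iff, Submodule.eq_bot_iff]
  intro x hx
  obtain ⟨d, hd⟩ := hsurj x
  have h1 := Submodule.inner_right_of_mem_orthogonal d.2 hx
  rw [← hd, inner_sub_right, sub_eq_zero] at h1
  have h2 := hA d
  rw [← inner_conj_symm, ← h1, Complex.conj_re] at h2
  have h3 : (inner ℂ (d : E) (d : E)).re = ‖(d : E)‖ ^ 2 := inner_self_eq_norm_sq (𝕜 := ℂ) _
  have h4 : (d : E) = 0 := norm_eq_zero.1 (by nlinarith [norm_nonneg (d : E)])
  have h5 : d = 0 := Subtype.ext h4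
  rw [← hd, h5, LinearPMap.map_zero, Submodule.coe_zero, sub_zero]

/-- Convergence to the identity of contractions passes from a dense set to the whole space. -/
theorem tendsto_of_dense {E ι : Type*} [NormedAddCommGroup E] {l : Filter ι}
    {S : ι → E → E} {D : Set E} (hD : Dense D)
    (hS : ∀ᶠ i in l, ∀ x y, ‖S i x - S i y‖ ≤ ‖x - y‖)
    (h : ∀ x ∈ D, Tendsto (fun i => S i x) l (𝓝 x)) (x : E) : Tendsto (fun i => S i x) l (𝓝 x) := by
  rw [Metric.tendsto_nhds]
  intro ε hε
  obtain ⟨d, hd, hdD⟩ := Metric.dense_iff.1 hD x (ε / 3) (by positivity)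
  filter_upwards [hS, Metric.tendsto_nhds.1 (h d hdD) (ε / 3) (by positivity)] with i h1 h2
  rw [dist_eq_norm] at h2 ⊢
  rw [Metric.mem_ball, dist_eq_norm] at hd
  have h3 := h1 x d
  rw [norm_sub_rev] at hd
  have e : S i x - x = (S i x - S i d) + (S i d - d) - (x - d) := by abel
  rw [e]
  calc _ ≤ ‖S i x - S i d‖ + ‖S i d - d‖ + ‖x - d‖ :=
        (norm_sub_le _ _).trans (by gcongr; exact norm_add_le _ _)
    _ < ε := by linarith

/-- The Yosida approximation of a dissipative operator with full range conditions:
`B n = r A (r - A)⁻¹ = r (r (r - A)⁻¹ - 1)` with `r = n + 1`. -/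
theorem IsDissipative.exists_yosida [CompleteSpace E] (hA : IsDissipative A)
    (hsurj : ∀ r : ℝ, 0 < r → ∀ y, ∃ x : A.domain, (r : ℂ) • (x : E) - A x = y) :
    ∃ B : ℕ → E →L[ℂ] E, (∀ n x, (inner ℂ (B n x) x).re ≤ 0) ∧ (∀ m n, Commute (B m) (B n)) ∧
      (∀ n (x : A.domain), ‖B n x‖ ≤ ‖A x‖) ∧
      ∀ x : A.domain, Tendsto (fun n => B n x) atTop (𝓝 (A x)) := by
  obtain ⟨r, hr, hrlim⟩ : ∃ r : ℕ → ℝ, (∀ n, 0 < r n) ∧ Tendsto r atTop atTop :=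
    ⟨fun n => n + 1, fun n => n.cast_add_one_pos,
      tendsto_atTop_add_const_right _ _ tendsto_natCast_atTop_atTop⟩
  have hres := fun n : ℕ => hA.exists_resolvent (hr n) (hsurj _ (hr n))
  choose R hR1 hR2 hR3 using hres
  -- the resolvent identity
  have hid : ∀ m n y, R m y - R n y = ((r n : ℂ) - r m) • R m (R n y) := by
    intro m n y
    obtain ⟨a, ha, ha'⟩ := hR3 m y
    obtain ⟨c, hc, hc'⟩ := hR3 n y
    rw [← ha, ← hc, ← Submodule.coe_sub, ← hR2 m (a - c), ← map_smul]
    congr 1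
    rw [LinearPMap.map_sub, Submodule.coe_sub]
    have e1 : A a = (r m : ℂ) • (a : E) - y := by rw [← ha']; abel
    have e2 : A c = (r n : ℂ) • (c : E) - y := by rw [← hc']; abel
    rw [e1, e2]
    module
  have hcomm : ∀ m n, Commute (R m) (R n) := by
    intro m n
    by_cases h : r n = r m
    · have : R m = R n := by
        ext y
        have := hid m n y
        rwa [h, sub_self, zero_smul, sub_eq_zero] at this
      rw [this]
    · have hne : ((r n : ℂ) - r m) ≠ 0 := by
        rw [sub_ne_zero]; exact_mod_cast h
      refine ContinuousLinearMap.ext fun y => ?_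
      have h1 := hid m n y
      have h2 := hid n m y
      have h3 : ((r n : ℂ) - r m) • (R m (R n y) - R n (R m y)) = 0 := by
        rw [smul_sub, ← h1, ← neg_sub (r m : ℂ), neg_smul, ← h2]; abel
      exact sub_eq_zero.1 ((smul_eq_zero.1 h3).resolve_left hne)
  have hmul : ∀ n (x : A.domain), (r n : ℂ) • R n x - x = R n (A x) := fun n x => by
    have := hR2 n x
    rw [map_sub, map_smul] at this
    exact sub_eq_iff_eq_add.2 ((sub_eq_iff_eq_add.1 this).trans (add_comm _ _))
  have hnorm : ∀ n y, ‖(r n : ℂ) • R n y‖ ≤ ‖y‖ := fun n y => by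
    rw [norm_smul, Complex.norm_real, Real.norm_of_nonneg (hr n).le]
    exact hR1 n y
  have hdense : Dense (A.domain : Set E) := hA.dense_domain fun y => by
    obtain ⟨x, hx⟩ := hsurj 1 one_pos y
    exact ⟨x, by simpa using hx⟩
  -- `r (r - A)⁻¹ z → z`, first on the domain, then everywhere
  have hone : ∀ z, Tendsto (fun n => (r n : ℂ) • R n z) atTop (𝓝 z) := by
    refine tendsto_of_dense hdense (Eventually.of_forall fun n x y => ?_) fun d hd => ?_
    · rw [← smul_sub, ← map_sub]; exact hnorm n _
    · rw [tendsto_iff_norm_sub_tendsto_zero]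
      have hlim : Tendsto (fun n : ℕ => ‖A ⟨d, hd⟩‖ / r n) atTop (𝓝 0) :=
        tendsto_const_nhds.div_atTop hrlim
      refine squeeze_zero (fun _ => norm_nonneg _) (fun n => ?_) hlim
      have := hmul n ⟨d, hd⟩
      simp only at this
      rw [this, le_div_iff₀ (hr n), mul_comm]
      exact hR1 n _
  refine ⟨fun n => (r n : ℂ) • ((r n : ℂ) • R n - 1), fun n y => ?_, fun m n => ?_, fun n x => ?_,
    fun x => ?_⟩
  · obtain ⟨x, hx, hx'⟩ := hR3 n y
    have e1 : ((r n : ℂ) • ((r n : ℂ) • R n - 1)) y = (r n : ℂ) • A x := by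
      simp only [smul_apply, sub_apply, one_apply_eq_self]
      rw [← hx, ← hx']; congr 1; abel
    rw [e1]
    have e2 : y = (r n : ℂ) • (x : E) - A x := hx'.symm
    rw [e2, inner_smul_left, Complex.conj_ofReal, Complex.re_ofReal_mul, inner_sub_right,
      inner_smul_right, Complex.sub_re, Complex.re_ofReal_mul]
    have h3 : (inner ℂ (A x) (A x)).re = ‖A x‖ ^ 2 := inner_self_eq_norm_sq (𝕜 := ℂ) _
    have := mul_nonpos_of_nonneg_of_nonpos (hr n).le (hA x)
    refine mul_nonpos_of_nonneg_of_nonpos (hr n).le ?_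
    rw [h3]; nlinarith [sq_nonneg ‖A x‖]
  · refine Commute.smul_left (Commute.smul_right ?_ _) _
    exact (((hcomm m n).smul_left _).smul_right _ |>.sub_right (Commute.one_right _)).sub_left
      (Commute.one_left _)
  · simp only [smul_apply, sub_apply, one_apply_eq_self, hmul, hnorm]
  · simp only [smul_apply, sub_apply, one_apply_eq_self, hmul, hone]

/-- The Lumer–Phillips theorem: a dissipative operator on a Hilbert space whose shifts `r - A`,
`r > 0`, are all surjective generates a semigroup of contractions, the limit of the semigroups of
its Yosida approximations. -/
theorem IsDissipative.exists_semigroup [CompleteSpace E] (hA : IsDissipative A)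
    (hsurj : ∀ r : ℝ, 0 < r → ∀ y, ∃ x : A.domain, (r : ℂ) • (x : E) - A x = y) :
    ∃ T : ℝ≥0 → E →L[ℂ] E, IsC0Semigroup T ∧ (∀ t, ‖T t‖ ≤ 1) ∧ IsGenerator A T := by
  obtain ⟨B, hB, hcomm, hbound, hconv⟩ := hA.exists_yosida hsurj
  have hone : ∀ y, ∃ x : A.domain, (x : E) - A x = y := fun y => by
    obtain ⟨x, hx⟩ := hsurj 1 one_pos y
    exact ⟨x, by simpa using hx⟩
  have hdense := hA.dense_domain hone
  set S : ℕ → ℝ≥0 → E →L[ℂ] E := fun n t => NormedSpace.exp ((t : ℝ) • B n) with hSdef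
  have hS1 : ∀ n t x, ‖S n t x‖ ≤ ‖x‖ := fun n t x =>
    norm_exp_apply_le (fun z => re_inner_smul_apply_nonpos (hB n) t.2 z) x
  have hS2 : ∀ n m t x, ‖S n t x - S m t x‖ ≤ t * ‖B n x - B m x‖ := fun n m t x =>
    norm_exp_sub_exp_le (hcomm n m) (hB n) (hB m) t.2 x
  have hS3 : ∀ n t x, ‖S n t x - x‖ ≤ t * ‖B n x‖ := fun n t x => by
    have := norm_exp_sub_exp_le (C := 0) (Commute.zero_right (B n)) (hB n)
      (fun z => by simp) t.2 x
    simpa using this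
  have hcau : ∀ t x, CauchySeq fun n => S n t x := by
    intro t x
    rw [Metric.cauchySeq_iff]
    intro ε hε
    obtain ⟨d, hd, hdD⟩ := Metric.dense_iff.1 hdense x (ε / 3) (by positivity)
    have ht : 0 ≤ (t : ℝ) := t.2
    obtain ⟨N, hN⟩ := Metric.cauchySeq_iff.1 (hconv ⟨d, hdD⟩).cauchySeq (ε / (3 * (t + 1)))
      (by positivity)
    refine ⟨N, fun m hm n hn => ?_⟩
    have h1 := hN m hm n hn
    rw [dist_eq_norm, lt_div_iff₀ (by positivity)] at h1
    rw [Metric.mem_ball, dist_eq_norm, norm_sub_rev] at hd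
    have h2 := hS2 m n t d
    have h3 := hS1 m t (x - d)
    have h4 := hS1 n t (x - d)
    rw [map_sub] at h3 h4
    rw [dist_eq_norm]
    have e : S m t x - S n t x = (S m t x - S m t d) + (S m t d - S n t d)
      - (S n t x - S n t d) := by abel
    rw [e]
    calc _ ≤ ‖S m t x - S m t d‖ + ‖S m t d - S n t d‖ + ‖S n t x - S n t d‖ :=
          (norm_sub_le _ _).trans (by gcongr; exact norm_add_le _ _)
      _ < ε := by nlinarith [norm_nonneg (B m d - B n d)]
  choose L hL using fun t x => cauchySeq_tendsto_of_complete (hcau t x)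
  have hL1 : ∀ t x, ‖L t x‖ ≤ 1 * ‖x‖ := fun t x => by
    rw [one_mul]
    exact le_of_tendsto (hL t x).norm (Eventually.of_forall fun n => hS1 n t x)
  let T : ℝ≥0 → E →L[ℂ] E := fun t => LinearMap.mkContinuous
    { toFun := L t
      map_add' := fun x y => tendsto_nhds_unique (hL t (x + y)) (by
        simpa only [map_add] using (hL t x).add (hL t y))
      map_smul' := fun c x => tendsto_nhds_unique (hL t (c • x)) (by
        simp only [map_smul]
        exact (hL t x).const_smul c) } 1 (hL1 t)
  have hT : ∀ t x, Tendsto (fun n => S n t x) atTop (𝓝 (T t x)) := hL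
  have hT1 : ∀ t x, ‖T t x‖ ≤ ‖x‖ := fun t x => (hL1 t x).trans_eq (one_mul _)
  have hT3 : ∀ t (x : A.domain), ‖T t x - x‖ ≤ t * ‖A x‖ := fun t x =>
    le_of_tendsto ((hT t x).sub_const _).norm (Eventually.of_forall fun n =>
      (hS3 n t x).trans (mul_le_mul_of_nonneg_left (hbound n x) t.2))
  -- the remainder of the first-order expansion, with `A x` approximated by `z` in the domain
  have hT4 : ∀ h (x z : A.domain), ‖T h x - x - (h : ℝ) • A x‖ ≤
      (2 * ‖A x - z‖ + h * ‖A z‖) * h := by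
    intro h x z
    have hn : ∀ n, ‖S n h x - x - (h : ℝ) • B n x‖ ≤ (2 * ‖B n x - z‖ + h * ‖A z‖) * h := by
      intro n
      have hd : ∀ s : ℝ, HasDerivAt (fun s : ℝ => NormedSpace.exp (s • B n) (x : E) - s • B n x)
          (NormedSpace.exp (s • B n) (B n x) - B n x) s := fun s => by
        have h1 := (hasDerivAt_exp_smul_apply (B n) (x : E) s).sub
          ((hasDerivAt_id s).smul_const (B n x))
        rw [one_smul] at h1
        exact h1
      have := norm_image_sub_le_of_norm_deriv_le_segment' (a := 0) (b := (h : ℝ))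
        (C := 2 * ‖B n x - z‖ + h * ‖A z‖)
        (fun s _ => (hd s).hasDerivWithinAt) (fun s hs => ?_) h ⟨h.2, le_rfl⟩
      · simpa [hSdef, sub_right_comm] using this
      · lift s to ℝ≥0 using hs.1
        have e : S n s (B n x) - B n x = S n s (B n x - z) + (S n s z - z) - (B n x - z) := by
          rw [map_sub]; abel
        have h1 := hS1 n s (B n x - z)
        have h2 := (hS3 n s z).trans (mul_le_mul_of_nonneg_left (hbound n z) s.2)
        have h3 : (s : ℝ) * ‖A z‖ ≤ h * ‖A z‖ := by
          gcongr; exact hs.2.le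
        calc ‖S n s (B n x) - B n x‖ ≤ ‖S n s (B n x - z)‖ + ‖S n s z - z‖ + ‖B n x - z‖ := by
              rw [e]
              exact (norm_sub_le _ _).trans (by gcongr; exact norm_add_le _ _)
          _ ≤ _ := by linarith
    exact le_of_tendsto_of_tendsto (((hT h x).sub_const _).sub ((hconv x).const_smul (h : ℝ))).norm
      (((((hconv x).sub_const _).norm.const_mul 2).add_const _).mul_const _)
      (Eventually.of_forall hn)
  have hgen : ∀ x : A.domain, Tendsto (fun h : ℝ≥0 => (((h : ℝ) : ℂ)⁻¹) • (T h x - x)) (𝓝[>] 0)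
      (𝓝 (A x)) := by
    intro x
    rw [Metric.tendsto_nhds]
    intro ε hε
    obtain ⟨z, hz, hzD⟩ := Metric.dense_iff.1 hdense (A x) (ε / 4) (by positivity)
    rw [Metric.mem_ball, dist_eq_norm, norm_sub_rev] at hz
    have hlim : Tendsto (fun h : ℝ≥0 => (h : ℝ) * ‖A ⟨z, hzD⟩‖) (𝓝[>] 0) (𝓝 0) := by
      have : Continuous fun h : ℝ≥0 => (h : ℝ) * ‖A ⟨z, hzD⟩‖ := by fun_prop
      simpa using (this.tendsto 0).mono_left nhdsWithin_le_nhds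
    filter_upwards [hlim.eventually (gt_mem_nhds (half_pos hε)), self_mem_nhdsWithin] with h h1 h2
    have hpos : 0 < (h : ℝ) := h2
    have h3 := hT4 h x ⟨z, hzD⟩
    have e : (((h : ℝ) : ℂ)⁻¹) • (T h x - x) - A x
        = (((h : ℝ) : ℂ)⁻¹) • (T h x - x - (h : ℝ) • A x) := by
      rw [smul_sub _ (T h x - (x : E)), ← Complex.coe_smul, smul_smul, inv_mul_cancel₀, one_smul]
      exact_mod_cast hpos.ne'
    rw [dist_eq_norm, e, norm_smul, norm_inv, Complex.norm_real, Real.norm_of_nonneg hpos.le,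
      inv_mul_lt_iff₀ hpos]
    refine h3.trans_lt ?_
    rw [mul_comm]
    exact mul_lt_mul_of_pos_left (by linarith) hpos
  refine ⟨T, ⟨?_, ?_, ?_⟩, fun t => LinearMap.mkContinuous_norm_le _ zero_le_one _, ?_⟩
  · refine ContinuousLinearMap.ext fun x => tendsto_nhds_unique (hT 0 x) ?_
    simp [hSdef]
  · intro s t
    refine ContinuousLinearMap.ext fun x => tendsto_nhds_unique (hT (s + t) x) ?_
    have e : ∀ n, S n (s + t) x = S n s (S n t x) := fun n => by
      let _ : NormedAlgebra ℚ (E →L[ℂ] E) := .restrictScalars ℚ ℝ _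
      simp only [hSdef, NNReal.coe_add, add_smul]
      rw [NormedSpace.exp_add_of_commute (((Commute.refl (B n)).smul_left _).smul_right _)]
      rfl
    simp only [e]
    have h1 : Tendsto (fun n => S n s (S n t x - T t x)) atTop (𝓝 0) := by
      refine squeeze_zero_norm (fun n => hS1 n s _) ?_
      exact tendsto_iff_norm_sub_tendsto_zero.1 (hT t x)
    have h2 := h1.add (hT s (T t x))
    simp only [map_sub, sub_add_cancel, zero_add] at h2
    exact h2
  · refine tendsto_of_dense hdense (Eventually.of_forall fun t x y => ?_) fun x hx => ?_
    · rw [← map_sub]; exact hT1 t _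
    · rw [tendsto_iff_norm_sub_tendsto_zero]
      have : Continuous fun t : ℝ≥0 => (t : ℝ) * ‖A ⟨x, hx⟩‖ := by fun_prop
      exact squeeze_zero (fun _ => norm_nonneg _) (fun t => hT3 t ⟨x, hx⟩)
        (by simpa using this.tendsto 0)
  · intro x y
    rw [LinearPMap.mem_graph_iff]
    constructor
    · rintro ⟨d, rfl, rfl⟩
      exact hgen d
    · intro h
      -- the generator is dissipative and extends `A`, while `1 - A` is already surjective
      obtain ⟨d, hd⟩ := hone (x - y)
      have h1 := h.sub (hgen d)
      simp only [← smul_sub] at h1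
      have e1 : y - A d = x - d := by
        have : A d = d - (x - y) := by rw [← hd]; abel
        rw [this]; abel
      have e2 : ∀ t : ℝ≥0, T t x - x - (T t d - d) = T t (x - d) - (x - d) := fun t => by
        rw [map_sub]; abel
      simp only [e1, e2] at h1
      have h2 := (Complex.continuous_re.tendsto _).comp (h1.inner (𝕜 := ℂ)
        (tendsto_const_nhds (x := x - (d : E))))
      have h3 : (inner ℂ (x - (d : E)) (x - d)).re ≤ 0 := by
        refine le_of_tendsto h2 (Eventually.of_forall fun t => ?_)
        have h4 : (inner ℂ (T t (x - d)) (x - (d : E))).re ≤ ‖T t (x - d)‖ * ‖x - (d : E)‖ :=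
          re_inner_le_norm (𝕜 := ℂ) _ _
        have h5 : (inner ℂ (x - (d : E)) (x - d)).re = ‖x - (d : E)‖ ^ 2 :=
          inner_self_eq_norm_sq (𝕜 := ℂ) _
        have h6 := hT1 t (x - d)
        rw [Function.comp, inner_smul_left, ← Complex.ofReal_inv, Complex.conj_ofReal,
          Complex.re_ofReal_mul, inner_sub_left, Complex.sub_re, h5]
        refine mul_nonpos_of_nonneg_of_nonpos (inv_nonneg.2 t.2) ?_
        nlinarith [norm_nonneg (x - (d : E))]
      have h5 : (inner ℂ (x - (d : E)) (x - d)).re = ‖x - (d : E)‖ ^ 2 :=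
        inner_self_eq_norm_sq (𝕜 := ℂ) _
      have h6 : x - (d : E) = 0 := norm_eq_zero.1 (by nlinarith [norm_nonneg (x - (d : E))])
      refine ⟨d, (sub_eq_zero.1 h6).symm, ?_⟩
      rw [h6, sub_eq_zero] at e1
      exact e1.symm

/-- A uniformly stable semigroup `‖T t‖ ≤ M e^{-δt}` acts on an eigenvector of its generator by
`e^{λt}`, so that `Re λ ≤ -δ`. -/
theorem exists_pos_re_eigenvalue_le {T : ℝ≥0 → E →L[ℂ] E} (hT : IsC0Semigroup T)
    (hA : IsGenerator A T) (hs : UniformlyStable T) :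
    ∃ δ : ℝ, 0 < δ ∧ ∀ lam : ℂ, IsEigenvalue A lam → lam.re ≤ -δ := by
  obtain ⟨M, δ, hδ, hM⟩ := hs
  refine ⟨δ, hδ, fun lam ⟨x, hx0, hx⟩ => ?_⟩
  have hM' : ∀ t z, ‖T t z‖ ≤ |M| * ‖z‖ := fun t z => by
    refine (T t).le_of_opNorm_le ((hM t).trans ?_) z
    have h1 : Real.exp (-δ * t) ≤ 1 := Real.exp_le_one_iff.2 (by nlinarith [t.2])
    calc M * Real.exp (-δ * t) ≤ |M| * Real.exp (-δ * t) := by gcongr; exact le_abs_self M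
      _ ≤ |M| := mul_le_of_le_one_right (abs_nonneg _) h1
  let F : ℝ → E := fun s => T s.toNNReal x
  have hF : ∀ s u : ℝ, 0 ≤ s → s ≤ u →
      F u - F s = T s.toNNReal (T (u - s).toNNReal x - x) := by
    intro s u hs hu
    have e : u.toNNReal = s.toNNReal + (u - s).toNNReal := by
      rw [← Real.toNNReal_add hs (sub_nonneg.2 hu), add_sub_cancel]
    simp only [F, map_sub, e, hT.map_add]
    rfl
  have hcont : ContinuousOn F (Ici 0) := by
    intro s hs
    rw [ContinuousWithinAt, tendsto_iff_norm_sub_tendsto_zero]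
    have h1 : Tendsto (fun u : ℝ => |M| * ‖T |u - s|.toNNReal x - x‖) (𝓝[Ici 0] s) (𝓝 0) := by
      have h2 : Tendsto (fun u : ℝ => |u - s|.toNNReal) (𝓝[Ici 0] s) (𝓝 0) := by
        have : Continuous fun u : ℝ => |u - s|.toNNReal := by fun_prop
        simpa using (this.tendsto s).mono_left nhdsWithin_le_nhds
      have h3 := tendsto_iff_norm_sub_tendsto_zero.1 ((hT.tendsto_zero x).comp h2)
      simpa using h3.const_mul |M|
    refine squeeze_zero' (Eventually.of_forall fun _ => norm_nonneg _) ?_ h1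
    filter_upwards [self_mem_nhdsWithin] with u hu
    rcases le_total s u with h | h
    · rw [hF s u hs h, abs_of_nonneg (sub_nonneg.2 h)]; exact hM' _ _
    · rw [norm_sub_rev, hF u s hu h, abs_of_nonpos (sub_nonpos.2 h), neg_sub]; exact hM' _ _
  have hderiv : ∀ s : ℝ, 0 ≤ s → HasDerivWithinAt F (lam • F s) (Ici s) s := by
    intro s hs
    rw [hasDerivWithinAt_iff_tendsto_slope, Ici_sdiff_left]
    have h1 : Tendsto (fun u : ℝ => (u - s).toNNReal) (𝓝[>] s) (𝓝[>] 0) := by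
      refine tendsto_nhdsWithin_iff.2 ⟨?_, ?_⟩
      · have : Continuous fun u : ℝ => (u - s).toNNReal := by fun_prop
        simpa using (this.tendsto s).mono_left nhdsWithin_le_nhds
      · filter_upwards [self_mem_nhdsWithin] with u hu
        exact Real.toNNReal_pos.2 (sub_pos.2 hu)
    have h2 := ((T s.toNNReal).continuous.tendsto _).comp
      (((hA x (lam • (x : E))).1 ((LinearPMap.mem_graph_iff A).2 ⟨x, rfl, hx⟩)).comp h1)
    rw [map_smul] at h2
    refine h2.congr' ?_
    filter_upwards [self_mem_nhdsWithin] with u hu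
    have hu' : s ≤ u := le_of_lt hu
    rw [Function.comp, Function.comp, slope_def_module, hF s u hs hu', map_smul,
      Real.coe_toNNReal _ (sub_nonneg.2 hu'), ← Complex.ofReal_inv, Complex.coe_smul]
  have hexp : ∀ s : ℝ, HasDerivAt (fun s : ℝ => Complex.exp (-lam * s))
      (-lam * Complex.exp (-lam * s)) s := fun s => by
    have := (((hasDerivAt_id (s : ℂ)).const_mul (-lam)).cexp).comp_ofReal
    simpa [mul_comm] using this
  have hconst : ∀ t : ℝ, 0 ≤ t → Complex.exp (-lam * t) • F t = x := by
    intro t ht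
    have := constant_of_has_deriv_right_zero (a := 0) (b := t)
      (f := fun s : ℝ => Complex.exp (-lam * s) • F s)
      ((Continuous.continuousOn (by fun_prop)).smul (hcont.mono Icc_subset_Ici_self))
      (fun s hs => by
        have h := (hexp s).hasDerivWithinAt.smul (hderiv s hs.1)
        refine h.congr_deriv ?_
        rw [smul_smul, ← add_smul, mul_comm, ← add_mul, add_neg_cancel, zero_mul, zero_smul])
      t ⟨ht, le_rfl⟩
    simpa [F, hT.map_zero] using this
  have hxn : 0 < ‖(x : E)‖ := norm_pos_iff.2 hx0
  have hb : ∀ t : ℝ, 0 ≤ t → Real.exp ((lam.re + δ) * t) ≤ M := by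
    intro t ht
    have h1 := congrArg norm (hconst t ht)
    rw [norm_smul, Complex.norm_exp] at h1
    have h2 : ‖F t‖ ≤ M * Real.exp (-δ * t) * ‖(x : E)‖ := by
      have := (T t.toNNReal).le_of_opNorm_le (hM _) x
      rwa [Real.coe_toNNReal _ ht] at this
    have h3 : (-lam * t).re = -(lam.re * t) := by simp
    rw [h3] at h1
    have h4 : ‖(x : E)‖ ≤ Real.exp (-(lam.re * t)) * (M * Real.exp (-δ * t) * ‖(x : E)‖) := by
      rw [← h1]; gcongr; rwa [h1]
    have h5 : 1 ≤ Real.exp (-(lam.re * t)) * (M * Real.exp (-δ * t)) := by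
      refine le_of_mul_le_mul_right ?_ hxn
      rw [one_mul, mul_assoc]; exact h4
    have h6 : Real.exp ((lam.re + δ) * t)
        * (Real.exp (-(lam.re * t)) * (M * Real.exp (-δ * t))) = M := by
      have : Real.exp ((lam.re + δ) * t) * Real.exp (-(lam.re * t)) * Real.exp (-δ * t) = 1 := by
        rw [← Real.exp_add, ← Real.exp_add, ← Real.exp_zero]; congr 1; ring
      linear_combination M * this
    nlinarith [Real.exp_pos ((lam.re + δ) * t)]
  by_contra hlt
  push Not at hlt
  have hpos : 0 < lam.re + δ := by linarith
  have h1 := hb (|M| / (lam.re + δ)) (by positivity)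
  rw [mul_div_cancel₀ _ hpos.ne'] at h1
  have h2 := Real.add_one_le_exp |M|
  have h3 := le_abs_self M
  linarith

end LumerPhillips

/-! ### Calculus of weak derivatives -/

section Sobolev

theorem memLp_of_continuousOn {F : ℝ → ℂ} (hF : ContinuousOn F (Icc (0 : ℝ) 1)) :
    MemLp F 2 volI := by
  have h : MemLp F ⊤ volI := by
    obtain ⟨C, hC⟩ := isCompact_Icc.exists_bound_of_continuousOn hF
    refine memLp_top_of_bound ?_ C ?_
    · exact (hF.mono Ioo_subset_Icc_self).aestronglyMeasurable measurableSet_Ioo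
    · exact ae_restrict_of_forall_mem measurableSet_Ioo fun x hx => hC x (Ioo_subset_Icc_self hx)
  exact h.mono_exponent le_top

/-- The class in `L²(0,1)` of a function that is continuous on `[0,1]`. -/
noncomputable def ofCont (F : ℝ → ℂ) (hF : ContinuousOn F (Icc (0 : ℝ) 1)) : L2I :=
  (memLp_of_continuousOn hF).toLp F

theorem coeFn_ofCont {F : ℝ → ℂ} (hF : ContinuousOn F (Icc (0 : ℝ) 1)) :
    ofCont F hF =ᵐ[volI] F :=
  MemLp.coeFn_toLp _

theorem hasTrace_ofCont {F : ℝ → ℂ} (hF : ContinuousOn F (Icc (0 : ℝ) 1)) (x : ℝ) :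
    HasTrace (ofCont F hF) x (F x) :=
  ⟨F, hF, coeFn_ofCont hF, rfl⟩

theorem HasWeakDeriv.congr_ae {u g : L2I} {U G : ℝ → ℂ} (hU : u =ᵐ[volI] U) (hG : g =ᵐ[volI] G) :
    HasWeakDeriv u g ↔ ∀ φ : ℝ → ℝ, ContDiff ℝ ∞ φ → HasCompactSupport φ →
      tsupport φ ⊆ Ioo (0 : ℝ) 1 →
      ∫ x in Ioo (0 : ℝ) 1, deriv φ x • U x = - ∫ x in Ioo (0 : ℝ) 1, φ x • G x := by
  have e1 : ∀ φ : ℝ → ℝ, ∫ x in Ioo (0 : ℝ) 1, deriv φ x • u x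
      = ∫ x in Ioo (0 : ℝ) 1, deriv φ x • U x := fun φ =>
    integral_congr_ae (hU.mono fun x hx => by simp only [hx])
  have e2 : ∀ φ : ℝ → ℝ, ∫ x in Ioo (0 : ℝ) 1, φ x • g x
      = ∫ x in Ioo (0 : ℝ) 1, φ x • G x := fun φ =>
    integral_congr_ae (hG.mono fun x hx => by simp only [hx])
  simp only [HasWeakDeriv, e1, e2]

theorem hasWeakDeriv_const (c : ℂ) : HasWeakDeriv (ofCont (fun _ => c) continuousOn_const) 0 := by
  rw [HasWeakDeriv.congr_ae (coeFn_ofCont _) (Lp.coeFn_zero ℂ 2 volI)]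
  intro φ h1 h2 h3
  rw [integral_smul_const, setIntegral_eq_integral_of_forall_compl_eq_zero,
    integral_eq_zero_of_hasDerivAt_of_integrable (f := φ)
      (fun x => (h1.differentiable (by simp) x).hasDerivAt)]
  · simp
  · exact (h1.continuous_deriv (by simp)).integrable_of_hasCompactSupport h2.deriv
  · exact h1.continuous.integrable_of_hasCompactSupport h2
  · intro x hx
    exact zero_of_tsupport (tsupport_deriv_subset.trans h3) hx

/-- The primitive `x ↦ ∫₀ˣ g`. -/
noncomputable def prim (g : L2I) : L2I :=
  ofCont (fun x => ∫ t in (0 : ℝ)..x, g t) (continuousOn_primitive (integrable_coe g))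

theorem hasWeakDeriv_prim (g : L2I) : HasWeakDeriv (prim g) g := by
  rw [prim, HasWeakDeriv.congr_ae (coeFn_ofCont _) ae_eq_rfl]
  exact fun φ h1 h2 h3 => test_primitive (integrable_coe g) h1 h2 h3

theorem hasTrace_prim (g : L2I) (x : ℝ) : HasTrace (prim g) x (∫ t in (0 : ℝ)..x, g t) :=
  hasTrace_ofCont _ x

theorem hasTrace_zero_prim (g : L2I) : HasTrace (prim g) 0 0 := by
  simpa using hasTrace_prim g 0

/-- Continuously differentiable functions have their derivative as weak derivative. -/
theorem hasWeakDeriv_ofCont {F F' : ℝ → ℂ} (hF : ∀ x, HasDerivAt F (F' x) x)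
    (hF' : Continuous F') (h : ContinuousOn F (Icc 0 1)) :
    HasWeakDeriv (ofCont F h) (ofCont F' hF'.continuousOn) := by
  have h1 := (hasWeakDeriv_const (F 0)).add (hasWeakDeriv_prim (ofCont F' hF'.continuousOn))
  rw [zero_add] at h1
  convert h1 using 1
  refine Lp.ext ?_
  filter_upwards [coeFn_ofCont h, Lp.coeFn_add (ofCont (fun _ => F 0) continuousOn_const)
    (prim (ofCont F' hF'.continuousOn)), coeFn_ofCont (F := fun _ => F 0) continuousOn_const,
    coeFn_ofCont (continuousOn_primitive (integrable_coe (ofCont F' hF'.continuousOn))),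
    ae_restrict_mem measurableSet_Ioo] with x e1 e2 e3 e4 hx
  rw [e1, e2, Pi.add_apply, e3, prim, e4]
  have e5 : ∫ t in (0 : ℝ)..x, ofCont F' hF'.continuousOn t = ∫ t in (0 : ℝ)..x, F' t := by
    rw [intervalIntegral.integral_of_le hx.1.le, intervalIntegral.integral_of_le hx.1.le,
      integral_Ioc_eq_integral_Ioo, integral_Ioc_eq_integral_Ioo]
    exact integral_congr_ae (ae_restrict_of_ae_restrict_of_subset (Ioo_subset_Ioo_right hx.2.le)
      (coeFn_ofCont hF'.continuousOn))
  rw [e5, intervalIntegral.integral_eq_sub_of_hasDerivAt (fun t _ => hF t)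
    (hF'.intervalIntegrable _ _)]
  ring

/-- The product of an `L²` function with a function that is continuous on `[0,1]`. -/
noncomputable def cmul (φ : ℝ → ℂ) (hφ : Continuous φ) (u : L2I) : L2I :=
  MemLp.toLp (fun x => φ x * u x) (by
    obtain ⟨C, hC⟩ := isCompact_Icc.exists_bound_of_continuousOn (hφ.continuousOn (s := Icc 0 1))
    refine MemLp.of_le_mul (c := C) (Lp.memLp u)
      (hφ.aestronglyMeasurable.mul (Lp.memLp u).aestronglyMeasurable) ?_
    refine ae_restrict_of_forall_mem measurableSet_Ioo fun x hx => ?_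
    rw [norm_mul]
    gcongr
    exact hC x (Ioo_subset_Icc_self hx))

theorem coeFn_cmul {φ : ℝ → ℂ} (hφ : Continuous φ) (u : L2I) :
    cmul φ hφ u =ᵐ[volI] fun x => φ x * u x :=
  MemLp.coeFn_toLp _

theorem HasTrace.cmul {φ : ℝ → ℂ} (hφ : Continuous φ) {u : L2I} {x : ℝ} {c : ℂ}
    (h : HasTrace u x c) : HasTrace (cmul φ hφ u) x (φ x * c) := by
  obtain ⟨F, hF, hFu, rfl⟩ := h
  refine ⟨fun x => φ x * F x, hφ.continuousOn.mul hF, ?_, rfl⟩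
  filter_upwards [coeFn_cmul hφ u, hFu] with x h1 h2
  rw [h1, h2]

/-- The product rule with a smooth real factor `φ`: test `u` against `ψ φ`. -/
theorem HasWeakDeriv.smooth_mul {u g : L2I} (h : HasWeakDeriv u g) {φ : ℝ → ℝ}
    (hφ : ContDiff ℝ ∞ φ) :
    HasWeakDeriv (cmul (fun x => (φ x : ℂ)) (Complex.continuous_ofReal.comp hφ.continuous) u)
      (cmul (fun x => ((deriv φ x : ℝ) : ℂ))
        (Complex.continuous_ofReal.comp (hφ.continuous_deriv (by simp))) u
      + cmul (fun x => (φ x : ℂ)) (Complex.continuous_ofReal.comp hφ.continuous) g) := by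
  have hc := hφ.continuous
  have hc' := hφ.continuous_deriv (by simp)
  rw [HasWeakDeriv.congr_ae (coeFn_cmul _ _)
    ((Lp.coeFn_add _ _).trans ((coeFn_cmul _ _).add (coeFn_cmul _ _)))]
  intro ψ h1 h2 h3
  have hψ : Continuous ψ := h1.continuous
  have hψ' : Continuous (deriv ψ) := h1.continuous_deriv (by simp)
  have key := h (fun x => ψ x * φ x) (h1.mul hφ) h2.mul_right
    ((tsupport_mul_subset_left (f := ψ)).trans h3)
  have hd : ∀ x, deriv (fun x => ψ x * φ x) x = deriv ψ x * φ x + ψ x * deriv φ x := fun x =>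
    deriv_fun_mul (h1.differentiable (by simp) x) (hφ.differentiable (by simp) x)
  simp only [hd] at key
  have i1 : Integrable (fun x => (deriv ψ x * φ x) • u x) volI :=
    integrable_test_smul (integrable_coe u) (hψ'.mul hc) h2.deriv.mul_right
  have i2 : Integrable (fun x => (ψ x * deriv φ x) • u x) volI :=
    integrable_test_smul (integrable_coe u) (hψ.mul hc') h2.mul_right
  have i3 : Integrable (fun x => (ψ x * φ x) • g x) volI :=
    integrable_test_smul (integrable_coe g) (hψ.mul hc) h2.mul_right
  simp only [add_smul] at key
  rw [integral_add i1 i2] at key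
  have e1 : ∀ x, deriv ψ x • ((φ x : ℂ) * u x) = (deriv ψ x * φ x) • u x := fun x => by
    rw [mul_smul, ← Complex.real_smul]
  have e2 : ∀ x, ψ x • (((deriv φ x : ℝ) : ℂ) * u x + (φ x : ℂ) * g x)
      = (ψ x * deriv φ x) • u x + (ψ x * φ x) • g x := fun x => by
    rw [mul_smul, mul_smul, ← Complex.real_smul, ← Complex.real_smul, smul_add]
  simp only [Pi.add_apply, e1, e2]
  rw [integral_add i2 i3]
  linear_combination key

theorem continuous_cexp_mul (s : ℂ) : Continuous fun x : ℝ => Complex.exp (s * x) := by fun_prop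

/-- The product rule with the factor `e^{sx}`. -/
theorem HasWeakDeriv.cexp_mul {u g : L2I} (h : HasWeakDeriv u g) (s : ℂ) :
    HasWeakDeriv (cmul _ (continuous_cexp_mul s) u)
      (s • cmul _ (continuous_cexp_mul s) u + cmul _ (continuous_cexp_mul s) g) := by
  let φ : ℝ → ℝ := fun x => (Complex.exp (s * x)).re
  let χ : ℝ → ℝ := fun x => (Complex.exp (s * x)).im
  have hexp : ContDiff ℝ ∞ fun x : ℝ => Complex.exp (s * x) :=
    (contDiff_const.mul Complex.ofRealCLM.contDiff).cexp
  have hφ : ContDiff ℝ ∞ φ := Complex.reCLM.contDiff.comp hexp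
  have hχ : ContDiff ℝ ∞ χ := Complex.imCLM.contDiff.comp hexp
  have hder : ∀ x : ℝ, HasDerivAt (fun x : ℝ => Complex.exp (s * x)) (s * Complex.exp (s * x)) x :=
    fun x => by
      have := (((hasDerivAt_id (x : ℂ)).const_mul s).cexp).comp_ofReal
      simpa [mul_comm] using this
  have dφ : ∀ x, deriv φ x = (s * Complex.exp (s * x)).re := fun x =>
    (Complex.reCLM.hasFDerivAt.comp_hasDerivAt x (hder x)).deriv
  have dχ : ∀ x, deriv χ x = (s * Complex.exp (s * x)).im := fun x =>
    (Complex.imCLM.hasFDerivAt.comp_hasDerivAt x (hder x)).deriv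
  have h1 := (h.smooth_mul hφ).add ((h.smooth_mul hχ).smul Complex.I)
  have key : ∀ (w : L2I) (a : ℝ → ℂ) (b c : ℝ → ℝ) (ha : Continuous a)
      (hb : Continuous fun x => (b x : ℂ)) (hc : Continuous fun x => (c x : ℂ)),
      (∀ x, b x = (a x).re) → (∀ x, c x = (a x).im) →
      cmul _ hb w + Complex.I • cmul _ hc w = cmul a ha w := by
    intro w a b c ha hb hc hab hac
    refine Lp.ext ?_
    filter_upwards [Lp.coeFn_add (cmul _ hb w) (Complex.I • cmul _ hc w),
      Lp.coeFn_smul Complex.I (cmul _ hc w), coeFn_cmul hb w, coeFn_cmul hc w,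
      coeFn_cmul ha w] with x e1 e2 e3 e4 e5
    rw [e1, Pi.add_apply, e2, Pi.smul_apply, e3, e4, e5, hab, hac, smul_eq_mul]
    linear_combination (w x) * Complex.re_add_im (a x)
  have hsa : Continuous fun x : ℝ => s * Complex.exp (s * x) := by fun_prop
  have hs : s • cmul _ (continuous_cexp_mul s) u
      = cmul (fun x : ℝ => s * Complex.exp (s * x)) hsa u := by
    refine Lp.ext ?_
    filter_upwards [Lp.coeFn_smul s (cmul _ (continuous_cexp_mul s) u),
      coeFn_cmul (continuous_cexp_mul s) u, coeFn_cmul hsa u] with x e1 e2 e3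
    rw [e1, Pi.smul_apply, e2, e3, smul_eq_mul, mul_assoc]
  have cφ := Complex.continuous_ofReal.comp hφ.continuous
  have cχ := Complex.continuous_ofReal.comp hχ.continuous
  rw [hs, ← key u _ φ χ (continuous_cexp_mul s) cφ cχ (fun _ => rfl) (fun _ => rfl),
    ← key g _ φ χ (continuous_cexp_mul s) cφ cχ (fun _ => rfl) (fun _ => rfl),
    ← key u _ (deriv φ) (deriv χ) hsa
      (Complex.continuous_ofReal.comp (hφ.continuous_deriv (by simp)))
      (Complex.continuous_ofReal.comp (hχ.continuous_deriv (by simp))) dφ dχ]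
  convert h1 using 1
  rw [smul_add]; abel

/-- The first-order equation `u' = s u + h`, `u(0) = 0`, solved by `u = e^{sx} ∫₀ˣ e^{-st} h`. -/
theorem exists_firstOrder (s : ℂ) (h : L2I) :
    ∃ u : L2I, HasWeakDeriv u (s • u + h) ∧ HasTrace u 0 0 := by
  refine ⟨cmul _ (continuous_cexp_mul s) (prim (cmul _ (continuous_cexp_mul (-s)) h)), ?_, ?_⟩
  · have := (hasWeakDeriv_prim (cmul _ (continuous_cexp_mul (-s)) h)).cexp_mul s
    convert this using 2
    refine Lp.ext ?_
    filter_upwards [coeFn_cmul (continuous_cexp_mul s) (cmul _ (continuous_cexp_mul (-s)) h),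
      coeFn_cmul (continuous_cexp_mul (-s)) h] with x e1 e2
    rw [e1, e2, ← mul_assoc, ← Complex.exp_add]
    simp
  · simpa using (hasTrace_zero_prim (cmul _ (continuous_cexp_mul (-s)) h)).cmul
      (continuous_cexp_mul s)

/-- The second-order equation `u'' = s² u - f`, `u(0) = 0`, solved by the factorization
`(∂ + s)(∂ - s)`. -/
theorem exists_secondOrder (s : ℂ) (f : L2I) :
    ∃ u u' : L2I, HasWeakDeriv u u' ∧ HasWeakDeriv u' (s ^ 2 • u - f) ∧ HasTrace u 0 0 := by
  obtain ⟨w, hw, -⟩ := exists_firstOrder s (-f)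
  obtain ⟨u, hu, hu0⟩ := exists_firstOrder (-s) w
  refine ⟨u, _, hu, ?_, hu0⟩
  convert (hu.smul (-s)).add hw using 1
  module

/-- The solution `sinh(sx)` of the homogeneous equation `u'' = s² u`. -/
noncomputable def sinhL (s : ℂ) : L2I :=
  ofCont (fun x : ℝ => Complex.sinh (s * x)) (by fun_prop)

/-- The derivative `s cosh(sx)` of `sinh(sx)`. -/
noncomputable def coshL (s : ℂ) : L2I :=
  ofCont (fun x : ℝ => s * Complex.cosh (s * x)) (by fun_prop)

theorem hasWeakDeriv_sinhL (s : ℂ) : HasWeakDeriv (sinhL s) (coshL s) := by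
  refine hasWeakDeriv_ofCont (fun x => ?_) (by fun_prop) _
  have := (((hasDerivAt_id (x : ℂ)).const_mul s).csinh).comp_ofReal
  simpa [mul_comm] using this

theorem hasWeakDeriv_coshL (s : ℂ) : HasWeakDeriv (coshL s) (s ^ 2 • sinhL s) := by
  have h := hasWeakDeriv_ofCont (F := fun x : ℝ => s * Complex.cosh (s * x))
    (F' := fun x : ℝ => s ^ 2 * Complex.sinh (s * x)) (fun x => by
      have := ((((hasDerivAt_id (x : ℂ)).const_mul s).ccosh).const_mul s).comp_ofReal
      refine this.congr_deriv ?_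
      simp only [id, mul_one]; ring) (by fun_prop) (by fun_prop)
  have e : s ^ 2 • sinhL s
      = ofCont (fun x : ℝ => s ^ 2 * Complex.sinh (s * x)) (by fun_prop) := by
    refine Lp.ext ?_
    filter_upwards [Lp.coeFn_smul (s ^ 2) (sinhL s), coeFn_ofCont
      (F := fun x : ℝ => Complex.sinh (s * x)) (by fun_prop), coeFn_ofCont
      (F := fun x : ℝ => s ^ 2 * Complex.sinh (s * x)) (by fun_prop)] with x e1 e2 e3
    rw [e1, e3, Pi.smul_apply, sinhL, e2, smul_eq_mul]
  rw [e]
  exact h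

theorem hasTrace_sinhL (s : ℂ) (x : ℝ) : HasTrace (sinhL s) x (Complex.sinh (s * x)) :=
  hasTrace_ofCont _ x

theorem hasTrace_coshL (s : ℂ) (x : ℝ) : HasTrace (coshL s) x (s * Complex.cosh (s * x)) :=
  hasTrace_ofCont (F := fun x : ℝ => s * Complex.cosh (s * x)) _ x

theorem sinhL_ne_zero {s : ℂ} (hs : s ≠ 0) : sinhL s ≠ 0 := by
  intro h
  have h1 : coshL s = 0 := (h ▸ hasWeakDeriv_sinhL s).unique
    (by simpa using (hasWeakDeriv_sinhL s).smul 0)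
  have h2 := (hasTrace_coshL s 0).trace_eq zero_mem_Icc
  rw [h1, trace_zero zero_mem_Icc] at h2
  simp only [Complex.ofReal_zero, mul_zero, Complex.cosh_zero, mul_one] at h2
  exact hs h2.symm

/-! ### Integration by parts -/

theorem ibp_real {k l : ℝ → ℝ} (hk : IntervalIntegrable k volume 0 1)
    (hl : IntervalIntegrable l volume 0 1) (c d : ℝ) :
    ∫ x in (0 : ℝ)..1, (k x * (d + ∫ t in (0 : ℝ)..x, l t) + (c + ∫ t in (0 : ℝ)..x, k t) * l x)
      = (c + ∫ t in (0 : ℝ)..1, k t) * (d + ∫ t in (0 : ℝ)..1, l t) - c * d := by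
  have hK := hk.absolutelyContinuousOnInterval_intervalIntegral (c := 0) (by simp)
  have hL := hl.absolutelyContinuousOnInterval_intervalIntegral (c := 0) (by simp)
  have hc : ∀ c : ℝ, AbsolutelyContinuousOnInterval (fun _ : ℝ => c) 0 1 := fun c =>
    (contDiff_const (n := 1)).contDiffOn.absolutelyContinuousOnInterval
  have e := ((hc c).fun_add hK).integral_deriv_mul_eq_sub ((hc d).fun_add hL)
  simp only [intervalIntegral.integral_same, add_zero] at e
  rw [← e]
  refine intervalIntegral.integral_congr_ae ?_
  filter_upwards [hk.ae_hasDerivAt_integral, hl.ae_hasDerivAt_integral] with x h1 h2 hx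
  rw [((h1 (uIoc_subset_uIcc hx) 0 (by simp)).const_add c).deriv,
    ((h2 (uIoc_subset_uIcc hx) 0 (by simp)).const_add d).deriv]

theorem ibp_complex {k l : ℝ → ℂ} (hk : Integrable k volI) (hl : Integrable l volI) (c d : ℂ) :
    ∫ x in (0 : ℝ)..1, (k x * (d + ∫ t in (0 : ℝ)..x, l t) + (c + ∫ t in (0 : ℝ)..x, k t) * l x)
      = (c + ∫ t in (0 : ℝ)..1, k t) * (d + ∫ t in (0 : ℝ)..1, l t) - c * d := by
  have hk' := intervalIntegrable_of hk
  have hl' := intervalIntegrable_of hl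
  have hre : ∀ {w : ℝ → ℂ}, IntervalIntegrable w volume 0 1 →
      IntervalIntegrable (fun x => (w x).re) volume 0 1 := fun h =>
    ⟨Complex.reCLM.integrable_comp h.1, Complex.reCLM.integrable_comp h.2⟩
  have him : ∀ {w : ℝ → ℂ}, IntervalIntegrable w volume 0 1 →
      IntervalIntegrable (fun x => (w x).im) volume 0 1 := fun h =>
    ⟨Complex.imCLM.integrable_comp h.1, Complex.imCLM.integrable_comp h.2⟩
  have sub : ∀ {w : ℝ → ℂ}, IntervalIntegrable w volume 0 1 → ∀ x ∈ Icc (0 : ℝ) 1,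
      IntervalIntegrable w volume 0 x := fun h x hx =>
    h.mono_set (by rw [uIcc_of_le hx.1, uIcc_of_le zero_le_one]; exact Icc_subset_Icc_right hx.2)
  have pre : ∀ {w : ℝ → ℂ}, IntervalIntegrable w volume 0 1 → ∀ x ∈ Icc (0 : ℝ) 1,
      (∫ t in (0 : ℝ)..x, w t).re = ∫ t in (0 : ℝ)..x, (w t).re := fun h x hx =>
    (Complex.reCLM.intervalIntegral_comp_comm (sub h x hx)).symm
  have pim : ∀ {w : ℝ → ℂ}, IntervalIntegrable w volume 0 1 → ∀ x ∈ Icc (0 : ℝ) 1,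
      (∫ t in (0 : ℝ)..x, w t).im = ∫ t in (0 : ℝ)..x, (w t).im := fun h x hx =>
    (Complex.imCLM.intervalIntegral_comp_comm (sub h x hx)).symm
  have cont : ∀ {w : ℝ → ℝ} (a : ℝ), IntervalIntegrable w volume 0 1 →
      ContinuousOn (fun x => a + ∫ t in (0 : ℝ)..x, w t) (uIcc 0 1) := fun a h =>
    continuousOn_const.add
      (h.absolutelyContinuousOnInterval_intervalIntegral (c := 0) (by simp)).continuousOn
  have contC : ∀ {w : ℝ → ℂ} (a : ℂ), Integrable w volI →
      ContinuousOn (fun x => a + ∫ t in (0 : ℝ)..x, w t) (uIcc 0 1) := fun a h => by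
    rw [uIcc_of_le zero_le_one]
    exact continuousOn_const.add (continuousOn_primitive h)
  have hI : IntervalIntegrable (fun x => k x * (d + ∫ t in (0 : ℝ)..x, l t)
      + (c + ∫ t in (0 : ℝ)..x, k t) * l x) volume 0 1 :=
    (hk'.mul_continuousOn (contC d hl)).add (hl'.continuousOn_mul (contC c hk))
  have hR : ∀ {p q : ℝ → ℝ} (a b : ℝ), IntervalIntegrable p volume 0 1 →
      IntervalIntegrable q volume 0 1 → IntervalIntegrable (fun x =>
        p x * (b + ∫ t in (0 : ℝ)..x, q t) + (a + ∫ t in (0 : ℝ)..x, p t) * q x) volume 0 1 :=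
    fun a b hp hq => (hp.mul_continuousOn (cont b hq)).add (hq.continuousOn_mul (cont a hp))
  refine Complex.ext ?_ ?_
  · have h1 := Complex.reCLM.intervalIntegral_comp_comm hI
    simp only [Complex.reCLM_apply] at h1
    rw [← h1, Complex.sub_re, Complex.mul_re, Complex.mul_re, Complex.add_re, Complex.add_re,
      Complex.add_im, Complex.add_im, pre hk' 1 one_mem_Icc, pre hl' 1 one_mem_Icc,
      pim hk' 1 one_mem_Icc, pim hl' 1 one_mem_Icc]
    have e1 := ibp_real (hre hk') (hre hl') c.re d.re
    have e2 := ibp_real (him hk') (him hl') c.im d.im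
    have e3 := intervalIntegral.integral_sub (hR c.re d.re (hre hk') (hre hl'))
      (hR c.im d.im (him hk') (him hl'))
    rw [e1, e2] at e3
    rw [sub_sub_sub_comm, ← e3]
    refine intervalIntegral.integral_congr fun x hx => ?_
    rw [uIcc_of_le zero_le_one] at hx
    simp only [Complex.add_re, Complex.mul_re, Complex.add_im, pre hk' x hx, pre hl' x hx,
      pim hk' x hx, pim hl' x hx]
    ring
  · have h1 := Complex.imCLM.intervalIntegral_comp_comm hI
    simp only [Complex.imCLM_apply] at h1
    rw [← h1, Complex.sub_im, Complex.mul_im, Complex.mul_im, Complex.add_re, Complex.add_re,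
      Complex.add_im, Complex.add_im, pre hk' 1 one_mem_Icc, pre hl' 1 one_mem_Icc,
      pim hk' 1 one_mem_Icc, pim hl' 1 one_mem_Icc]
    have e1 := ibp_real (hre hk') (him hl') c.re d.im
    have e2 := ibp_real (him hk') (hre hl') c.im d.re
    have e3 := intervalIntegral.integral_add (hR c.re d.im (hre hk') (him hl'))
      (hR c.im d.re (him hk') (hre hl'))
    rw [e1, e2] at e3
    rw [add_sub_add_comm, ← e3]
    refine intervalIntegral.integral_congr fun x hx => ?_
    rw [uIcc_of_le zero_le_one] at hx
    simp only [Complex.add_re, Complex.mul_im, Complex.add_im, pre hk' x hx, pre hl' x hx,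
      pim hk' x hx, pim hl' x hx]
    ring

/-- A function of class `H¹` is its value at `0` plus the primitive of its weak derivative. -/
theorem HasWeakDeriv.ae_eq_trace_add_primitive {u g : L2I} (hu : HasWeakDeriv u g) :
    u =ᵐ[volI] (fun x => trace 0 u + ∫ t in (0 : ℝ)..x, g t) ∧
      trace 1 u = trace 0 u + ∫ t in (0 : ℝ)..1, g t := by
  obtain ⟨c, hc⟩ := hu.ae_eq_primitive
  have ht : ∀ x ∈ Icc (0 : ℝ) 1, trace x u = c + ∫ t in (0 : ℝ)..x, g t := fun x hx =>
    HasTrace.trace_eq hx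
      ⟨_, continuousOn_const.add (continuousOn_primitive (integrable_coe g)), hc, rfl⟩
  have h0 : trace 0 u = c := by simpa using ht 0 zero_mem_Icc
  rw [h0]
  exact ⟨hc, ht 1 one_mem_Icc⟩

/-- Integration by parts in `H¹(0,1)`. -/
theorem inner_add_inner_eq_boundary {u u' v v' : L2I} (hu : HasWeakDeriv u u')
    (hv : HasWeakDeriv v v') :
    inner ℂ u' v + inner ℂ u v' = starRingEnd ℂ (trace 1 u) * trace 1 v
      - starRingEnd ℂ (trace 0 u) * trace 0 v := by
  obtain ⟨hu1, hu2⟩ := hu.ae_eq_trace_add_primitive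
  obtain ⟨hv1, hv2⟩ := hv.ae_eq_trace_add_primitive
  have hconj : Integrable (fun x => starRingEnd ℂ (u' x)) volI :=
    Complex.conjCLE.toContinuousLinearMap.integrable_comp (integrable_coe u')
  have key := ibp_complex hconj (integrable_coe v') (starRingEnd ℂ (trace 0 u)) (trace 0 v)
  have hc : ∀ x : ℝ, ∫ t in (0 : ℝ)..x, starRingEnd ℂ (u' t)
      = starRingEnd ℂ (∫ t in (0 : ℝ)..x, u' t) := fun x => by
    simp only [intervalIntegral, integral_conj, map_sub]
  simp only [hc, ← map_add] at key
  rw [← hu2, ← hv2] at key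
  rw [← key, ← integral_Ioo_eq, L2.inner_def, L2.inner_def,
    ← integral_add (L2.integrable_inner u' v) (L2.integrable_inner u v')]
  refine integral_congr_ae ?_
  filter_upwards [hu1, hv1] with x h1 h2
  rw [← h1, ← h2]
  simp only [RCLike.inner_apply]
  ring

end Sobolev

/-! ### The energy space -/

section Energy

variable {p : Params}

namespace EnergySpace

theorem norm_sq_eq (U : EnergySpace p) : ‖U‖ ^ 2 = ‖U.v‖ ^ 2 + ‖wderiv U.u‖ ^ 2 + ‖U.z‖ ^ 2
    + p.a * ‖wderiv U.y‖ ^ 2 + p.γ * p.κ * ‖U.w‖ ^ 2 := by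
  have h : ‖U‖ ^ 2 = (inner ℂ U U).re := (inner_self_eq_norm_sq (𝕜 := ℂ) U).symm
  rw [h]
  show (inner ℂ U.v U.v + inner ℂ (wderiv U.u) (wderiv U.u) + inner ℂ U.z U.z
    + (p.a : ℂ) * inner ℂ (wderiv U.y) (wderiv U.y)
    + ((p.γ * p.κ : ℝ) : ℂ) * inner ℂ U.w U.w).re = _
  simp only [inner_self_eq_norm_sq_to_K]
  simp only [Complex.coe_algebraMap, ← Complex.ofReal_pow, ← Complex.ofReal_mul,
      ← Complex.ofReal_add, Complex.ofReal_re]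

theorem exists_clm {F : Type*} [NormedAddCommGroup F] [NormedSpace ℂ F] (f : EnergySpace p → F)
    (hadd : ∀ U V, f (U + V) = f U + f V) (hsmul : ∀ (c : ℂ) U, f (c • U) = c • f U)
    {c : ℝ} (hc : 0 < c) (h : ∀ U, c * ‖f U‖ ^ 2 ≤ ‖U‖ ^ 2) :
    ∃ g : EnergySpace p →L[ℂ] F, ∀ U, g U = f U := by
  refine ⟨LinearMap.mkContinuous { toFun := f, map_add' := hadd, map_smul' := hsmul } (√c)⁻¹
    fun U => ?_, fun U => rfl⟩
  rw [inv_mul_eq_div, le_div_iff₀ (Real.sqrt_pos.2 hc), mul_comm]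
  refine (sq_le_sq₀ (by positivity) (norm_nonneg _)).1 ?_
  rw [mul_pow, Real.sq_sqrt hc.le]
  exact h U

/-- The derivatives and the components without derivative are bounded functions of the element. -/
theorem exists_components (p : Params) : ∃ (cu cv cy cz : EnergySpace p →L[ℂ] L2I)
    (cw : EnergySpace p →L[ℂ] L2R), (∀ U, cu U = wderiv U.u) ∧ (∀ U, cv U = U.v) ∧
      (∀ U, cy U = wderiv U.y) ∧ (∀ U, cz U = U.z) ∧ ∀ U, cw U = U.w := by
  have ha := p.a_pos
  have hg := mul_pos p.γ_pos p.κ_pos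
  have key : ∀ U : EnergySpace p, 1 * ‖wderiv U.u‖ ^ 2 ≤ ‖U‖ ^ 2 ∧ 1 * ‖U.v‖ ^ 2 ≤ ‖U‖ ^ 2 ∧
      p.a * ‖wderiv U.y‖ ^ 2 ≤ ‖U‖ ^ 2 ∧ 1 * ‖U.z‖ ^ 2 ≤ ‖U‖ ^ 2 ∧
      p.γ * p.κ * ‖U.w‖ ^ 2 ≤ ‖U‖ ^ 2 := fun U => by
    rw [norm_sq_eq]
    have n1 : 0 ≤ p.a * ‖wderiv U.y‖ ^ 2 := by positivity
    have n2 : 0 ≤ p.γ * p.κ * ‖U.w‖ ^ 2 := by positivity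
    have n3 := sq_nonneg ‖wderiv U.u‖
    have n4 := sq_nonneg ‖U.v‖
    have n5 := sq_nonneg ‖U.z‖
    refine ⟨?_, ?_, ?_, ?_, ?_⟩ <;> linarith
  obtain ⟨cu, hu⟩ := exists_clm (p := p) (fun U => wderiv U.u)
    (fun U V => wderiv_add U.u_mem.1 V.u_mem.1) (fun c U => wderiv_smul c U.u_mem.1) one_pos
    fun U => (key U).1
  obtain ⟨cv, hv⟩ := exists_clm (p := p) v add_v smul_v one_pos fun U => (key U).2.1
  obtain ⟨cy, hy⟩ := exists_clm (p := p) (fun U => wderiv U.y)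
    (fun U V => wderiv_add U.y_mem.1 V.y_mem.1) (fun c U => wderiv_smul c U.y_mem.1) ha
    fun U => (key U).2.2.1
  obtain ⟨cz, hz⟩ := exists_clm (p := p) z add_z smul_z one_pos fun U => (key U).2.2.2.1
  obtain ⟨cw, hw⟩ := exists_clm (p := p) w add_w smul_w hg fun U => (key U).2.2.2.2
  exact ⟨cu, cv, cy, cz, cw, hu, hv, hy, hz, hw⟩

end EnergySpace

/-- The boundary values of an `H¹` function differ by the integral of its derivative, written as
an inner product with the constant function `1`. -/
theorem inner_one_eq_trace_sub {v v' : L2I} (hv : HasWeakDeriv v v') :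
    inner ℂ (ofCont (fun _ => (1 : ℂ)) continuousOn_const) v' = trace 1 v - trace 0 v := by
  have h := inner_add_inner_eq_boundary (hasWeakDeriv_const 1) hv
  rw [inner_zero_left, zero_add, (hasTrace_ofCont _ 1).trace_eq one_mem_Icc,
    (hasTrace_ofCont _ 0).trace_eq zero_mem_Icc] at h
  simpa using h

theorem prim_mem_H1L (g : L2I) : prim g ∈ H1L :=
  ⟨⟨g, hasWeakDeriv_prim g⟩, (hasTrace_zero_prim g).trace_eq zero_mem_Icc⟩

instance : CompleteSpace (EnergySpace p) := by
  refine Metric.complete_of_cauchySeq_tendsto fun U hU => ?_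
  obtain ⟨cu, cv, cy, cz, cw, hu, hv, hy, hz, hw⟩ := EnergySpace.exists_components p
  obtain ⟨g, hg⟩ := cauchySeq_tendsto_of_complete (cu.uniformContinuous.comp_cauchySeq hU)
  obtain ⟨v, hv'⟩ := cauchySeq_tendsto_of_complete (cv.uniformContinuous.comp_cauchySeq hU)
  obtain ⟨h, hh⟩ := cauchySeq_tendsto_of_complete (cy.uniformContinuous.comp_cauchySeq hU)
  obtain ⟨z, hz'⟩ := cauchySeq_tendsto_of_complete (cz.uniformContinuous.comp_cauchySeq hU)
  obtain ⟨w, hw'⟩ := cauchySeq_tendsto_of_complete (cw.uniformContinuous.comp_cauchySeq hU)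
  have hh1 : trace 1 (prim h) = 0 := by
    have h1 := inner_one_eq_trace_sub (hasWeakDeriv_prim h)
    rw [(hasTrace_zero_prim h).trace_eq zero_mem_Icc, sub_zero] at h1
    rw [← h1]
    refine tendsto_nhds_unique (tendsto_const_nhds.inner hh) ?_
    refine tendsto_const_nhds.congr fun n => ?_
    rw [Function.comp, hy, inner_one_eq_trace_sub (hasWeakDeriv_wderiv (U n).y_mem.1),
      (U n).y_mem.2.1, (U n).y_mem.2.2, sub_zero]
  let V : EnergySpace p := EnergySpace.mk ⟨prim g, prim_mem_H1L g⟩ v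
    ⟨prim h, (prim_mem_H1L h).1, (prim_mem_H1L h).2, hh1⟩ z w
  have eu : cu V = g := (hu V).trans (hasWeakDeriv_prim g).wderiv_eq
  have ey : cy V = h := (hy V).trans (hasWeakDeriv_prim h).wderiv_eq
  have ev : cv V = v := hv V
  have ez : cz V = z := hz V
  have ew : cw V = w := hw V
  refine ⟨V, ?_⟩
  rw [tendsto_iff_norm_sub_tendsto_zero]
  have hsq : Tendsto (fun n => ‖U n - V‖ ^ 2) atTop (𝓝 0) := by
    have e : ∀ n, ‖U n - V‖ ^ 2 = ‖cv (U n) - v‖ ^ 2 + ‖cu (U n) - g‖ ^ 2 + ‖cz (U n) - z‖ ^ 2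
        + p.a * ‖cy (U n) - h‖ ^ 2 + p.γ * p.κ * ‖cw (U n) - w‖ ^ 2 := fun n => by
      rw [EnergySpace.norm_sq_eq, ← hu, ← hv, ← hy, ← hz, ← hw, map_sub, map_sub, map_sub, map_sub,
        map_sub, eu, ey, ev, ez, ew]
    simp only [e]
    have t := fun {F : Type} [NormedAddCommGroup F] {f : ℕ → F} {x : F}
      (hf : Tendsto f atTop (𝓝 x)) => (tendsto_iff_norm_sub_tendsto_zero.1 hf).pow 2
    have := ((((t hv').add (t hg)).add (t hz')).add ((t hh).const_mul p.a)).add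
      ((t hw').const_mul (p.γ * p.κ))
    simpa using this
  have := hsq.sqrt
  simpa using this

/-! ### Dissipativity -/

theorem waveOp_apply (X : (waveOp p).domain) : waveOp p X = waveVal (X : EnergySpace p) X.2 := rfl

/-- `Re ⟪A U, U⟫ = -γ κ ∫ (ξ² + η) |ω|² ≤ 0`: the coupling terms cancel, and the boundary term of
the integration by parts is compensated by the term `v(1) μ` of the diffusion equation. -/
theorem waveOp_dissipative (p : Params) : IsDissipative (waveOp p) := by
  intro X
  rw [waveOp_apply]
  obtain ⟨U, hU⟩ := X
  have hU : InDomain p U := hU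
  simp only
  show (inner ℂ (wderiv (wderiv U.u) - (p.b : ℂ) • U.z) U.v + inner ℂ (wderiv U.v) (wderiv U.u)
    + inner ℂ ((p.a : ℂ) • wderiv (wderiv U.y) + (p.b : ℂ) • U.v) U.z
    + (p.a : ℂ) * inner ℂ (wderiv U.z) (wderiv U.y)
    + ((p.γ * p.κ : ℝ) : ℂ) * inner ℂ (hU.diffusion_memLp.toLp (diffusion p U)) U.w).re ≤ 0
  have hg := mul_pos p.γ_pos p.κ_pos
  set J : ℂ := ∫ ξ : ℝ, (p.μ ξ : ℂ) * U.w ξ with hJ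
  have h1 := inner_add_inner_eq_boundary (hasWeakDeriv_wderiv hU.u_mem.2)
    (hasWeakDeriv_wderiv hU.v_mem.1)
  rw [hU.v_mem.2, mul_zero, sub_zero] at h1
  have h2 := inner_add_inner_eq_boundary (hasWeakDeriv_wderiv hU.y_mem.2)
    (hasWeakDeriv_wderiv hU.z_mem.1)
  rw [hU.z_mem.2.1, hU.z_mem.2.2, mul_zero, mul_zero, sub_zero] at h2
  have h3 : trace 1 (wderiv U.u) = -((p.γ * p.κ : ℝ) : ℂ) * J := by
    linear_combination hU.boundary
  have h4 : (inner ℂ (hU.diffusion_memLp.toLp (diffusion p U)) U.w).re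
      ≤ (starRingEnd ℂ (trace 1 U.v) * J).re := by
    have i1 := L2.integrable_inner (𝕜 := ℂ) (hU.diffusion_memLp.toLp (diffusion p U)) U.w
    have i2 := hU.integrable_μ_mul.const_mul (starRingEnd ℂ (trace 1 U.v))
    rw [← sub_nonpos, ← Complex.sub_re, hJ, ← integral_const_mul, L2.inner_def,
      ← integral_sub i1 i2, ← RCLike.re_eq_complex_re]
    refine (integral_re (i1.sub i2)).symm.trans_le ?_
    refine integral_nonpos_of_ae ?_
    filter_upwards [hU.diffusion_memLp.coeFn_toLp] with ξ hξ
    simp only [Pi.sub_apply, hξ, RCLike.inner_apply, diffusion, map_add, map_mul,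
      map_neg, Complex.conj_ofReal,
      Pi.zero_apply]
    have e : U.w ξ * (-((ξ ^ 2 + p.η : ℝ) : ℂ) * starRingEnd ℂ (U.w ξ)
        + starRingEnd ℂ (trace 1 U.v) * (p.μ ξ : ℂ)) - starRingEnd ℂ (trace 1 U.v)
        * ((p.μ ξ : ℂ) * U.w ξ) = ((-(ξ ^ 2 + p.η) * Complex.normSq (U.w ξ) : ℝ) : ℂ) := by
      rw [Complex.ofReal_mul, Complex.normSq_eq_conj_mul_self]; push_cast; ring
    rw [e]
    show -(ξ ^ 2 + p.η) * Complex.normSq (U.w ξ) ≤ 0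
    have := p.η_nonneg
    have := Complex.normSq_nonneg (U.w ξ)
    nlinarith [mul_nonneg (add_nonneg (sq_nonneg ξ) p.η_nonneg) this]
  have r1 := congrArg Complex.re h1
  have r2 := congrArg Complex.re h2
  have s1 : (inner ℂ (wderiv U.v) (wderiv U.u)).re = (inner ℂ (wderiv U.u) (wderiv U.v)).re := by
    rw [← inner_conj_symm, Complex.conj_re]
  have s2 : (inner ℂ (wderiv U.z) (wderiv U.y)).re = (inner ℂ (wderiv U.y) (wderiv U.z)).re := by
    rw [← inner_conj_symm, Complex.conj_re]
  have s3 : (inner ℂ U.z U.v).re = (inner ℂ U.v U.z).re := by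
    rw [← inner_conj_symm, Complex.conj_re]
  have s4 : (starRingEnd ℂ (trace 1 (wderiv U.u)) * trace 1 U.v).re
      = -(p.γ * p.κ) * (starRingEnd ℂ (trace 1 U.v) * J).re := by
    rw [h3, map_mul, map_neg, Complex.conj_ofReal]
    simp only [Complex.mul_re, Complex.conj_re, Complex.conj_im, Complex.mul_im, Complex.neg_re,
      Complex.neg_im, Complex.ofReal_re, Complex.ofReal_im]
    ring
  rw [s4] at r1
  simp only [inner_add_left, inner_sub_left, inner_smul_left, Complex.conj_ofReal, Complex.add_re,
    Complex.sub_re, Complex.re_ofReal_mul, Complex.zero_re] at r1 r2 ⊢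
  rw [s1, s2, s3]
  have h5 := mul_le_mul_of_nonneg_left h4 hg.le
  have r3 := congrArg (p.a * ·) r2
  simp only [mul_zero, mul_add] at r3
  linarith

end Energy

/-! ### The resolvent equation -/

section Resolvent

variable {p : Params}

/-- The denominator `λ + ξ² + η` of the diffusive part of the resolvent. -/
noncomputable def den (p : Params) (lam : ℂ) (ξ : ℝ) : ℂ := lam + ((ξ ^ 2 + p.η : ℝ) : ℂ)

/-- `λ + ξ² + η` is bounded below by a multiple of `(1 + |ξ|)²`, so that `λ` lies off the
half-line `(-∞, -η]` on which the diffusive part is not invertible. -/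
def Admissible (p : Params) (lam : ℂ) : Prop :=
  ∃ c : ℝ, 0 < c ∧ ∀ ξ : ℝ, c * (1 + |ξ|) ^ 2 ≤ ‖den p lam ξ‖

/-- The symbol `∫ μ² / (λ + ξ² + η) dξ` of the boundary feedback. -/
noncomputable def feedback (p : Params) (lam : ℂ) : ℂ := ∫ ξ : ℝ, (p.μ ξ : ℂ) ^ 2 / den p lam ξ

theorem continuous_den (p : Params) (lam : ℂ) : Continuous (den p lam) := by
  unfold den; fun_prop

theorem measurable_μ (p : Params) : Measurable fun ξ : ℝ => (p.μ ξ : ℂ) := by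
  have : Measurable p.μ := by unfold Params.μ; fun_prop
  fun_prop

theorem Admissible.den_ne_zero {lam : ℂ} (h : Admissible p lam) (ξ : ℝ) : den p lam ξ ≠ 0 := by
  obtain ⟨c, hc, hb⟩ := h
  have : 0 < c * (1 + |ξ|) ^ 2 := by positivity
  exact norm_pos_iff.1 (this.trans_le (hb ξ))

theorem memLp_mul_of_bounded {m f : ℝ → ℂ} (hm : Measurable m) {C : ℝ} (hC : ∀ x, ‖m x‖ ≤ C)
    (hf : MemLp f 2 volume) : MemLp (fun x => m x * f x) 2 volume := by
  refine MemLp.of_le_mul (c := C) hf (hm.aestronglyMeasurable.mul hf.aestronglyMeasurable) ?_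
  refine ae_of_all _ fun x => ?_
  rw [norm_mul]
  gcongr
  exact hC x

theorem Admissible.exists_bound {lam : ℂ} (h : Admissible p lam) :
    ∃ C : ℝ, ∀ ξ : ℝ, (1 + |ξ|) ^ 2 / ‖den p lam ξ‖ ≤ C := by
  have h' := h
  obtain ⟨c, hc, hb⟩ := h
  refine ⟨1 / c, fun ξ => ?_⟩
  rw [div_le_div_iff₀ (norm_pos_iff.2 (h'.den_ne_zero ξ)) hc]
  linarith [hb ξ]

/-- Division by `λ + ξ² + η` gains two powers of `1 + |ξ|`. -/
theorem Admissible.memLp_div {lam : ℂ} (h : Admissible p lam) {f : ℝ → ℂ}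
    (hf : MemLp (fun ξ : ℝ => f ξ / ((1 + |ξ| : ℝ) : ℂ)) 2 volume) :
    MemLp (fun ξ => f ξ / den p lam ξ) 2 volume ∧
      MemLp (fun ξ : ℝ => ((|ξ| : ℝ) : ℂ) * (f ξ / den p lam ξ)) 2 volume := by
  obtain ⟨C, hC⟩ := h.exists_bound
  have hd : Measurable (den p lam) := (continuous_den p lam).measurable
  have hone : ∀ ξ : ℝ, (0 : ℝ) < 1 + |ξ| := fun ξ => by positivity
  have key : ∀ m : ℝ → ℂ, Measurable m → (∀ ξ, ‖m ξ‖ ≤ 1 + |ξ|) →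
      MemLp (fun ξ => m ξ * (f ξ / den p lam ξ)) 2 volume := by
    intro m hm hmb
    have h1 := memLp_mul_of_bounded (m := fun ξ => m ξ * ((1 + |ξ| : ℝ) : ℂ) / den p lam ξ)
      (by fun_prop) (C := C) (fun ξ => ?_) hf
    · refine h1.ae_eq (ae_of_all _ fun ξ => ?_)
      have hne : ((1 + |ξ| : ℝ) : ℂ) ≠ 0 := by exact_mod_cast (hone ξ).ne'
      have := h.den_ne_zero ξ
      field_simp
    · refine le_trans ?_ (hC ξ)
      rw [norm_div, norm_mul, Complex.norm_real, Real.norm_of_nonneg (hone ξ).le, sq]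
      have := hone ξ
      gcongr
      exact hmb ξ
  refine ⟨?_, key _ (by fun_prop) fun ξ => ?_⟩
  · have := key (fun _ => 1) measurable_const fun ξ => by
      rw [norm_one]; linarith [abs_nonneg ξ]
    simpa using this
  · rw [Complex.norm_real, Real.norm_of_nonneg (abs_nonneg ξ)]; linarith

theorem memLp_div_one_add_abs {f : ℝ → ℂ} (hf : MemLp f 2 volume) :
    MemLp (fun ξ : ℝ => f ξ / ((1 + |ξ| : ℝ) : ℂ)) 2 volume := by
  have := memLp_mul_of_bounded (m := fun ξ : ℝ => (((1 + |ξ| : ℝ) : ℂ))⁻¹) (by fun_prop) (C := 1)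
    (fun ξ => by
      rw [norm_inv, Complex.norm_real, Real.norm_of_nonneg (by positivity)]
      exact inv_le_one_of_one_le₀ (by linarith [abs_nonneg ξ])) hf
  simpa [div_eq_mul_inv, mul_comm] using this

theorem memLp_μ_div' (p : Params) :
    MemLp (fun ξ : ℝ => (p.μ ξ : ℂ) / ((1 + |ξ| : ℝ) : ℂ)) 2 volume := by
  simpa using memLp_μ_div p

/-- Products with the weight `μ` are integrable after division by `λ + ξ² + η`. -/
theorem Admissible.integrable_μ_mul_div {lam : ℂ} (h : Admissible p lam) {f : ℝ → ℂ}
    (hf : MemLp (fun ξ : ℝ => f ξ / ((1 + |ξ| : ℝ) : ℂ)) 2 volume) :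
    Integrable (fun ξ => (p.μ ξ : ℂ) * (f ξ / den p lam ξ)) volume := by
  obtain ⟨C, hC⟩ := h.exists_bound
  have hd : Measurable (den p lam) := (continuous_den p lam).measurable
  have hone : ∀ ξ : ℝ, (0 : ℝ) < 1 + |ξ| := fun ξ => by positivity
  have h1 := memLp_mul_of_bounded (m := fun ξ => ((1 + |ξ| : ℝ) : ℂ) ^ 2 / den p lam ξ)
    (by fun_prop) (C := C) (fun ξ => by
      rw [norm_div, norm_pow, Complex.norm_real, Real.norm_of_nonneg (hone ξ).le]
      exact hC ξ) hf
  refine (MemLp.integrable_mul (memLp_μ_div' p) h1).congr (ae_of_all _ fun ξ => ?_)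
  have hne : ((1 + |ξ| : ℝ) : ℂ) ≠ 0 := by exact_mod_cast (hone ξ).ne'
  have := h.den_ne_zero ξ
  simp only [Pi.mul_apply]
  field_simp

/-- Given a solution `(u, y)` of the second-order boundary value problem of the resolvent equation,
the other components are determined, and the resolvent equation holds. -/
theorem exists_resolvent_of_bvp (ha : p.a = 1) {lam : ℂ} (hlam : Admissible p lam)
    (F : EnergySpace p) {u u' y y' : L2I} (hu : HasWeakDeriv u u')
    (hu' : HasWeakDeriv u' (lam ^ 2 • u + (p.b * lam) • y - (F.v + lam • F.u + (p.b : ℂ) • F.y)))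
    (hy : HasWeakDeriv y y')
    (hy' : HasWeakDeriv y' (lam ^ 2 • y - (p.b * lam) • u - (F.z + lam • F.y - (p.b : ℂ) • F.u)))
    (hu0 : trace 0 u = 0) (hy0 : trace 0 y = 0) (hy1 : trace 1 y = 0)
    (hbc : trace 1 u' + (p.γ * p.κ : ℝ) * ((lam * trace 1 u - trace 1 F.u) * feedback p lam
      + ∫ ξ : ℝ, (p.μ ξ : ℂ) * (F.w ξ / den p lam ξ)) = 0) :
    ∃ X : (waveOp p).domain, (X : EnergySpace p).u = u ∧ (X : EnergySpace p).y = y ∧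
      lam • (X : EnergySpace p) - waveOp p X = F := by
  have huL : u ∈ H1L := ⟨⟨_, hu⟩, hu0⟩
  have hy00 : y ∈ H10 := ⟨⟨_, hy⟩, hy0, hy1⟩
  set v : L2I := lam • u - F.u with hv
  set z : L2I := lam • y - F.y with hz
  have hvL : v ∈ H1L := H1L.sub_mem (H1L.smul_mem lam huL) F.u_mem
  have hz0 : z ∈ H10 := H10.sub_mem (H10.smul_mem lam hy00) F.y_mem
  have hv1 : trace 1 v = lam * trace 1 u - trace 1 F.u := by
    have h1 := trace_add (H1.smul_mem lam huL.1) (H1.smul_mem (-1) F.u_mem.1) one_mem_Icc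
    rw [trace_smul lam huL.1 one_mem_Icc, trace_smul _ F.u_mem.1 one_mem_Icc] at h1
    rw [hv, sub_eq_add_neg, ← neg_one_smul ℂ, h1]; ring
  have hμ := hlam.memLp_div (memLp_μ_div' p)
  have hF := hlam.memLp_div (memLp_div_one_add_abs (Lp.memLp F.w))
  let W : ℝ → ℂ := fun ξ => F.w ξ / den p lam ξ + trace 1 v * ((p.μ ξ : ℂ) / den p lam ξ)
  have hW : MemLp W 2 volume := hF.1.add (hμ.1.const_mul _)
  let U : EnergySpace p := EnergySpace.mk ⟨u, huL⟩ v ⟨y, hy00⟩ z (hW.toLp W)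
  have hUw : U.w =ᵐ[volume] W := hW.coeFn_toLp
  have hdiff : diffusion p U =ᵐ[volume] fun ξ => lam * U.w ξ - F.w ξ := by
    filter_upwards [hUw] with ξ h1
    have hne := hlam.den_ne_zero ξ
    have e : den p lam ξ * U.w ξ = F.w ξ + trace 1 v * (p.μ ξ : ℂ) := by
      rw [h1]
      simp only [W]
      field_simp
    rw [den] at e
    show -((ξ ^ 2 + p.η : ℝ) : ℂ) * U.w ξ + trace 1 v * (p.μ ξ : ℂ) = _
    linear_combination -e
  have hdom : InDomain p U := by
    refine ⟨⟨⟨_, hu⟩, ?_⟩, ⟨⟨_, hy⟩, ?_⟩, hvL, hz0, ?_, ?_, ?_⟩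
    · show wderiv u ∈ H1
      rw [hu.wderiv_eq]; exact ⟨_, hu'⟩
    · show wderiv y ∈ H1
      rw [hy.wderiv_eq]; exact ⟨_, hy'⟩
    · exact (((Lp.memLp U.w).const_mul lam).sub (Lp.memLp F.w)).ae_eq hdiff.symm
    · show trace 1 (wderiv u) + _ = 0
      rw [hu.wderiv_eq, ← hbc, ← hv1]
      have e : ∫ ξ : ℝ, (p.μ ξ : ℂ) * U.w ξ = trace 1 v * feedback p lam
          + ∫ ξ : ℝ, (p.μ ξ : ℂ) * (F.w ξ / den p lam ξ) := by
        have i1 := hlam.integrable_μ_mul_div (memLp_μ_div' p)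
        have i2 := hlam.integrable_μ_mul_div (memLp_div_one_add_abs (Lp.memLp F.w))
        rw [feedback, ← integral_const_mul, ← integral_add ?_ i2]
        · refine integral_congr_ae ?_
          filter_upwards [hUw] with ξ h1
          rw [h1]; simp only [W]; ring
        · refine (i1.const_mul (trace 1 v)).congr (ae_of_all _ fun ξ => ?_)
          ring
      rw [e]
    · refine (hF.2.add (hμ.2.const_mul (trace 1 v))).ae_eq ?_
      filter_upwards [hUw] with ξ h1
      rw [h1]; simp only [W, Pi.add_apply]; ring
  refine ⟨⟨U, hdom⟩, rfl, rfl, ?_⟩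
  rw [sub_eq_iff_eq_add, waveOp_apply]
  have e1 : wderiv (wderiv U.u) = lam ^ 2 • u + (p.b * lam) • y
      - (F.v + lam • F.u + (p.b : ℂ) • F.y) := by
    show wderiv (wderiv u) = _
    rw [hu.wderiv_eq, hu'.wderiv_eq]
  have e2 : wderiv (wderiv U.y) = lam ^ 2 • y - (p.b * lam) • u
      - (F.z + lam • F.y - (p.b : ℂ) • F.u) := by
    show wderiv (wderiv y) = _
    rw [hy.wderiv_eq, hy'.wderiv_eq]
  refine EnergySpace.ext ?_ ?_ ?_ ?_ ?_
  · show lam • u = F.u + v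
    rw [hv]; abel
  · show lam • v = F.v + (wderiv (wderiv U.u) - (p.b : ℂ) • z)
    rw [e1, hv, hz]; module
  · show lam • y = F.y + z
    rw [hz]; abel
  · show lam • z = F.z + ((p.a : ℂ) • wderiv (wderiv U.y) + (p.b : ℂ) • v)
    rw [e2, ha, hv, hz, Complex.ofReal_one]; module
  · show lam • U.w = F.w + hdom.diffusion_memLp.toLp (diffusion p U)
    refine Lp.ext ?_
    filter_upwards [Lp.coeFn_smul lam U.w, Lp.coeFn_add F.w (hdom.diffusion_memLp.toLp _),
      hdom.diffusion_memLp.coeFn_toLp, hdiff] with ξ h1 h2 h3 h4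
    rw [h1, h2, Pi.add_apply, h3, h4, Pi.smul_apply, smul_eq_mul]; ring

/-- For equal wave speeds, `P = u + iy` and `Q = u - iy` decouple the system: they solve scalar
equations with `s₁² = λ² - ibλ` and `s₂² = λ² + ibλ`, and only the conditions at `1` couple them. -/
theorem exists_resolvent_of_decoupled (ha : p.a = 1) {lam s₁ s₂ : ℂ} (hlam : Admissible p lam)
    (hs₁ : s₁ ^ 2 = lam ^ 2 - Complex.I * p.b * lam)
    (hs₂ : s₂ ^ 2 = lam ^ 2 + Complex.I * p.b * lam)
    (F : EnergySpace p) {P P' Q Q' : L2I} (hP : HasWeakDeriv P P')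
    (hP' : HasWeakDeriv P' (s₁ ^ 2 • P - ((F.v + lam • F.u + (p.b : ℂ) • F.y)
      + Complex.I • (F.z + lam • F.y - (p.b : ℂ) • F.u))))
    (hQ : HasWeakDeriv Q Q')
    (hQ' : HasWeakDeriv Q' (s₂ ^ 2 • Q - ((F.v + lam • F.u + (p.b : ℂ) • F.y)
      - Complex.I • (F.z + lam • F.y - (p.b : ℂ) • F.u))))
    (hP0 : trace 0 P = 0) (hQ0 : trace 0 Q = 0) (h1 : trace 1 P = trace 1 Q)
    (hbc : trace 1 P' + trace 1 Q' + (p.γ * p.κ : ℝ) * ((lam * (trace 1 P + trace 1 Q)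
      - 2 * trace 1 F.u) * feedback p lam
      + 2 * ∫ ξ : ℝ, (p.μ ξ : ℂ) * (F.w ξ / den p lam ξ)) = 0) :
    ∃ X : (waveOp p).domain, (X : EnergySpace p).u = (1 / 2 : ℂ) • (P + Q) ∧
      (X : EnergySpace p).y = (-Complex.I / 2) • (P - Q) ∧
      lam • (X : EnergySpace p) - waveOp p X = F := by
  have hPm : P ∈ H1 := ⟨_, hP⟩
  have hQm : Q ∈ H1 := ⟨_, hQ⟩
  have hPm' : P' ∈ H1 := ⟨_, hP'⟩
  have hQm' : Q' ∈ H1 := ⟨_, hQ'⟩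
  have tu : ∀ {A B : L2I} (c d : ℂ), A ∈ H1 → B ∈ H1 → ∀ {x : ℝ}, x ∈ Icc (0 : ℝ) 1 →
      trace x (c • A + d • B) = c * trace x A + d * trace x B := fun c d hA hB x hx => by
    rw [trace_add (H1.smul_mem c hA) (H1.smul_mem d hB) hx, trace_smul c hA hx, trace_smul d hB hx]
  have eu : (1 / 2 : ℂ) • (P + Q) = (1 / 2 : ℂ) • P + (1 / 2 : ℂ) • Q := smul_add _ _ _
  have ey : (-Complex.I / 2) • (P - Q) = (-Complex.I / 2) • P + (Complex.I / 2) • Q := by module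
  rw [eu, ey]
  have hI : Complex.I ^ 2 = -1 := Complex.I_sq
  refine exists_resolvent_of_bvp ha hlam F ((hP.smul (1 / 2)).add (hQ.smul (1 / 2)))
    ?_ ((hP.smul (-Complex.I / 2)).add (hQ.smul (Complex.I / 2))) ?_ ?_ ?_ ?_ ?_
  · convert (hP'.smul (1 / 2)).add (hQ'.smul (1 / 2)) using 1
    rw [hs₁, hs₂]
    match_scalars <;> ring
  · convert (hP'.smul (-Complex.I / 2)).add (hQ'.smul (Complex.I / 2)) using 1
    rw [hs₁, hs₂]
    match_scalars <;> first
      | ring1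
      | linear_combination (-(lam * p.b) / 2) * hI
      | linear_combination -hI
      | linear_combination -lam * hI
      | linear_combination p.b * hI
  · rw [tu _ _ hPm hQm zero_mem_Icc, hP0, hQ0]; ring
  · rw [tu _ _ hPm hQm zero_mem_Icc, hP0, hQ0]; ring
  · rw [tu _ _ hPm hQm one_mem_Icc, h1]; ring
  · rw [tu _ _ hPm hQm one_mem_Icc, tu _ _ hPm' hQm' one_mem_Icc]
    linear_combination hbc / 2

theorem sinhL_mem_H1 (s : ℂ) : sinhL s ∈ H1 := ⟨_, hasWeakDeriv_sinhL s⟩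

theorem coshL_mem_H1 (s : ℂ) : coshL s ∈ H1 := ⟨_, hasWeakDeriv_coshL s⟩

theorem trace_zero_sinhL (s : ℂ) : trace 0 (sinhL s) = 0 := by
  rw [(hasTrace_sinhL s 0).trace_eq zero_mem_Icc]; simp

theorem trace_one_sinhL (s : ℂ) : trace 1 (sinhL s) = Complex.sinh s := by
  rw [(hasTrace_sinhL s 1).trace_eq one_mem_Icc]; simp

theorem trace_one_coshL (s : ℂ) : trace 1 (coshL s) = s * Complex.cosh s := by
  rw [(hasTrace_coshL s 1).trace_eq one_mem_Icc]; simp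

/-- The characteristic function: the determinant of the conditions at `1` on
`P = A sinh(s₁ x)` and `Q = B sinh(s₂ x)`. -/
noncomputable def charDet (p : Params) (lam s₁ s₂ : ℂ) : ℂ :=
  Complex.sinh s₁ * (s₂ * Complex.cosh s₂
      + (p.γ * p.κ : ℝ) * lam * feedback p lam * Complex.sinh s₂)
    + Complex.sinh s₂ * (s₁ * Complex.cosh s₁
      + (p.γ * p.κ : ℝ) * lam * feedback p lam * Complex.sinh s₁)

/-- A nontrivial solution `(A, B)` of the singular `2 × 2` boundary system gives the eigenvector
with diagonal components `A sinh (s₁ x)` and `B sinh (s₂ x)`. -/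
theorem isEigenvalue_of_charDet_eq_zero (ha : p.a = 1) {lam s₁ s₂ : ℂ} (hlam : Admissible p lam)
    (hs₁ : s₁ ^ 2 = lam ^ 2 - Complex.I * p.b * lam)
    (hs₂ : s₂ ^ 2 = lam ^ 2 + Complex.I * p.b * lam)
    (h₁ : s₁ ≠ 0) (h₂ : s₂ ≠ 0) (hD : charDet p lam s₁ s₂ = 0) :
    IsEigenvalue (waveOp p) lam := by
  set c : ℂ := (p.γ * p.κ : ℝ) * lam * feedback p lam with hc
  set k₁ : ℂ := s₁ * Complex.cosh s₁ + c * Complex.sinh s₁ with hk₁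
  set k₂ : ℂ := s₂ * Complex.cosh s₂ + c * Complex.sinh s₂ with hk₂
  have hD' : Complex.sinh s₁ * k₂ + Complex.sinh s₂ * k₁ = 0 := hD
  -- a nonzero vector in the kernel of the singular matrix
  obtain ⟨A, B, hAB, e1, e2⟩ : ∃ A B : ℂ, ¬ (A = 0 ∧ B = 0) ∧
      A * Complex.sinh s₁ = B * Complex.sinh s₂ ∧ A * k₁ + B * k₂ = 0 := by
    by_cases hk : k₁ = 0 ∧ k₂ = 0
    · by_cases hsh : Complex.sinh s₁ = 0 ∧ Complex.sinh s₂ = 0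
      · exact ⟨1, 0, by simp, by simp [hsh.1], by simp [hk.1]⟩
      · exact ⟨Complex.sinh s₂, Complex.sinh s₁, fun h => hsh ⟨h.2, h.1⟩, mul_comm _ _,
          by simp [hk.1, hk.2]⟩
    · exact ⟨k₂, -k₁, fun h => hk ⟨neg_eq_zero.1 h.2, h.1⟩, by linear_combination hD', by ring⟩
  have z : ∫ ξ : ℝ, (p.μ ξ : ℂ) * ((0 : L2R) ξ / den p lam ξ) = 0 := by
    refine integral_eq_zero_of_ae ?_
    filter_upwards [Lp.coeFn_zero ℂ 2 (volume : Measure ℝ)] with ξ h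
    rw [h, Pi.zero_apply, zero_div, mul_zero]
  obtain ⟨X, hu, hy, hX⟩ := exists_resolvent_of_decoupled ha hlam hs₁ hs₂ 0
    (P := A • sinhL s₁) (P' := A • coshL s₁) (Q := B • sinhL s₂) (Q' := B • coshL s₂)
    ((hasWeakDeriv_sinhL s₁).smul A)
    (by
      convert (hasWeakDeriv_coshL s₁).smul A using 1
      simp only [EnergySpace.zero_u, EnergySpace.zero_v, EnergySpace.zero_y, EnergySpace.zero_z]
      module)
    ((hasWeakDeriv_sinhL s₂).smul B)
    (by
      convert (hasWeakDeriv_coshL s₂).smul B using 1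
      simp only [EnergySpace.zero_u, EnergySpace.zero_v, EnergySpace.zero_y, EnergySpace.zero_z]
      module)
    (by rw [trace_smul _ (sinhL_mem_H1 _) zero_mem_Icc, trace_zero_sinhL, mul_zero])
    (by rw [trace_smul _ (sinhL_mem_H1 _) zero_mem_Icc, trace_zero_sinhL, mul_zero])
    (by rw [trace_smul _ (sinhL_mem_H1 _) one_mem_Icc, trace_smul _ (sinhL_mem_H1 _) one_mem_Icc,
      trace_one_sinhL, trace_one_sinhL, e1])
    (by
      rw [trace_smul _ (sinhL_mem_H1 _) one_mem_Icc, trace_smul _ (sinhL_mem_H1 _) one_mem_Icc,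
        trace_smul _ (coshL_mem_H1 _) one_mem_Icc,
        trace_smul _ (coshL_mem_H1 _) one_mem_Icc, trace_one_sinhL, trace_one_sinhL,
        trace_one_coshL, trace_one_coshL,
        EnergySpace.zero_u, trace_zero one_mem_Icc, EnergySpace.zero_w, z]
      rw [hk₁, hk₂, hc] at e2
      linear_combination e2)
  refine ⟨X, fun hX0 => hAB ?_, (sub_eq_zero.1 hX).symm⟩
  rw [hX0, EnergySpace.zero_u] at hu
  rw [hX0, EnergySpace.zero_y] at hy
  have e3 : A • sinhL s₁ = 0 := by
    have : A • sinhL s₁ = (1 / 2 : ℂ) • (A • sinhL s₁ + B • sinhL s₂)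
        + Complex.I • ((-Complex.I / 2) • (A • sinhL s₁ - B • sinhL s₂)) := by
      match_scalars
      · linear_combination (A / 2) * Complex.I_sq
      · linear_combination (-B / 2) * Complex.I_sq
    rw [this, ← hu, ← hy, smul_zero, add_zero]
  have e4 : B • sinhL s₂ = 0 := by
    have : B • sinhL s₂ = (2 : ℂ) • ((1 / 2 : ℂ) • (A • sinhL s₁ + B • sinhL s₂))
        - A • sinhL s₁ := by module
    rw [this, ← hu, e3, smul_zero, sub_zero]
  exact ⟨(smul_eq_zero.1 e3).resolve_right (sinhL_ne_zero h₁),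
    (smul_eq_zero.1 e4).resolve_right (sinhL_ne_zero h₂)⟩

/-- Add to a particular solution a combination of `sinh (s₁ x)` and `sinh (s₂ x)`; the two
boundary conditions at `1` then form a `2 × 2` system with determinant `charDet ≠ 0`, solved by
Cramer's rule. -/
theorem exists_resolvent_of_charDet_ne_zero (ha : p.a = 1) {lam s₁ s₂ : ℂ}
    (hlam : Admissible p lam)
    (hs₁ : s₁ ^ 2 = lam ^ 2 - Complex.I * p.b * lam)
    (hs₂ : s₂ ^ 2 = lam ^ 2 + Complex.I * p.b * lam)
    (hD : charDet p lam s₁ s₂ ≠ 0) (F : EnergySpace p) :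
    ∃ X : (waveOp p).domain, lam • (X : EnergySpace p) - waveOp p X = F := by
  set c : ℂ := (p.γ * p.κ : ℝ) * lam * feedback p lam with hc
  set k₁ : ℂ := s₁ * Complex.cosh s₁ + c * Complex.sinh s₁ with hk₁
  set k₂ : ℂ := s₂ * Complex.cosh s₂ + c * Complex.sinh s₂ with hk₂
  set D : ℂ := charDet p lam s₁ s₂
  have hD' : D = Complex.sinh s₁ * k₂ + Complex.sinh s₂ * k₁ := rfl
  -- particular solutions of the two scalar equations, corrected by homogeneous ones
  obtain ⟨P, P', hP, hP', hP0⟩ := exists_secondOrder s₁ ((F.v + lam • F.u + (p.b : ℂ) • F.y)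
      + Complex.I • (F.z + lam • F.y - (p.b : ℂ) • F.u))
  obtain ⟨Q, Q', hQ, hQ', hQ0⟩ := exists_secondOrder s₂ ((F.v + lam • F.u + (p.b : ℂ) • F.y)
      - Complex.I • (F.z + lam • F.y - (p.b : ℂ) • F.u))
  set r₁ : ℂ := trace 1 Q - trace 1 P with hr₁
  set r₂ : ℂ := -(trace 1 P' + trace 1 Q' + (p.γ * p.κ : ℝ) * ((lam * (trace 1 P + trace 1 Q)
      - 2 * trace 1 F.u) * feedback p lam
      + 2 * ∫ ξ : ℝ, (p.μ ξ : ℂ) * (F.w ξ / den p lam ξ))) with hr₂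
  set A : ℂ := (r₁ * k₂ + Complex.sinh s₂ * r₂) / D with hA
  set B : ℂ := (Complex.sinh s₁ * r₂ - k₁ * r₁) / D with hB
  have e1 : A * Complex.sinh s₁ - B * Complex.sinh s₂ = r₁ := by
    rw [hA, hB, div_mul_eq_mul_div, div_mul_eq_mul_div, ← sub_div, div_eq_iff hD, hD']; ring
  have e2 : A * k₁ + B * k₂ = r₂ := by
    rw [hA, hB, div_mul_eq_mul_div, div_mul_eq_mul_div, ← add_div, div_eq_iff hD, hD']; ring
  have tr : ∀ {x : ℝ} {f g : L2I} (d : ℂ), x ∈ Icc (0 : ℝ) 1 → f ∈ H1 → g ∈ H1 →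
      trace x (f + d • g) = trace x f + d * trace x g := fun d hx hf hg => by
    rw [trace_add hf (H1.smul_mem d hg) hx, trace_smul d hg hx]
  have mP : P ∈ H1 := ⟨_, hP⟩
  have mQ : Q ∈ H1 := ⟨_, hQ⟩
  have mP' : P' ∈ H1 := ⟨_, hP'⟩
  have mQ' : Q' ∈ H1 := ⟨_, hQ'⟩
  obtain ⟨X, -, -, hX⟩ := exists_resolvent_of_decoupled ha hlam hs₁ hs₂ F
    (P := P + A • sinhL s₁) (P' := P' + A • coshL s₁)
    (Q := Q + B • sinhL s₂) (Q' := Q' + B • coshL s₂)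
    (hP.add ((hasWeakDeriv_sinhL s₁).smul A))
    (by
      convert hP'.add ((hasWeakDeriv_coshL s₁).smul A) using 1
      module)
    (hQ.add ((hasWeakDeriv_sinhL s₂).smul B))
    (by
      convert hQ'.add ((hasWeakDeriv_coshL s₂).smul B) using 1
      module)
    (by rw [tr A zero_mem_Icc mP (sinhL_mem_H1 _),
      hP0.trace_eq zero_mem_Icc, trace_zero_sinhL]; ring)
    (by rw [tr B zero_mem_Icc mQ (sinhL_mem_H1 _),
      hQ0.trace_eq zero_mem_Icc, trace_zero_sinhL]; ring)
    (by
      rw [tr A one_mem_Icc mP (sinhL_mem_H1 _), tr B one_mem_Icc mQ (sinhL_mem_H1 _),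
        trace_one_sinhL, trace_one_sinhL]
      linear_combination e1 + hr₁)
    (by
      rw [tr A one_mem_Icc mP (sinhL_mem_H1 _), tr B one_mem_Icc mQ (sinhL_mem_H1 _),
        tr A one_mem_Icc mP' (coshL_mem_H1 _),
        tr B one_mem_Icc mQ' (coshL_mem_H1 _), trace_one_sinhL, trace_one_sinhL,
        trace_one_coshL, trace_one_coshL]
      rw [hk₁, hk₂, hc] at e2
      linear_combination e2 + hr₂)
  exact ⟨X, hX⟩

theorem admissible_of_pos (p : Params) {r : ℝ} (hr : 0 < r) : Admissible p r := by
  refine ⟨min r 1 / 2, by positivity, fun ξ => ?_⟩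
  have e : den p r ξ = ((r + (ξ ^ 2 + p.η) : ℝ) : ℂ) := by rw [den]; push_cast; rfl
  have hη := p.η_nonneg
  rw [e, Complex.norm_real, Real.norm_of_nonneg (by positivity)]
  have h1 : (1 + |ξ|) ^ 2 ≤ 2 * (1 + ξ ^ 2) := by
    rw [← sq_abs ξ]; nlinarith [sq_nonneg (1 - |ξ|)]
  have h2 : 0 < min r 1 := lt_min hr one_pos
  have h3 := min_le_left r 1
  have h4 := min_le_right r 1
  nlinarith [mul_le_mul_of_nonneg_left h1 h2.le, sq_nonneg ξ]

/-- Every `r > 0` lies in the resolvent set: by dissipativity it is not an eigenvalue, so the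
characteristic function does not vanish there. -/
theorem waveOp_surjective (ha : p.a = 1) {r : ℝ} (hr : 0 < r) (F : EnergySpace p) :
    ∃ X : (waveOp p).domain, (r : ℂ) • (X : EnergySpace p) - waveOp p X = F := by
  obtain ⟨s₁, hs₁⟩ := IsAlgClosed.exists_pow_nat_eq ((r : ℂ) ^ 2 - Complex.I * p.b * r) two_pos
  obtain ⟨s₂, hs₂⟩ := IsAlgClosed.exists_pow_nat_eq ((r : ℂ) ^ 2 + Complex.I * p.b * r) two_pos
  have hne : ∀ {s : ℂ} {c : ℝ}, s ^ 2 = (r : ℂ) ^ 2 + Complex.I * c * r → s ≠ 0 := by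
    rintro s c h rfl
    have h' := congrArg Complex.re h
    simp [sq] at h'
    exact hr.ne' h'
  have hadm := admissible_of_pos p hr
  refine exists_resolvent_of_charDet_ne_zero ha hadm hs₁ hs₂ (fun hD => ?_) F
  obtain ⟨X, hX0, hX⟩ := isEigenvalue_of_charDet_eq_zero ha hadm hs₁ hs₂
    (hne (c := -p.b) (by rw [hs₁]; push_cast; ring)) (hne hs₂) hD
  have h := (waveOp_dissipative p).mul_norm_le (r := r) X
  rw [hX, sub_self, norm_zero] at h
  have := mul_pos hr (norm_pos_iff.2 hX0)
  linarith

end Resolvent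

/-! ### Behaviour high up in a vertical strip -/

section Spectrum

variable {p : Params}

/-- The filter of `λ → i∞` within the strip `|Re λ| ≤ 1`. -/
def stripFilter : Filter ℂ := comap Complex.im atTop ⊓ 𝓟 {z | |z.re| ≤ 1}

instance : stripFilter.IsCountablyGenerated :=
  inferInstanceAs (IsCountablyGenerated (comap Complex.im atTop ⊓ 𝓟 {z | |z.re| ≤ 1}))

theorem eventually_stripFilter {P : ℂ → Prop} : (∀ᶠ z in stripFilter, P z) ↔
    ∃ T : ℝ, ∀ z : ℂ, |z.re| ≤ 1 → T ≤ z.im → P z := by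
  rw [stripFilter, eventually_inf_principal, eventually_comap, eventually_atTop]
  exact ⟨fun ⟨T, h⟩ => ⟨T, fun z h1 h2 => h z.im h2 z rfl h1⟩,
    fun ⟨T, h⟩ => ⟨T, fun t ht z hz h1 => h z h1 (by rw [hz]; exact ht)⟩⟩

theorem tendsto_im_stripFilter : Tendsto Complex.im stripFilter atTop :=
  tendsto_comap.mono_left inf_le_left

theorem tendsto_inv_stripFilter : Tendsto (fun z : ℂ => z⁻¹) stripFilter (𝓝 0) := by
  rw [tendsto_zero_iff_norm_tendsto_zero]
  refine squeeze_zero' (Eventually.of_forall fun _ => norm_nonneg _) ?_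
    tendsto_im_stripFilter.inv_tendsto_atTop
  filter_upwards [tendsto_im_stripFilter.eventually_gt_atTop 0] with z hz
  rw [norm_inv]
  exact inv_anti₀ hz ((le_abs_self _).trans (Complex.abs_im_le_norm z))

/-! ### The feedback symbol -/

theorem den_im (p : Params) (lam : ℂ) (ξ : ℝ) : (den p lam ξ).im = lam.im := by
  rw [den, Complex.add_im, Complex.ofReal_im, add_zero]

/-- On the strip `|Re λ| ≤ 1`, `Im λ ≥ 2`, the denominator dominates `(1 + |ξ|) ^ 2` uniformly in
`λ`. -/
theorem le_norm_den (p : Params) {lam : ℂ} (h1 : |lam.re| ≤ 1) (h2 : 2 ≤ lam.im) (ξ : ℝ) :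
    1 / 4 * (1 + |ξ|) ^ 2 ≤ ‖den p lam ξ‖ := by
  have a1 := Complex.abs_im_le_norm (den p lam ξ)
  have a2 := Complex.abs_re_le_norm (den p lam ξ)
  have e2 : (den p lam ξ).re = lam.re + (ξ ^ 2 + p.η) := by
    rw [den, Complex.add_re, Complex.ofReal_re]
  rw [den_im] at a1
  rw [e2] at a2
  have b1 := (le_abs_self _).trans a1
  have b2 := (le_abs_self _).trans a2
  have b3 := (abs_le.1 h1).1
  have hη := p.η_nonneg
  have : (1 + |ξ|) ^ 2 ≤ 2 * (1 + ξ ^ 2) := by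
    rw [← sq_abs ξ]; nlinarith [sq_nonneg (1 - |ξ|)]
  linarith

theorem admissible_of_strip (p : Params) {lam : ℂ} (h1 : |lam.re| ≤ 1) (h2 : 2 ≤ lam.im) :
    Admissible p lam :=
  ⟨1 / 4, by norm_num, le_norm_den p h1 h2⟩

theorem integrable_weight (p : Params) :
    Integrable (fun ξ : ℝ => 4 * (p.μ ξ ^ 2 / (1 + |ξ|) ^ 2)) volume := by
  have h := (memLp_μ_div p).integrable_norm_pow two_ne_zero
  refine (h.const_mul 4).congr (ae_of_all _ fun ξ => ?_)
  simp only [Complex.norm_real, Real.norm_eq_abs, sq_abs, div_pow]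

theorem norm_integrand_le (p : Params) {lam : ℂ} (h1 : |lam.re| ≤ 1) (h2 : 2 ≤ lam.im) (ξ : ℝ) :
    ‖(p.μ ξ : ℂ) ^ 2 / den p lam ξ‖ ≤ 4 * (p.μ ξ ^ 2 / (1 + |ξ|) ^ 2) := by
  have h := le_norm_den p h1 h2 ξ
  have hpos : (0 : ℝ) < (1 + |ξ|) ^ 2 := by positivity
  rw [norm_div, norm_pow, Complex.norm_real, Real.norm_eq_abs, sq_abs, ← mul_div_assoc,
    div_le_div_iff₀ (by linarith) hpos]
  nlinarith [sq_nonneg (p.μ ξ)]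

theorem measurable_integrand (p : Params) (lam : ℂ) :
    AEStronglyMeasurable (fun ξ : ℝ => (p.μ ξ : ℂ) ^ 2 / den p lam ξ) volume := by
  have h1 := (continuous_den p lam).measurable
  have h2 := measurable_μ p
  exact ((h2.pow_const 2).div h1).aestronglyMeasurable

theorem tendsto_feedback (p : Params) : Tendsto (feedback p) stripFilter (𝓝 0) := by
  have hs : ∀ᶠ z in stripFilter, |z.re| ≤ 1 ∧ 2 ≤ z.im :=
    eventually_stripFilter.2 ⟨2, fun z h1 h2 => ⟨h1, h2⟩⟩
  have h := tendsto_integral_filter_of_dominated_convergence (μ := (volume : Measure ℝ))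
    (l := stripFilter) (F := fun (z : ℂ) (ξ : ℝ) => (p.μ ξ : ℂ) ^ 2 / den p z ξ) (f := fun _ => 0)
    (fun ξ : ℝ => 4 * (p.μ ξ ^ 2 / (1 + |ξ|) ^ 2))
    (Eventually.of_forall fun z => measurable_integrand p z)
    (hs.mono fun z hz => ae_of_all _ (norm_integrand_le p hz.1 hz.2))
    (integrable_weight p) (ae_of_all _ fun ξ => ?_)
  · rw [integral_zero] at h
    exact h
  · rw [tendsto_zero_iff_norm_tendsto_zero]
    refine squeeze_zero' (Eventually.of_forall fun _ => norm_nonneg _) ?_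
      ((tendsto_const_nhds (x := p.μ ξ ^ 2)).div_atTop tendsto_im_stripFilter)
    filter_upwards [hs] with z hz
    rw [norm_div, norm_pow, Complex.norm_real, Real.norm_eq_abs, sq_abs]
    have h1 : z.im ≤ ‖den p z ξ‖ := by
      have := (le_abs_self _).trans (Complex.abs_im_le_norm (den p z ξ))
      rwa [den_im] at this
    exact div_le_div_of_nonneg_left (sq_nonneg _) (by linarith [hz.2]) h1

theorem differentiableAt_feedback (p : Params) {lam : ℂ} (h1 : |lam.re| < 1) (h2 : 2 < lam.im) :
    DifferentiableAt ℂ (feedback p) lam := by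
  have hopen : IsOpen {z : ℂ | |z.re| < 1 ∧ 2 < z.im} :=
    (isOpen_lt (continuous_abs.comp Complex.continuous_re) continuous_const).inter
      (isOpen_lt continuous_const Complex.continuous_im)
  have h := hasDerivAt_integral_of_dominated_loc_of_deriv_le (μ := (volume : Measure ℝ))
    (F := fun (z : ℂ) (ξ : ℝ) => (p.μ ξ : ℂ) ^ 2 / den p z ξ)
    (F' := fun (z : ℂ) (ξ : ℝ) => -((p.μ ξ : ℂ) ^ 2 / den p z ξ) / den p z ξ)
    (bound := fun ξ : ℝ => 4 * (p.μ ξ ^ 2 / (1 + |ξ|) ^ 2))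
    (hopen.mem_nhds (show lam ∈ {z : ℂ | |z.re| < 1 ∧ 2 < z.im} from ⟨h1, h2⟩))
    (Eventually.of_forall fun z => measurable_integrand p z)
    ((integrable_weight p).mono' (measurable_integrand p lam)
      (ae_of_all _ (norm_integrand_le p h1.le h2.le)))
    (((measurable_integrand p lam).aemeasurable.neg.div
      (continuous_den p lam).measurable.aemeasurable).aestronglyMeasurable)
    (ae_of_all _ fun ξ z hz => ?_) (integrable_weight p) (ae_of_all _ fun ξ z hz => ?_)
  · exact h.2.differentiableAt
  · rw [norm_div, norm_neg]
    refine (div_le_self (norm_nonneg _) ?_).trans (norm_integrand_le p hz.1.le hz.2.le ξ)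
    have := (le_abs_self _).trans (Complex.abs_im_le_norm (den p z ξ))
    rw [den_im] at this
    linarith [hz.2]
  · have hne := (admissible_of_strip p hz.1.le hz.2.le).den_ne_zero ξ
    have hd : HasDerivAt (fun z => den p z ξ) 1 z := (hasDerivAt_id z).add_const _
    have := (hasDerivAt_const z ((p.μ ξ : ℂ) ^ 2)).div hd hne
    refine this.congr_deriv ?_
    field_simp
    ring

/-! ### Asymptotics of the characteristic function -/

/-- The principal square root of `1 + c / λ`, so that `s = λ √(1 + c / λ)` has
`s² = λ² + c λ` and `s ≈ λ + c / 2` for large `λ`. -/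
noncomputable def root (c lam : ℂ) : ℂ := (1 + c / lam) ^ (2⁻¹ : ℂ)

theorem root_sq (c lam : ℂ) : root c lam ^ 2 = 1 + c / lam := by
  simp [root]

theorem mul_root_sq (c : ℂ) {lam : ℂ} (h : lam ≠ 0) :
    (lam * root c lam) ^ 2 = lam ^ 2 + c * lam := by
  rw [mul_pow, root_sq]; field_simp

theorem tendsto_div_stripFilter (c : ℂ) : Tendsto (fun z : ℂ => c / z) stripFilter (𝓝 0) := by
  simpa [div_eq_mul_inv] using tendsto_inv_stripFilter.const_mul c

theorem tendsto_root (c : ℂ) : Tendsto (root c) stripFilter (𝓝 1) := by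
  have h1 : ContinuousAt (fun z : ℂ => z ^ (2⁻¹ : ℂ)) 1 :=
    continuousAt_id.cpow continuousAt_const (by simp)
  have h2 : Tendsto (fun z : ℂ => 1 + c / z) stripFilter (𝓝 1) := by
    simpa using (tendsto_div_stripFilter c).const_add 1
  have h3 := h1.tendsto.comp h2
  rw [Complex.one_cpow] at h3
  exact h3

theorem eventually_ne_stripFilter : ∀ᶠ z : ℂ in stripFilter, z ≠ 0 := by
  filter_upwards [tendsto_im_stripFilter.eventually_gt_atTop 0] with z hz h
  rw [h, Complex.zero_im] at hz
  exact lt_irrefl _ hz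

theorem tendsto_mul_root_sub (c : ℂ) :
    Tendsto (fun z : ℂ => z * root c z - z) stripFilter (𝓝 (c / 2)) := by
  have h1 : Tendsto (fun z : ℂ => root c z + 1) stripFilter (𝓝 2) := by
    have := (tendsto_root c).add_const 1
    rwa [one_add_one_eq_two] at this
  have h2 : Tendsto (fun z : ℂ => c / (root c z + 1)) stripFilter (𝓝 (c / 2)) :=
    tendsto_const_nhds.div h1 two_ne_zero
  refine h2.congr' ?_
  filter_upwards [h1.eventually_ne two_ne_zero, eventually_ne_stripFilter] with z hz hz0
  rw [div_eq_iff hz]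
  have := root_sq c z
  field_simp at this
  linear_combination -this

theorem norm_sinh_le (z : ℂ) : ‖Complex.sinh z‖ ≤ Real.exp |z.re| := by
  have h1 : ‖Complex.exp z‖ ≤ Real.exp |z.re| := by
    rw [Complex.norm_exp]; exact Real.exp_le_exp.2 (le_abs_self _)
  have h2 : ‖Complex.exp (-z)‖ ≤ Real.exp |z.re| := by
    rw [Complex.norm_exp, Complex.neg_re]; exact Real.exp_le_exp.2 (neg_le_abs _)
  rw [Complex.sinh, norm_div, Complex.norm_two]
  linarith [norm_sub_le (Complex.exp z) (Complex.exp (-z))]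

theorem norm_cosh_le (z : ℂ) : ‖Complex.cosh z‖ ≤ Real.exp |z.re| := by
  have h1 : ‖Complex.exp z‖ ≤ Real.exp |z.re| := by
    rw [Complex.norm_exp]; exact Real.exp_le_exp.2 (le_abs_self _)
  have h2 : ‖Complex.exp (-z)‖ ≤ Real.exp |z.re| := by
    rw [Complex.norm_exp, Complex.neg_re]; exact Real.exp_le_exp.2 (neg_le_abs _)
  rw [Complex.cosh, norm_div, Complex.norm_two]
  linarith [norm_add_le (Complex.exp z) (Complex.exp (-z))]

/-- `λ √(1 + c / λ)` has bounded real part on the strip, so its hyperbolic functions are bounded. -/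
theorem exists_bound_hyperbolic (c : ℂ) : ∃ K : ℝ, ∀ᶠ z in stripFilter,
    ‖Complex.sinh (z * root c z)‖ ≤ K ∧ ‖Complex.cosh (z * root c z)‖ ≤ K := by
  refine ⟨Real.exp (1 + (‖c / 2‖ + 1)), ?_⟩
  have h1 := (tendsto_mul_root_sub c).norm.eventually (gt_mem_nhds (lt_add_one ‖c / 2‖))
  have h2 : ∀ᶠ z in stripFilter, |z.re| ≤ 1 := eventually_stripFilter.2 ⟨0, fun z h _ => h⟩
  filter_upwards [h1, h2] with z hz1 hz2
  have h3 : |(z * root c z).re| ≤ 1 + (‖c / 2‖ + 1) := by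
    have e : (z * root c z).re = z.re + (z * root c z - z).re := by
      rw [Complex.sub_re]; ring
    rw [e]
    refine (abs_add_le _ _).trans (add_le_add hz2 ?_)
    exact (Complex.abs_re_le_norm _).trans hz1.le
  exact ⟨(norm_sinh_le _).trans (Real.exp_le_exp.2 h3),
    (norm_cosh_le _).trans (Real.exp_le_exp.2 h3)⟩

/-- The characteristic function divided by `λ`. -/
noncomputable def charFun (p : Params) (lam : ℂ) : ℂ :=
  root (Complex.I * p.b) lam * (Complex.sinh (lam * root (-(Complex.I * p.b)) lam)
      * Complex.cosh (lam * root (Complex.I * p.b) lam))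
    + root (-(Complex.I * p.b)) lam * (Complex.cosh (lam * root (-(Complex.I * p.b)) lam)
      * Complex.sinh (lam * root (Complex.I * p.b) lam))
    + 2 * (p.γ * p.κ : ℝ) * feedback p lam * (Complex.sinh (lam * root (-(Complex.I * p.b)) lam)
      * Complex.sinh (lam * root (Complex.I * p.b) lam))

theorem charDet_eq_mul_charFun (p : Params) (lam : ℂ) :
    charDet p lam (lam * root (-(Complex.I * p.b)) lam) (lam * root (Complex.I * p.b) lam)
      = lam * charFun p lam := by
  rw [charDet, charFun]; ring

theorem tendsto_zero_mul_of_bounded {l : Filter ℂ} {f g : ℂ → ℂ} {K : ℝ}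
    (hf : Tendsto f l (𝓝 0)) (hg : ∀ᶠ z in l, ‖g z‖ ≤ K) :
    Tendsto (fun z => f z * g z) l (𝓝 0) :=
  hf.zero_mul_isBoundedUnder_le (isBoundedUnder_of_eventually_le hg)

/-- To leading order the characteristic function is that of the undamped, uncoupled system: the
shifts `∓ib/2` of `s₁`, `s₂` cancel in `sinh(s₁ + s₂)`, and the feedback tends to `0`. -/
theorem tendsto_charFun_sub (p : Params) :
    Tendsto (fun z => charFun p z - Complex.sinh (2 * z)) stripFilter (𝓝 0) := by
  set c : ℂ := Complex.I * p.b with hc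
  obtain ⟨K₁, hK₁⟩ := exists_bound_hyperbolic (-c)
  obtain ⟨K₂, hK₂⟩ := exists_bound_hyperbolic c
  have hK : ∀ᶠ z : ℂ in stripFilter, ‖Complex.sinh (2 * z)‖ ≤ Real.exp 2 ∧
      ‖Complex.cosh (2 * z)‖ ≤ Real.exp 2 := by
    refine eventually_stripFilter.2 ⟨0, fun z h _ => ?_⟩
    have h' : |(2 * z).re| ≤ 2 := by
      have e : (2 * z).re = 2 * z.re := by simp
      rw [e, abs_mul, abs_two]; linarith
    exact ⟨(norm_sinh_le _).trans (Real.exp_le_exp.2 h'),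
      (norm_cosh_le _).trans (Real.exp_le_exp.2 h')⟩
  have hprod : ∀ {f g : ℂ → ℂ} {K L : ℝ}, (∀ᶠ z in stripFilter, ‖f z‖ ≤ K) →
      (∀ᶠ z in stripFilter, ‖g z‖ ≤ L) → ∀ᶠ z in stripFilter, ‖f z * g z‖ ≤ K * L := by
    intro f g K L hf hg
    filter_upwards [hf, hg] with z h1 h2
    rw [norm_mul]
    exact mul_le_mul h1 h2 (norm_nonneg _) ((norm_nonneg _).trans h1)
  have hr₁ : Tendsto (fun z => root (-c) z - 1) stripFilter (𝓝 0) := by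
    simpa using (tendsto_root (-c)).sub_const 1
  have hr₂ : Tendsto (fun z => root c z - 1) stripFilter (𝓝 0) := by
    simpa using (tendsto_root c).sub_const 1
  have hδ : Tendsto (fun z => (z * root (-c) z - z) + (z * root c z - z)) stripFilter (𝓝 0) := by
    have := (tendsto_mul_root_sub (-c)).add (tendsto_mul_root_sub c)
    rwa [neg_div, neg_add_cancel] at this
  have hcosh : Tendsto (fun z => Complex.cosh ((z * root (-c) z - z) + (z * root c z - z)) - 1)
      stripFilter (𝓝 0) := by
    have := ((Complex.continuous_cosh.tendsto 0).comp hδ).sub_const 1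
    simpa using this
  have hsinh : Tendsto (fun z => Complex.sinh ((z * root (-c) z - z) + (z * root c z - z)))
      stripFilter (𝓝 0) := by
    have := (Complex.continuous_sinh.tendsto 0).comp hδ
    rwa [Complex.sinh_zero] at this
  have hfb : Tendsto (fun z => 2 * (p.γ * p.κ : ℝ) * feedback p z) stripFilter (𝓝 0) := by
    simpa using (tendsto_feedback p).const_mul (2 * (p.γ * p.κ : ℝ) : ℂ)
  have t1 := tendsto_zero_mul_of_bounded hr₂
    (hprod (hK₁.mono fun _ h => h.1) (hK₂.mono fun _ h => h.2))
  have t2 := tendsto_zero_mul_of_bounded hr₁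
    (hprod (hK₁.mono fun _ h => h.2) (hK₂.mono fun _ h => h.1))
  have t3 := tendsto_zero_mul_of_bounded hfb
    (hprod (hK₁.mono fun _ h => h.1) (hK₂.mono fun _ h => h.1))
  have t4 := tendsto_zero_mul_of_bounded hcosh (hK.mono fun _ h => h.1)
  have t5 := tendsto_zero_mul_of_bounded hsinh (hK.mono fun _ h => h.2)
  have t := (((t1.add t2).add t3).add t4).add t5
  simp only [add_zero] at t
  refine t.congr fun z => ?_
  have e1 := Complex.sinh_add (2 * z) ((z * root (-c) z - z) + (z * root c z - z))
  have e2 := Complex.sinh_add (z * root (-c) z) (z * root c z)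
  have e3 : 2 * z + ((z * root (-c) z - z) + (z * root c z - z))
      = z * root (-c) z + z * root c z := by ring
  rw [e3, e2] at e1
  rw [charFun]
  linear_combination -e1

theorem differentiableAt_root {c lam : ℂ} (h : ‖c / lam‖ < 1) (h0 : lam ≠ 0) :
    DifferentiableAt ℂ (root c) lam := by
  have h1 : 1 + c / lam ∈ Complex.slitPlane := by
    left
    have := (neg_le_abs _).trans (Complex.abs_re_le_norm (c / lam))
    rw [Complex.add_re, Complex.one_re]; linarith
  exact DifferentiableAt.cpow_const ((differentiableAt_const _).add
    ((differentiableAt_const _).div differentiableAt_id h0)) h1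

theorem root_ne_zero {c lam : ℂ} (h : ‖c / lam‖ < 1) : root c lam ≠ 0 := by
  intro h0
  have h1 := root_sq c lam
  rw [h0, sq, zero_mul] at h1
  have h2 : c / lam = -1 := by linear_combination -h1
  rw [h2, norm_neg, norm_one] at h
  exact lt_irrefl _ h

/-! ### Eigenvalues near the imaginary axis -/

theorem sinh_two_mul_ne_zero {w : ℂ} (h0 : w ≠ 0) (h1 : ‖w‖ < 1) : Complex.sinh (2 * w) ≠ 0 := by
  intro h
  have h2 : Complex.sin (2 * w * Complex.I) = 0 := by rw [Complex.sin_mul_I, h, zero_mul]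
  obtain ⟨k, hk⟩ := Complex.sin_eq_zero_iff.1 h2
  have h3 := congrArg norm hk
  rw [norm_mul, norm_mul, norm_mul, Complex.norm_I, Complex.norm_two, Complex.norm_intCast,
    Complex.norm_real, Real.norm_of_nonneg Real.pi_pos.le, mul_one] at h3
  have hk0 : k = 0 := by
    by_contra hne
    have h4 : (1 : ℝ) ≤ |(k : ℝ)| := by exact_mod_cast Int.one_le_abs hne
    nlinarith [Real.pi_gt_three]
  rw [hk0, Int.cast_zero, abs_zero, zero_mul] at h3
  exact h0 (norm_eq_zero.1 (by linarith))

theorem sinh_two_mul_add (m : ℕ) (w : ℂ) :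
    Complex.sinh (2 * ((m * Real.pi : ℝ) * Complex.I + w)) = Complex.sinh (2 * w) := by
  have e : 2 * (((m * Real.pi : ℝ) : ℂ) * Complex.I + w)
      = (m * (2 * Real.pi) : ℂ) * Complex.I + 2 * w := by push_cast; ring
  have hs : Complex.sin (m * (2 * Real.pi)) = 0 := by
    have := Complex.sin_nat_mul_pi (m * 2)
    rw [← this]; congr 1; push_cast; ring
  rw [e, Complex.sinh_add, Complex.sinh_mul_I, Complex.cosh_mul_I, hs,
    Complex.cos_nat_mul_two_pi]
  ring

/-- Eigenvalues exist arbitrarily far up and arbitrarily close to the imaginary axis: near `iπm`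
the characteristic function is a small perturbation of `sinh(2λ)`, and the quantitative open
mapping theorem provides a zero. -/
theorem exists_eigenvalue_near_imaginary_axis (ha : p.a = 1) {ε : ℝ} (hε : 0 < ε) (hε1 : ε < 1)
    (R : ℝ) : ∃ lam : ℂ, IsEigenvalue (waveOp p) lam ∧ |lam.re| ≤ ε ∧ R < lam.im := by
  obtain ⟨w₀, hw₀, hmin⟩ := (isCompact_sphere (0 : ℂ) ε).exists_isMinOn
    ⟨(ε : ℂ), by simp [abs_of_pos hε]⟩
    (f := fun w : ℂ => ‖Complex.sinh (2 * w)‖)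
    (Continuous.continuousOn (by have := Complex.continuous_sinh; fun_prop))
  set δ : ℝ := ‖Complex.sinh (2 * w₀)‖ with hδdef
  have hw₀n : ‖w₀‖ = ε := by simpa using hw₀
  have hδ : 0 < δ := norm_pos_iff.2 (sinh_two_mul_ne_zero
    (norm_pos_iff.1 (by rw [hw₀n]; exact hε)) (by rw [hw₀n]; exact hε1))
  have hev := ((tendsto_charFun_sub p).norm.eventually
    (gt_mem_nhds (show ‖(0 : ℂ)‖ < δ / 4 by rw [norm_zero]; positivity))).and
    (((tendsto_div_stripFilter (Complex.I * p.b)).norm.eventually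
      (gt_mem_nhds (show ‖(0 : ℂ)‖ < 1 by rw [norm_zero]; exact one_pos))).and
      eventually_ne_stripFilter)
  obtain ⟨T, hT⟩ := eventually_stripFilter.1 hev
  obtain ⟨m, hm⟩ := exists_nat_gt (max (max T R) 2 + 1)
  have hm1 : T + 1 < m := by
    linarith [(le_max_left T R).trans (le_max_left (max T R) 2)]
  have hm2 : R + 1 < m := by
    linarith [(le_max_right T R).trans (le_max_left (max T R) 2)]
  have hm3 : 2 + 1 < (m : ℝ) := by linarith [le_max_right (max T R) 2]
  set z₀ : ℂ := ((m * Real.pi : ℝ) : ℂ) * Complex.I with hz₀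
  have hz₀re : z₀.re = 0 := by simp [hz₀]
  have hz₀im : z₀.im = m * Real.pi := by
    rw [hz₀, Complex.im_ofReal_mul, Complex.I_im, mul_one]
  have hπ : (m : ℝ) ≤ m * Real.pi := by nlinarith [Real.pi_gt_three]
  have hball : ∀ z ∈ Metric.ball z₀ 1, |z.re| < 1 ∧ T < z.im ∧ R < z.im ∧ 2 < z.im := by
    intro z hz
    rw [Metric.mem_ball, dist_eq_norm] at hz
    have h1 := (Complex.abs_re_le_norm (z - z₀)).trans_lt hz
    have h2 := (Complex.abs_im_le_norm (z - z₀)).trans_lt hz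
    rw [Complex.sub_re, hz₀re, sub_zero] at h1
    rw [Complex.sub_im, hz₀im] at h2
    have h3 := (abs_lt.1 h2).1
    exact ⟨h1, by linarith, by linarith, by linarith⟩
  have hP := fun z hz => hT z (hball z hz).1.le (hball z hz).2.1.le
  have hneg : ∀ z : ℂ, ‖-(Complex.I * p.b) / z‖ = ‖Complex.I * p.b / z‖ := fun z => by
    rw [neg_div, norm_neg]
  have hdiff : DifferentiableOn ℂ (charFun p) (Metric.ball z₀ 1) := by
    intro z hz
    obtain ⟨-, h1, h2⟩ := hP z hz
    have d1 := differentiableAt_root h1 h2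
    have d2 := differentiableAt_root (c := -(Complex.I * p.b)) (by rw [hneg]; exact h1) h2
    have d3 := differentiableAt_feedback p (hball z hz).1 (hball z hz).2.2.2
    have s1 := (differentiableAt_id.mul d1).csinh
    have c1 := (differentiableAt_id.mul d1).ccosh
    have s2 := (differentiableAt_id.mul d2).csinh
    have c2 := (differentiableAt_id.mul d2).ccosh
    exact (((d1.mul (s2.mul c1)).add (d2.mul (c2.mul s1))).add
      ((d3.const_mul _).mul (s2.mul s1))).differentiableWithinAt
  have hsub : Metric.closedBall z₀ ε ⊆ Metric.ball z₀ 1 := Metric.closedBall_subset_ball hε1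
  have hz₀mem : z₀ ∈ Metric.ball z₀ 1 := Metric.mem_ball_self one_pos
  have hcenter : ‖charFun p z₀‖ < δ / 4 := by
    have h := (hP z₀ hz₀mem).1
    have h0 := sinh_two_mul_add m 0
    rw [add_zero, mul_zero, Complex.sinh_zero] at h0
    rwa [h0, sub_zero] at h
  have hsphere : ∀ z ∈ Metric.sphere z₀ ε, δ / 2 ≤ ‖charFun p z - charFun p z₀‖ := by
    intro z hz
    have h1 := (hP z (hsub (Metric.sphere_subset_closedBall hz))).1
    have h2 : δ ≤ ‖Complex.sinh (2 * z)‖ := by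
      have h3 := sinh_two_mul_add m (z - z₀)
      rw [← hz₀, add_sub_cancel] at h3
      rw [h3]
      refine hmin ?_
      rw [mem_sphere_zero_iff_norm, ← dist_eq_norm]
      exact hz
    have e : Complex.sinh (2 * z) = (charFun p z - charFun p z₀)
        - (charFun p z - Complex.sinh (2 * z)) + charFun p z₀ := by ring
    rw [e] at h2
    have h4 := norm_add_le ((charFun p z - charFun p z₀) - (charFun p z - Complex.sinh (2 * z)))
      (charFun p z₀)
    have h5 := norm_sub_le (charFun p z - charFun p z₀) (charFun p z - Complex.sinh (2 * z))
    linarith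
  have hfreq : ∃ᶠ z in 𝓝 z₀, charFun p z ≠ charFun p z₀ := by
    intro hcon
    have h1 := (hdiff.analyticOnNhd Metric.isOpen_ball).eqOn_of_preconnected_of_eventuallyEq
      (analyticOnNhd_const (v := charFun p z₀)) (convex_ball z₀ 1).isPreconnected hz₀mem
      (hcon.mono fun z hz => not_not.1 hz)
    have hmem : z₀ + ε ∈ Metric.sphere z₀ ε := by
      simp [abs_of_pos hε]
    have h2 := hsphere _ hmem
    rw [h1 (hsub (Metric.sphere_subset_closedBall hmem)), sub_self, norm_zero] at h2
    linarith
  have hcl : DiffContOnCl ℂ (charFun p) (Metric.ball z₀ ε) := by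
    refine DifferentiableOn.diffContOnCl ?_
    rw [closure_ball z₀ hε.ne']
    exact hdiff.mono hsub
  obtain ⟨lam, hlam, hzero⟩ := hcl.ball_subset_image_closedBall hε hsphere hfreq
    (show (0 : ℂ) ∈ Metric.ball (charFun p z₀) (δ / 2 / 2) by
      rw [Metric.mem_ball, dist_comm, dist_zero_right]; linarith)
  obtain ⟨b1, -, b3, b4⟩ := hball lam (hsub hlam)
  obtain ⟨-, n1, n2⟩ := hP lam (hsub hlam)
  refine ⟨lam, ?_, ?_, b3⟩
  · refine isEigenvalue_of_charDet_eq_zero ha (admissible_of_strip p b1.le b4.le)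
      ((mul_root_sq (-(Complex.I * p.b)) n2).trans (by ring)) (mul_root_sq (Complex.I * p.b) n2)
      (mul_ne_zero n2 (root_ne_zero (by rw [hneg]; exact n1)))
      (mul_ne_zero n2 (root_ne_zero n1)) ?_
    rw [charDet_eq_mul_charFun, hzero, mul_zero]
  · have h1 := Complex.abs_re_le_norm (lam - z₀)
    rw [Complex.sub_re, hz₀re, sub_zero] at h1
    exact h1.trans (by rw [← dist_eq_norm]; exact hlam)

/-- A sequence of distinct eigenvalues whose real parts tend to `0`. -/
theorem exists_seq_eigenvalue (ha : p.a = 1) : ∃ lam : ℕ → ℂ, Function.Injective lam ∧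
    (∀ n, IsEigenvalue (waveOp p) (lam n)) ∧ Tendsto (fun n => (lam n).re) atTop (𝓝 0) := by
  have hpos : ∀ n : ℕ, (0 : ℝ) < 1 / ((n : ℝ) + 2) := fun n => by positivity
  have hlt : ∀ n : ℕ, 1 / ((n : ℝ) + 2) < 1 := fun n => by
    rw [div_lt_one (by positivity)]; linarith [(n.cast_nonneg : (0 : ℝ) ≤ n)]
  choose f hf1 hf2 hf3 using fun n : ℕ =>
    exists_eigenvalue_near_imaginary_axis ha (hpos n) (hlt n) n
  have him : Tendsto (fun n => (f n).im) atTop atTop :=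
    tendsto_atTop_mono (fun n => (hf3 n).le) tendsto_natCast_atTop_atTop
  obtain ⟨φ, hφ, hφ'⟩ := strictMono_subseq_of_tendsto_atTop him
  have hre : Tendsto (fun n => (f n).re) atTop (𝓝 0) := by
    refine squeeze_zero_norm hf2 ?_
    exact tendsto_const_nhds.div_atTop
      (tendsto_atTop_add_const_right _ _ tendsto_natCast_atTop_atTop)
  exact ⟨f ∘ φ, fun a b hab => hφ'.injective (congrArg Complex.im hab), fun n => hf1 _,
    hre.comp hφ.tendsto_atTop⟩

end Spectrum

end FracWave

/-- Let `a = 1`, `η > 0` and `(SC1)`. The operator `A` generates a `C₀`-semigroup of contractions on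
the energy space; no `C₀`-semigroup generated by `A` is uniformly (exponentially) stable; and there
is a sequence of distinct eigenvalues of `A` whose real parts tend to `0`. -/
theorem theorem3p1 (p : FracWave.Params) (ha : p.a = 1) (hη : 0 < p.η) (hb : p.SC1) :
    (∃ T : ℝ≥0 → FracWave.EnergySpace p →L[ℂ] FracWave.EnergySpace p,
      FracWave.IsC0Semigroup T ∧ (∀ t, ‖T t‖ ≤ 1) ∧ FracWave.IsGenerator (FracWave.waveOp p) T) ∧
    (∀ T : ℝ≥0 → FracWave.EnergySpace p →L[ℂ] FracWave.EnergySpace p,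
      FracWave.IsC0Semigroup T → FracWave.IsGenerator (FracWave.waveOp p) T →
        ¬ FracWave.UniformlyStable T) ∧
    (∃ lam : ℕ → ℂ, Function.Injective lam ∧
      (∀ n, FracWave.IsEigenvalue (FracWave.waveOp p) (lam n)) ∧
      Tendsto (fun n => (lam n).re) atTop (𝓝 0)) := by
  obtain ⟨lam, hinj, heig, hlim⟩ := FracWave.exists_seq_eigenvalue ha
  refine ⟨(FracWave.waveOp_dissipative p).exists_semigroup
    fun r hr F => FracWave.waveOp_surjective ha hr F, fun T hT hA hs => ?_, lam, hinj, heig, hlim⟩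
  obtain ⟨δ, hδ, hle⟩ := FracWave.exists_pos_re_eigenvalue_le hT hA hs
  have := le_of_tendsto' hlim fun n => hle _ (heig n)
  linarith
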